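/- Work over $\mathbb C$. Formal binomials such as $(x_1-x_2)^n$ are expanded in nonnegative powers of the second variable, and $\delta(z)=\sum_{n\in\mathbb Z}z^n$. Consider a vector space $V$ with a vector $\mathbf 1$ and a linear map $Y(\cdot,x):V\to\mathrm{Hom}(V,V((x)))$ such that $Y(\mathbf 1,x)v=v$, $Y(v,x)\mathbf 1\in V[[x]]$ and $\lim_{x\to0}Y(v,x)\mathbf 1=v$ for all $v\in V$. It is a *nonlocal vertex algebra* if for all $u,v,w\in V$ there is $l\ge 0$ with $(x_0+x_2)^lY(u,x_0+x_2)Y(v,x_2)w=(x_0+x_2)^lY(Y(u,x_0)v,x_2)w$. A nonlocal vertex algebra is *nondegenerate* if for every $n\ge1$ the linear map $Z_n:V^{\otimes n}\otimes\mathbb C((x_1))\cdots((x_n))\to V((x_1))\cdots((x_n))$, $u_1\otimes\cdots\otimes u_n\otimes f\mapsto fY(u_1,x_1)\cdots Y(u_n,x_n)\mathbf 1$, is injective. It is a *weak quantum vertex algebra* if for all $u,v\in V$ there is $\sum_{i=1}^r v^{(i)}\otimes u^{(i)}\otimes f_i(x)\in V\otimes V\otimes\mathbb C((x))$ such that $$x_0^{-1}\delta\left(\frac{x_1-x_2}{x_0}\right)Y(u,x_1)Y(v,x_2)-x_0^{-1}\delta\left(\frac{x_2-x_1}{-x_0}\right)\sum_{i=1}^r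 f_i(-x_0)Y(v^{(i)},x_2)Y(u^{(i)},x_1)=x_2^{-1}\delta\left(\frac{x_1-x_0}{x_2}\right)Y(Y(u,x_0)v,x_2).\quad(*)$$ A *quantum vertex algebra* is a weak quantum vertex algebra together with a unitary rational quantum Yang–Baxter operator, that is, a linear map $\mathcal S(x):V\otimes V\to V\otimes V\otimes\mathbb C((x))$ with $\mathcal S_{21}(-x)\mathcal S(x)=1$ and $\mathcal S_{12}(x)\mathcal S_{13}(x+z)\mathcal S_{23}(z)=\mathcal S_{23}(z)\mathcal S_{13}(x+z)\mathcal S_{12}(x)$, such that $(*)$ holds for all $u,v\in V$ with $\sum_i v^{(i)}\otimes u^{(i)}\otimes f_i(x)=\mathcal S(x)(v\otimes u)$. **Proposition.** Let $\mathfrak g$ be a Lie algebra of countable (possibly finite) dimension over $\mathbb C$, let $V=U(\mathfrak g\otimes t^{-1}\mathbb C[t^{-1}])$, and let $d$ be the derivation of the algebra $V$ that extends the derivation $1\otimes d/dt$ of $\mathfrak g\otimes t^{-1}\mathbb C[t^{-1}]$. Then $V$, with $\mathbf 1=1$ and $Y(a,x)b=(e^{xd}a)b$ for $a,b\in V$,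 is a nondegenerate nonlocal vertex algebra, and there is a unique $\mathcal S$ for which it is a quantum vertex algebra. If $\mathfrak g$ is not abelian, then this quantum Yang–Baxter operator is nontrivial: $\mathcal S(x)$ is not the identity operator $v\otimes u\mapsto v\otimes u\otimes1$. -/

import Mathlib

open scoped TensorProduct PowerSeries LaurentPolynomial

noncomputable section

namespace QuantumVA

/-! ### Formal series -/

/-- `V((x))`: formal Laurent series `∑ vₙ xⁿ` with coefficients in `V`, truncated from below. -/
abbrev Laurent (V : Type*) [Zero V] : Type _ := HahnSeries ℤ V

/-- The coefficientwise `ℂ`-algebra structure of `ℂ((x))`. -/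
instance laurentAlgebra : Algebra ℂ (Laurent ℂ) := HahnSeries.instAlgebra

/-- The coefficientwise `ℂ`-algebra structure of `ℂ((x))((z))`. -/
instance laurentLaurentAlgebra : Algebra ℂ (Laurent (Laurent ℂ)) := HahnSeries.instAlgebra

/-- The substitution `f(x) ↦ f(-x)` on `ℂ((x))`. -/
def evalNeg : Laurent ℂ →ₗ[ℂ] Laurent ℂ where
  toFun f :=
    { coeff := fun n => (-1 : ℂ) ^ n * f.coeff n
      isPWO_support' := f.isPWO_support'.mono fun n hn => right_ne_zero_of_mul hn }
  map_add' f g := by ext n; simp [mul_add]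
  map_smul' c f := by ext n; simp [mul_left_comm]

/-- The embedding `f ↦ f(x)` of one-variable Laurent series into `ℂ((x))((z))`. -/
def inX : Laurent ℂ →ₗ[ℂ] Laurent (Laurent ℂ) where
  toFun f := HahnSeries.single 0 f
  map_add' f g := by simp
  map_smul' c f := by
    ext n : 2
    by_cases h : n = 0 <;> simp [h]

/-- The embedding `f ↦ f(z)` of one-variable Laurent series into `ℂ((x))((z))`: each
coefficient becomes a constant series in `x`. -/
def inZ : Laurent ℂ →ₗ[ℂ] Laurent (Laurent ℂ) where
  toFun f :=
    { coeff := fun n => HahnSeries.single 0 (f.coeff n)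
      isPWO_support' := f.isPWO_support'.mono fun n hn h => hn (by simp [h]) }
  map_add' f g := by ext n; simp
  map_smul' c f := by
    ext n m
    by_cases h : m = 0 <;> simp [h]

/-- The substitution `f ↦ f(x + z)` of `ℂ((x))` into `ℂ((x))((z))`, with `x + z` expanded in
nonnegative powers of `z`: the coefficient of `zⁱ`, `i ≥ 0`, is the divided derivative
`f⁽ⁱ⁾(x) / i!`. -/
def inXaddZ : Laurent ℂ →ₗ[ℂ] Laurent (Laurent ℂ) where
  toFun f := HahnSeries.ofSuppBddBelow
    (fun i : ℤ => if 0 ≤ i then LaurentSeries.hasseDeriv ℂ i.toNat f else 0)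
    ⟨0, fun i hi => by by_contra h; exact hi (if_neg h)⟩
  map_add' f g := by
    ext i : 2
    by_cases h : 0 ≤ i <;> simp [HahnSeries.ofSuppBddBelow, h]
  map_smul' c f := by
    ext i : 2
    by_cases h : 0 ≤ i <;> simp [HahnSeries.ofSuppBddBelow, h]

/-! ### Nonlocal vertex algebras and weak quantum vertex algebras -/

section VertexAlgebras

variable {V : Type*} [AddCommGroup V] [Module ℂ V]

/-- A state-field map `Y(·, x) : V → Hom(V, V((x)))`; `Y u w` is the series `Y(u, x) w`. -/
abbrev StateField (V : Type*) [AddCommGroup V] [Module ℂ V] : Type _ :=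
  V →ₗ[ℂ] V →ₗ[ℂ] Laurent V

/-- The modes `uₙ` in `Y(u, x) w = ∑ₙ (uₙ w) x⁻ⁿ⁻¹`. -/
def mode (Y : StateField V) (u : V) (n : ℤ) (w : V) : V :=
  (Y u w).coeff (-n - 1)

/-- `Y(𝟏, x) v = v`, `Y(v, x) 𝟏 ∈ V[[x]]` and `lim_{x → 0} Y(v, x) 𝟏 = v`. -/
structure VacuumAxioms (Y : StateField V) (vac : V) : Prop where
  vacuum : ∀ v : V, Y vac v = HahnSeries.single 0 v
  creation : ∀ v : V, ∀ n : ℤ, n < 0 → (Y v vac).coeff n = 0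
  limit : ∀ v : V, (Y v vac).coeff 0 = v

/-- The identity
`(x₀ + x₂)ˡ Y(u, x₀ + x₂) Y(v, x₂) w = (x₀ + x₂)ˡ Y(Y(u, x₀) v, x₂) w`,
where powers of `x₀ + x₂` are expanded in nonnegative powers of `x₂`. It is written as the equality
of the coefficients of `x₀ᵃ x₂ᵇ` of the two sides, for all integers `a, b`. The sum on the left is
finite because `vₖ w = 0` for all large `k`. -/
def WeakAssoc (Y : StateField V) (l : ℕ) (u v w : V) : Prop :=
  ∀ a b : ℤ,
    ∑ᶠ i : ℕ, Ring.choose (a + i) i • mode Y u (l - 1 - i - a) (mode Y v (i - 1 - b) w) =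
      ∑ j ∈ Finset.range (l + 1),
        (l.choose j : ℤ) • mode Y (mode Y u (l - j - 1 - a) v) (j - 1 - b) w

/-- Nonlocal vertex algebras. -/
structure IsNonlocalVertexAlgebra (Y : StateField V) (vac : V) : Prop
    extends VacuumAxioms Y vac where
  weakAssoc : ∀ u v w : V, ∃ l : ℕ, WeakAssoc Y l u v w

/-- The `𝒮`-Jacobi identity for `u, v` and `∑ⱼ v⁽ʲ⁾ ⊗ u⁽ʲ⁾ ⊗ fⱼ(x)` (with `v' j = v⁽ʲ⁾`,
`u' j = u⁽ʲ⁾`):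
`x₀⁻¹ δ((x₁ - x₂)/x₀) Y(u, x₁) Y(v, x₂)`
`  - x₀⁻¹ δ((x₂ - x₁)/(-x₀)) ∑ⱼ fⱼ(-x₀) Y(v⁽ʲ⁾, x₂) Y(u⁽ʲ⁾, x₁)`
`  = x₂⁻¹ δ((x₁ - x₀)/x₂) Y(Y(u, x₀) v, x₂)`,
with binomials expanded in nonnegative powers of their second variable. It is applied to `w` and
written as the equality of the coefficients of `x₀⁻ⁿ⁻¹ x₁⁻ᵖ⁻¹ x₂⁻ᵠ⁻¹`, for all integers `n, p, q`.
In the second term the pair `(m, i)` stands for the `m`-th coefficient of `fⱼ` and the `i`-th term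
of the expansion of `(x₂ - x₁)ⁿ⁺ᵐ`. All sums have only finitely many nonzero terms. -/
def SJacobi (Y : StateField V) (u v : V) {r : ℕ} (v' u' : Fin r → V) (f : Fin r → Laurent ℂ) :
    Prop :=
  ∀ (w : V) (n p q : ℤ),
    ∑ᶠ i : ℕ, ((-1) ^ i * Ring.choose n i : ℤ) • mode Y u (p + n - i) (mode Y v (q + i) w)
      - (-1 : ℂ) ^ n • ∑ j : Fin r, ∑ᶠ mi : ℤ × ℕ,
          ((f j).coeff mi.1 * (((-1) ^ mi.2 * Ring.choose (n + mi.1) mi.2 : ℤ) : ℂ)) •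
            mode Y (v' j) (q + n + mi.1 - mi.2) (mode Y (u' j) (p + mi.2) w) =
      ∑ᶠ i : ℕ, Ring.choose p i • mode Y (mode Y u (n + i) v) (p + q - i) w

/-- Weak quantum vertex algebras. -/
structure IsWeakQuantumVertexAlgebra (Y : StateField V) (vac : V) : Prop
    extends VacuumAxioms Y vac where
  sJacobi : ∀ u v : V, ∃ (r : ℕ) (v' u' : Fin r → V) (f : Fin r → Laurent ℂ),
    SJacobi Y u v v' u' f

end VertexAlgebras

/-! ### Quantum Yang-Baxter operators and quantum vertex algebras -/

section YangBaxter

variable {V : Type*} [AddCommGroup V] [Module ℂ V]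

/-- For a linear map `T : W → W ⊗ K` into the scalar extension by a commutative algebra `K`, its
`K`-linear extension `W ⊗ K → W ⊗ K`, `w ⊗ k ↦ k T(w)`. -/
def extendScalars {W K : Type*} [AddCommGroup W] [Module ℂ W] [CommRing K] [Algebra ℂ K]
    (T : W →ₗ[ℂ] W ⊗[ℂ] K) : W ⊗[ℂ] K →ₗ[ℂ] W ⊗[ℂ] K :=
  (LinearMap.mul' ℂ K).lTensor W ∘ₗ (TensorProduct.assoc ℂ W K K).toLinearMap ∘ₗ T.rTensor K

/-- Operators `𝒮(x) : V ⊗ V → V ⊗ V ⊗ ℂ((x))`. -/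
abbrev SOperator (V : Type*) [AddCommGroup V] [Module ℂ V] : Type _ :=
  V ⊗[ℂ] V →ₗ[ℂ] (V ⊗[ℂ] V) ⊗[ℂ] Laurent ℂ

/-- `𝒮₂₁(x) = σ 𝒮(x) σ`, where `σ` is the flip of `V ⊗ V`. -/
def S21 (S : SOperator V) : SOperator V :=
  (TensorProduct.comm ℂ V V).toLinearMap.rTensor (Laurent ℂ) ∘ₗ S ∘ₗ
    (TensorProduct.comm ℂ V V).toLinearMap

/-- The identity operator `v ⊗ u ↦ v ⊗ u ⊗ 1`. -/
def trivialS (V : Type*) [AddCommGroup V] [Module ℂ V] : SOperator V :=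
  (TensorProduct.mk ℂ (V ⊗[ℂ] V) (Laurent ℂ)).flip 1

/-- The unitarity relation `𝒮₂₁(-x) 𝒮(x) = 1`. -/
def Unitary (S : SOperator V) : Prop :=
  extendScalars (evalNeg.lTensor (V ⊗[ℂ] V) ∘ₗ S21 S) ∘ₗ S = trivialS V

variable {K : Type*} [CommRing K] [Algebra ℂ K]

/-- `T` acting on the first two factors of `V ⊗ V ⊗ V`. -/
def act12 (T : V ⊗[ℂ] V →ₗ[ℂ] (V ⊗[ℂ] V) ⊗[ℂ] K) :
    (V ⊗[ℂ] V) ⊗[ℂ] V →ₗ[ℂ] ((V ⊗[ℂ] V) ⊗[ℂ] V) ⊗[ℂ] K :=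
  (TensorProduct.rightComm ℂ (V ⊗[ℂ] V) K V).toLinearMap ∘ₗ T.rTensor V

/-- `T` acting on the last two factors of `V ⊗ V ⊗ V`. -/
def act23 (T : V ⊗[ℂ] V →ₗ[ℂ] (V ⊗[ℂ] V) ⊗[ℂ] K) :
    (V ⊗[ℂ] V) ⊗[ℂ] V →ₗ[ℂ] ((V ⊗[ℂ] V) ⊗[ℂ] V) ⊗[ℂ] K :=
  (TensorProduct.assoc ℂ V V V).symm.toLinearMap.rTensor K ∘ₗ
    (TensorProduct.assoc ℂ V (V ⊗[ℂ] V) K).symm.toLinearMap ∘ₗ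
      T.lTensor V ∘ₗ (TensorProduct.assoc ℂ V V V).toLinearMap

/-- `T` acting on the first and third factors of `V ⊗ V ⊗ V`: the conjugate of `act12 T` by the
interchange of the last two factors. -/
def act13 (T : V ⊗[ℂ] V →ₗ[ℂ] (V ⊗[ℂ] V) ⊗[ℂ] K) :
    (V ⊗[ℂ] V) ⊗[ℂ] V →ₗ[ℂ] ((V ⊗[ℂ] V) ⊗[ℂ] V) ⊗[ℂ] K :=
  (TensorProduct.rightComm ℂ V V V).toLinearMap.rTensor K ∘ₗ act12 T ∘ₗ
    (TensorProduct.rightComm ℂ V V V).toLinearMap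

/-- The equation `A₁₂ B₁₃ C₂₃ = C₂₃ B₁₃ A₁₂` of maps `V ⊗ V ⊗ V → V ⊗ V ⊗ V ⊗ K`. -/
def BraidEquation (A B C : V ⊗[ℂ] V →ₗ[ℂ] (V ⊗[ℂ] V) ⊗[ℂ] K) : Prop :=
  extendScalars (act12 A) ∘ₗ extendScalars (act13 B) ∘ₗ act23 C =
    extendScalars (act23 C) ∘ₗ extendScalars (act13 B) ∘ₗ act12 A

/-- The quantum Yang-Baxter equation
`𝒮₁₂(x) 𝒮₁₃(x + z) 𝒮₂₃(z) = 𝒮₂₃(z) 𝒮₁₃(x + z) 𝒮₁₂(x)`, over `K = ℂ((x))((z))`. -/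
def QuantumYangBaxter (S : SOperator V) : Prop :=
  BraidEquation (K := Laurent (Laurent ℂ))
    (inX.lTensor (V ⊗[ℂ] V) ∘ₗ S) (inXaddZ.lTensor (V ⊗[ℂ] V) ∘ₗ S) (inZ.lTensor (V ⊗[ℂ] V) ∘ₗ S)

/-- `(V, Y, 𝟏, 𝒮)` is a quantum vertex algebra: a weak quantum vertex algebra with a unitary
rational quantum Yang-Baxter operator `𝒮` such that the `𝒮`-Jacobi identity holds with
`∑ⱼ v⁽ʲ⁾ ⊗ u⁽ʲ⁾ ⊗ fⱼ(x) = 𝒮(x)(v ⊗ u)`. -/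
structure IsQuantumVertexAlgebra (Y : StateField V) (vac : V) (S : SOperator V) : Prop
    extends IsWeakQuantumVertexAlgebra Y vac where
  unitary : Unitary S
  quantumYangBaxter : QuantumYangBaxter S
  sJacobi_S : ∀ u v : V, ∃ (r : ℕ) (v' u' : Fin r → V) (f : Fin r → Laurent ℂ),
    S (v ⊗ₜ u) = ∑ j, (v' j ⊗ₜ u' j) ⊗ₜ f j ∧ SJacobi Y u v v' u' f

end YangBaxter

/-! ### Nondegeneracy -/

section Nondegenerate

/-- Exponents `(e₁, …, eₙ)` of monomials in `x₁, …, xₙ`, ordered lexicographically with `eₙ` most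
significant. A set of exponents is well-ordered in this order exactly when `eₙ` is bounded below on
it and, for fixed `eₙ`, `eₙ₋₁` is bounded below, and so on; hence Hahn series with these exponents
are the iterated Laurent series in `x₁, …, xₙ`, the last variable being the outermost. -/
abbrev Exponent (n : ℕ) : Type := Lex ((Fin n)ᵒᵈ → ℤ)

/-- The field `ℂ((x₁))⋯((xₙ))`. -/
abbrev IterLaurent (n : ℕ) : Type := HahnSeries (Exponent n) ℂ

/-- `V((x₁))⋯((xₙ))`, with its module structure over `ℂ((x₁))⋯((xₙ))`. -/
abbrev IterLaurentModule (n : ℕ) (V : Type*) [AddCommGroup V] [Module ℂ V] : Type _ :=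
  HahnModule (Exponent n) ℂ V

theorem isPWO_of_bddBelow_fibers {n : ℕ} (s : Set (Exponent n))
    (hs : ∀ (e : Exponent n) (i : Fin n), BddBelow {k : ℤ | ∃ e' ∈ s,
      (∀ j, i < j → ofLex e' (OrderDual.toDual j) = ofLex e (OrderDual.toDual j)) ∧
        ofLex e' (OrderDual.toDual i) = k}) : s.IsPWO := by
  rw [Set.isPWO_iff_isWF, Set.isWF_iff_no_descending_seq]
  rintro a ha has
  -- from some point on, the `k` most significant exponents are constant
  have key : ∀ k : ℕ, k ≤ n → ∃ N, ∀ m, N ≤ m → ∀ j : Fin n, n ≤ j + k →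
      ofLex (a m) (OrderDual.toDual j) = ofLex (a N) (OrderDual.toDual j) := by
    intro k
    induction k with
    | zero => exact fun _ => ⟨0, fun m _ j hj => absurd j.2 (by omega)⟩
    | succ k ih =>
      intro hk
      obtain ⟨N, hN⟩ := ih (by omega)
      let i : Fin n := ⟨n - (k + 1), by omega⟩
      obtain ⟨B, hB⟩ := hs (a N) i
      have hgt : ∀ m, N ≤ m → ∀ j, i < j →
          ofLex (a m) (OrderDual.toDual j) = ofLex (a N) (OrderDual.toDual j) := by
        intro m hm j hj
        refine hN m hm j ?_
        have : n - (k + 1) < (j : ℕ) := hj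
        omega
      have hanti : ∀ m m', N ≤ m → m ≤ m' →
          ofLex (a m') (OrderDual.toDual i) ≤ ofLex (a m) (OrderDual.toDual i) := by
        intro m m' hm hmm'
        refine Pi.apply_le_of_toLex (x := ofLex (a m')) (y := ofLex (a m)) (i := OrderDual.toDual i)
          (ha.antitone hmm') ?_
        intro j hj
        exact (hgt m' (hm.trans hmm') (OrderDual.ofDual j) hj).trans
          (hgt m hm (OrderDual.ofDual j) hj).symm
      obtain ⟨b, ⟨M, hM, rfl⟩, hmin⟩ := Int.exists_least_of_bdd
        (P := fun b => ∃ M, N ≤ M ∧ ofLex (a M) (OrderDual.toDual i) = b)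
        ⟨B, fun z ⟨M, hM, h⟩ => hB ⟨a M, has M, fun j hj => hgt M hM j hj, h⟩⟩ ⟨_, N, le_rfl, rfl⟩
      refine ⟨M, fun m hm j hj => ?_⟩
      rcases eq_or_ne j i with rfl | hne
      · exact le_antisymm (hanti M m hM hm) (hmin _ ⟨m, hM.trans hm, rfl⟩)
      · have hij : n ≤ (j : ℕ) + k := by
          have : (j : ℕ) ≠ n - (k + 1) := fun h => hne (Fin.ext h)
          omega
        rw [hN m (hM.trans hm) j hij, hN M hM j hij]
  obtain ⟨N, hN⟩ := key n le_rfl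
  have h : a (N + 1) = a N := by
    refine ofLex_inj.1 (funext fun j => ?_)
    exact hN (N + 1) (by omega) (OrderDual.ofDual j) (by omega)
  exact (ha (Nat.lt_succ_self N)).ne h

variable {V : Type*} [AddCommGroup V] [Module ℂ V]

/-- The coefficient of `x₁^{e 0} ⋯ xₙ^{e (n-1)}` in `Y(u₁, x₁) ⋯ Y(uₙ, xₙ) 𝟏`. -/
def productCoeff (Y : StateField V) (vac : V) : (n : ℕ) → (Fin n → V) → (Fin n → ℤ) → V
  | 0, _, _ => vac
  | n + 1, u, e => (Y (u 0) (productCoeff Y vac n (Fin.tail u) (Fin.tail e))).coeff (e 0)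

theorem productCoeff_bddBelow (Y : StateField V) (vac : V) {n : ℕ} (u : Fin n → V)
    (e : Fin n → ℤ) (i : Fin n) :
    BddBelow {k : ℤ | ∃ e', productCoeff Y vac n u e' ≠ 0 ∧ (∀ j, i < j → e' j = e j) ∧ e' i = k} := by
  induction n with
  | zero => exact i.elim0
  | succ n ih =>
    induction i using Fin.cases with
    | zero =>
      have hw := (Y (u 0) (productCoeff Y vac n (Fin.tail u) (Fin.tail e))).isPWO_support'.isWF
      have key : ∀ k : ℤ, (∃ e', productCoeff Y vac (n + 1) u e' ≠ 0 ∧ (∀ j, 0 < j → e' j = e j) ∧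
          e' 0 = k) → (Y (u 0) (productCoeff Y vac n (Fin.tail u) (Fin.tail e))).coeff k ≠ 0 := by
        rintro k ⟨e', hne, hj, rfl⟩
        have ht : Fin.tail e' = Fin.tail e := funext fun j => hj j.succ (Fin.succ_pos j)
        simpa [productCoeff, ht] using hne
      by_cases hn : (Function.support
          (Y (u 0) (productCoeff Y vac n (Fin.tail u) (Fin.tail e))).coeff).Nonempty
      · exact ⟨hw.min hn, fun k hk => hw.min_le hn (key k hk)⟩
      · exact ⟨0, fun k hk => absurd ⟨k, key k hk⟩ hn⟩
    | succ i =>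
      refine (ih (Fin.tail u) (Fin.tail e) i).mono ?_
      rintro k ⟨e', hne, hj, rfl⟩
      refine ⟨Fin.tail e', fun h0 => hne ?_, fun j hj' => hj j.succ (Fin.succ_lt_succ_iff.2 hj'), rfl⟩
      simp [productCoeff, h0]

theorem productCoeff_update_add (Y : StateField V) (vac : V) {n : ℕ} (u : Fin n → V) (i : Fin n)
    (a b : V) (e : Fin n → ℤ) :
    productCoeff Y vac n (Function.update u i (a + b)) e =
      productCoeff Y vac n (Function.update u i a) e +
        productCoeff Y vac n (Function.update u i b) e := by
  induction n with
  | zero => exact i.elim0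
  | succ n ih =>
    induction i using Fin.cases with
    | zero => simp [productCoeff]
    | succ i => simp [productCoeff, ih, Function.update_of_ne (Fin.succ_ne_zero i).symm]

theorem productCoeff_update_smul (Y : StateField V) (vac : V) {n : ℕ} (u : Fin n → V) (i : Fin n)
    (c : ℂ) (a : V) (e : Fin n → ℤ) :
    productCoeff Y vac n (Function.update u i (c • a)) e =
      c • productCoeff Y vac n (Function.update u i a) e := by
  induction n with
  | zero => exact i.elim0
  | succ n ih =>
    induction i using Fin.cases with
    | zero => simp [productCoeff]
    | succ i => simp [productCoeff, ih, Function.update_of_ne (Fin.succ_ne_zero i).symm]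

/-- The series `Y(u₁, x₁) ⋯ Y(uₙ, xₙ) 𝟏` in `V((x₁))⋯((xₙ))`. -/
def productSeries (Y : StateField V) (vac : V) (n : ℕ) (u : Fin n → V) :
    HahnSeries (Exponent n) V where
  coeff e := productCoeff Y vac n u fun i => ofLex e (OrderDual.toDual i)
  isPWO_support' := by
    refine isPWO_of_bddBelow_fibers _ fun e i =>
      (productCoeff_bddBelow Y vac u (fun i => ofLex e (OrderDual.toDual i)) i).mono ?_
    rintro k ⟨e', hne, hj, rfl⟩
    exact ⟨fun i => ofLex e' (OrderDual.toDual i), hne, hj, rfl⟩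

/-- `(u₁, …, uₙ) ↦ Y(u₁, x₁) ⋯ Y(uₙ, xₙ) 𝟏` as a multilinear map. -/
def productMap (Y : StateField V) (vac : V) (n : ℕ) :
    MultilinearMap ℂ (fun _ : Fin n => V) (IterLaurentModule n V) where
  toFun u := HahnModule.of ℂ (productSeries Y vac n u)
  map_update_add' u i a b := by
    refine congrArg (HahnModule.of ℂ) (HahnSeries.ext (funext fun e => ?_))
    rename_i inst
    obtain rfl : inst = instDecidableEqFin n := Subsingleton.elim _ _
    exact productCoeff_update_add Y vac u i a b _
  map_update_smul' u i c a := by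
    refine congrArg (HahnModule.of ℂ) (HahnSeries.ext (funext fun e => ?_))
    rename_i inst
    obtain rfl : inst = instDecidableEqFin n := Subsingleton.elim _ _
    exact productCoeff_update_smul Y vac u i c a _

/-- The linear map `Zₙ : V^{⊗n} ⊗ ℂ((x₁))⋯((xₙ)) → V((x₁))⋯((xₙ))`,
`u₁ ⊗ ⋯ ⊗ uₙ ⊗ f ↦ f Y(u₁, x₁) ⋯ Y(uₙ, xₙ) 𝟏`. -/
def Z (Y : StateField V) (vac : V) (n : ℕ) :
    (⨂[ℂ] _ : Fin n, V) ⊗[ℂ] IterLaurent n →ₗ[ℂ] IterLaurentModule n V :=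
  TensorProduct.lift <| LinearMap.mk₂ ℂ
    (fun (T : ⨂[ℂ] _ : Fin n, V) (f : IterLaurent n) => f • PiTensorProduct.lift (productMap Y vac n) T)
    (fun T T' f => by rw [map_add, smul_add])
    (fun c T f => by
      rw [map_smul]
      exact (smul_comm c f (PiTensorProduct.lift (productMap Y vac n) T)).symm)
    (fun T f g => add_smul f g _)
    (fun c T f => smul_assoc c f _)

/-- Nondegeneracy: `Zₙ` is injective for every positive integer `n`. -/
def IsNondegenerate (Y : StateField V) (vac : V) : Prop :=
  ∀ n : ℕ, 0 < n → Function.Injective (Z Y vac n)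

end Nondegenerate

/-! ### The vertex operator of an algebra with a derivation -/

section Derivation

variable {A : Type*} [Ring A] [Algebra ℂ A]

/-- `e^{xD} a = ∑ₙ (xⁿ / n!) Dⁿ a` in `A[[x]]`. -/
def expSeries (D : A →ₗ[ℂ] A) (a : A) : A⟦X⟧ :=
  PowerSeries.mk fun n => ((n.factorial : ℂ)⁻¹) • (D ^ n) a

theorem expSeries_add (D : A →ₗ[ℂ] A) (a b : A) :
    expSeries D (a + b) = expSeries D a + expSeries D b := by
  ext n; simp [expSeries]

theorem expSeries_smul (D : A →ₗ[ℂ] A) (c : ℂ) (a : A) :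
    expSeries D (c • a) = c • expSeries D a := by
  ext n; simp [expSeries, smul_comm c]

theorem ofPowerSeries_smul (c : ℂ) (p : A⟦X⟧) :
    HahnSeries.ofPowerSeries ℤ A (c • p) = c • HahnSeries.ofPowerSeries ℤ A p := by
  ext k
  rcases lt_or_ge k 0 with hk | hk
  · rw [HahnSeries.coeff_smul, HahnSeries.ofPowerSeries_apply, HahnSeries.ofPowerSeries_apply,
      HahnSeries.embDomain_of_notMem_range, HahnSeries.embDomain_of_notMem_range, smul_zero] <;>
    · rintro ⟨m, hm⟩
      simp at hm
      omega
  · obtain ⟨m, rfl⟩ := Int.eq_ofNat_of_zero_le hk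
    have h := HahnSeries.ofPowerSeries_apply_coeff (Γ := ℤ) (c • p) m
    have h' := HahnSeries.ofPowerSeries_apply_coeff (Γ := ℤ) p m
    change (HahnSeries.ofPowerSeries ℤ A (c • p)).coeff (m : ℤ) =
      (c • HahnSeries.ofPowerSeries ℤ A p).coeff (m : ℤ)
    rw [HahnSeries.coeff_smul, h, h', PowerSeries.coeff_smul]

/-- The vertex operator `Y(a, x) b = (e^{xD} a) b` of an algebra `A` with a derivation `D`. -/
def derivationY (D : A →ₗ[ℂ] A) : StateField A :=
  LinearMap.mk₂ ℂ
    (fun a b => HahnSeries.ofPowerSeries ℤ A (expSeries D a * PowerSeries.C b))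
    (fun a a' b => by simp [expSeries_add, add_mul])
    (fun c a b => by rw [expSeries_smul, smul_mul_assoc, ofPowerSeries_smul])
    (fun a b b' => by simp [mul_add])
    (fun c a b => by
      have h : (PowerSeries.C (c • b) : A⟦X⟧) = c • PowerSeries.C b := by
        ext n; simp [PowerSeries.coeff_C]
      rw [h, mul_smul_comm, ofPowerSeries_smul])

end Derivation

/-! ### The universal enveloping algebra of `𝔤 ⊗ t⁻¹ℂ[t⁻¹]` -/

section Enveloping

attribute [local instance] LieRing.ofAssociativeRing LieAlgebra.ofAssociativeAlgebra

open UniversalEnvelopingAlgebra in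
/-- For a derivation `d` of a Lie algebra `L`, the algebra map `U(L) → U(L) ⊕ ε U(L)` (`ε² = 0`)
with `x ↦ x + ε d(x)` on `L`. -/
def dualLift {L : Type*} [LieRing L] [LieAlgebra ℂ L] (d : LieDerivation ℂ L L) :
    UniversalEnvelopingAlgebra ℂ L →ₐ[ℂ]
      TrivSqZeroExt (UniversalEnvelopingAlgebra ℂ L) (UniversalEnvelopingAlgebra ℂ L) :=
  lift ℂ
    { toFun := fun x => TrivSqZeroExt.inl (ι ℂ x) + TrivSqZeroExt.inr (ι ℂ (d x))
      map_add' := fun x y => by ext <;> simp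
      map_smul' := fun c x => by ext <;> simp
      map_lie' := fun {x y} => by
        ext
        · simp [LieRing.of_associative_ring_bracket, -ι_apply]
        · simp [LieRing.of_associative_ring_bracket, -ι_apply]
          abel }

/-- The extension of a derivation `d` of `L` to `U(L)`. -/
def envelopingDerivation {L : Type*} [LieRing L] [LieAlgebra ℂ L] (d : LieDerivation ℂ L L) :
    UniversalEnvelopingAlgebra ℂ L →ₗ[ℂ] UniversalEnvelopingAlgebra ℂ L :=
  { toFun := fun u => (dualLift d u).snd
    map_add' := by simp
    map_smul' := by simp }

theorem dualLift_ι {L : Type*} [LieRing L] [LieAlgebra ℂ L] (d : LieDerivation ℂ L L) (x : L) :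
    dualLift d (UniversalEnvelopingAlgebra.ι ℂ x) =
      TrivSqZeroExt.inl (UniversalEnvelopingAlgebra.ι ℂ x) +
        TrivSqZeroExt.inr (UniversalEnvelopingAlgebra.ι ℂ (d x)) :=
  UniversalEnvelopingAlgebra.lift_ι_apply ℂ _ x

theorem fst_dualLift {L : Type*} [LieRing L] [LieAlgebra ℂ L] (d : LieDerivation ℂ L L)
    (u : UniversalEnvelopingAlgebra ℂ L) : (dualLift d u).fst = u := by
  have h : (TrivSqZeroExt.fstHom ℂ (UniversalEnvelopingAlgebra ℂ L)
      (UniversalEnvelopingAlgebra ℂ L)).comp (dualLift d) = AlgHom.id ℂ _ := by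
    ext x
    simp [dualLift_ι, -UniversalEnvelopingAlgebra.ι_apply]
  exact DFunLike.congr_fun h u

/-- `envelopingDerivation d` extends `d`. -/
theorem envelopingDerivation_ι {L : Type*} [LieRing L] [LieAlgebra ℂ L] (d : LieDerivation ℂ L L)
    (x : L) : envelopingDerivation d (UniversalEnvelopingAlgebra.ι ℂ x) =
      UniversalEnvelopingAlgebra.ι ℂ (d x) := by
  simp [envelopingDerivation, dualLift_ι, -UniversalEnvelopingAlgebra.ι_apply]

/-- `envelopingDerivation d` is a derivation of the algebra `U(L)`. -/
theorem envelopingDerivation_mul {L : Type*} [LieRing L] [LieAlgebra ℂ L]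
    (d : LieDerivation ℂ L L) (u v : UniversalEnvelopingAlgebra ℂ L) :
    envelopingDerivation d (u * v) =
      envelopingDerivation d u * v + u * envelopingDerivation d v := by
  simp [envelopingDerivation, fst_dualLift, add_comm]

end Enveloping

section NegLoop

theorem lie_mem_span {L : Type*} [LieRing L] [LieAlgebra ℂ L] {s : Set L}
    (hs : ∀ x ∈ s, ∀ y ∈ s, ⁅x, y⁆ ∈ s) {x y : L} (hx : x ∈ Submodule.span ℂ s)
    (hy : y ∈ Submodule.span ℂ s) : ⁅x, y⁆ ∈ Submodule.span ℂ s := by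
  induction hx, hy using Submodule.span_induction₂ with
  | mem_mem x y hx hy => exact Submodule.subset_span (hs x hx y hy)
  | zero_left y hy => simp
  | zero_right x hx => simp
  | add_left x y z _ _ _ h h' => rw [add_lie]; exact Submodule.add_mem _ h h'
  | add_right x y z _ _ _ h h' => rw [lie_add]; exact Submodule.add_mem _ h h'
  | smul_left r x y _ _ h => rw [smul_lie]; exact Submodule.smul_mem _ r h
  | smul_right r x y _ _ h => rw [lie_smul]; exact Submodule.smul_mem _ r h

theorem leibniz_span {L : Type*} [LieRing L] [LieAlgebra ℂ L] {s : Set L} (D : L →ₗ[ℂ] L)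
    (hs : ∀ x ∈ s, ∀ y ∈ s, D ⁅x, y⁆ = ⁅x, D y⁆ - ⁅y, D x⁆) {x y : L}
    (hx : x ∈ Submodule.span ℂ s) (hy : y ∈ Submodule.span ℂ s) :
    D ⁅x, y⁆ = ⁅x, D y⁆ - ⁅y, D x⁆ := by
  induction hx, hy using Submodule.span_induction₂ with
  | mem_mem x y hx hy => exact hs x hx y hy
  | zero_left y hy => simp
  | zero_right x hx => simp
  | add_left x y z _ _ _ h h' => simp only [add_lie, lie_add, map_add, h, h']; abel
  | add_right x y z _ _ _ h h' => simp only [add_lie, lie_add, map_add, h, h']; abel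
  | smul_left r x y _ _ h => simp only [smul_lie, lie_smul, map_smul, h, smul_sub]
  | smul_right r x y _ _ h => simp only [smul_lie, lie_smul, map_smul, h, smul_sub]

variable (𝔤 : Type*) [LieRing 𝔤] [LieAlgebra ℂ 𝔤]

/-- The elements `tⁿ ⊗ a` of `𝔤 ⊗ ℂ[t, t⁻¹]` with `n < 0`. -/
def negMonomials : Set (ℂ[T;T⁻¹] ⊗[ℂ] 𝔤) :=
  {z | ∃ (n : ℤ) (a : 𝔤), n < 0 ∧ z = LaurentPolynomial.T n ⊗ₜ[ℂ] a}

theorem lie_mem_negMonomials : ∀ x ∈ negMonomials 𝔤, ∀ y ∈ negMonomials 𝔤,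
    ⁅x, y⁆ ∈ negMonomials 𝔤 := by
  rintro _ ⟨m, a, hm, rfl⟩ _ ⟨n, b, hn, rfl⟩
  refine ⟨m + n, ⁅a, b⁆, by omega, ?_⟩
  rw [LieAlgebra.ExtendScalars.bracket_tmul, LaurentPolynomial.T_add]

/-- `𝔤 ⊗ t⁻¹ℂ[t⁻¹]`, the Lie subalgebra of the loop algebra `𝔤 ⊗ ℂ[t, t⁻¹]` spanned by the
`tⁿ ⊗ a` with `n < 0`. -/
def negLoop : LieSubalgebra ℂ (ℂ[T;T⁻¹] ⊗[ℂ] 𝔤) where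
  __ := Submodule.span ℂ (negMonomials 𝔤)
  lie_mem' hx hy := lie_mem_span (lie_mem_negMonomials 𝔤) hx hy

/-- `d/dt` on Laurent polynomials, `tⁿ ↦ n tⁿ⁻¹`. -/
def ddt : ℂ[T;T⁻¹] →ₗ[ℂ] ℂ[T;T⁻¹] :=
  (AddMonoidAlgebra.basis ℤ ℂ).constr ℂ fun n : ℤ => (n : ℂ) • LaurentPolynomial.T (n - 1)

theorem ddt_T (n : ℤ) :
    ddt (LaurentPolynomial.T n) = (n : ℂ) • LaurentPolynomial.T (n - 1) := by
  rw [ddt, LaurentPolynomial.T, ← AddMonoidAlgebra.basis_apply, Module.Basis.constr_basis]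

theorem ddt_mem {z : ℂ[T;T⁻¹] ⊗[ℂ] 𝔤} (hz : z ∈ (negLoop 𝔤).toSubmodule) :
    ddt.rTensor 𝔤 z ∈ (negLoop 𝔤).toSubmodule := by
  change z ∈ Submodule.span ℂ _ at hz
  change _ ∈ Submodule.span ℂ _
  induction hz using Submodule.span_induction with
  | mem z hz =>
    obtain ⟨n, a, hn, rfl⟩ := hz
    rw [LinearMap.rTensor_tmul, ddt_T, ← TensorProduct.smul_tmul']
    exact Submodule.smul_mem _ _ (Submodule.subset_span ⟨n - 1, a, by omega, rfl⟩)
  | zero => simp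
  | add x y _ _ h h' => rw [map_add]; exact Submodule.add_mem _ h h'
  | smul c x _ h => rw [map_smul]; exact Submodule.smul_mem _ c h

theorem ddt_lie : ∀ x ∈ negMonomials 𝔤, ∀ y ∈ negMonomials 𝔤,
    ddt.rTensor 𝔤 ⁅x, y⁆ = ⁅x, ddt.rTensor 𝔤 y⁆ - ⁅y, ddt.rTensor 𝔤 x⁆ := by
  rintro _ ⟨m, a, hm, rfl⟩ _ ⟨n, b, hn, rfl⟩
  simp only [LieAlgebra.ExtendScalars.bracket_tmul, LinearMap.rTensor_tmul,
    ← LaurentPolynomial.T_add, ddt_T, mul_smul_comm]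
  rw [← lie_skew b a, TensorProduct.tmul_neg]
  rw [sub_neg_eq_add, ← TensorProduct.add_tmul,
    show m + (n - 1) = m + n - 1 by ring, show n + (m - 1) = m + n - 1 by ring, ← add_smul]
  push_cast
  rw [add_comm (n : ℂ) m]

/-- The derivation `1 ⊗ d/dt` of `𝔤 ⊗ t⁻¹ℂ[t⁻¹]`, `tⁿ ⊗ a ↦ n tⁿ⁻¹ ⊗ a`. -/
def negLoopDerivation : LieDerivation ℂ (negLoop 𝔤) (negLoop 𝔤) where
  __ := (ddt.rTensor 𝔤).restrict (p := (negLoop 𝔤).toSubmodule) (q := (negLoop 𝔤).toSubmodule)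
    fun _ hz => ddt_mem 𝔤 hz
  leibniz' x y := Subtype.ext (leibniz_span (ddt.rTensor 𝔤) (ddt_lie 𝔤) x.2 y.2)

/-- The underlying space `U(𝔤 ⊗ t⁻¹ℂ[t⁻¹])`. -/
abbrev UNegLoop : Type _ := UniversalEnvelopingAlgebra ℂ (negLoop 𝔤)

/-- The vertex operator `Y(a, x) b = (e^{xd} a) b` on `U(𝔤 ⊗ t⁻¹ℂ[t⁻¹])`, where `d` is the
derivation induced by `d/dt`. -/
def vertexOperator : StateField (UNegLoop 𝔤) :=
  derivationY (envelopingDerivation (negLoopDerivation 𝔤))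

end NegLoop

end QuantumVA

end

/-!
# The quantum vertex algebra `U(𝔤 ⊗ t⁻¹ℂ[t⁻¹])`

Since `d` is a derivation, `u ↦ e^{xd} u` is a homomorphism of algebras, and products of vertex
operators are products in `V`: `Y(u₁, x₁) ⋯ Y(uₙ, xₙ) w = (e^{x₁ d} u₁) ⋯ (e^{xₙ d} uₙ) w`. Weak
associativity is then immediate, with `l = 0` (`weakAssoc_derivationY`).

Nondegeneracy says that the products of monomials in the `e^{xⱼ d}(t^{-m-1} ⊗ b)` are linearly
independent over `ℂ((x₁))⋯((xₙ))`. It suffices to see their leading terms, which is done by symbols: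
`L = 𝔤 ⊗ t⁻¹ℂ[t⁻¹]` acts on polynomials on `L*` in one more variable `w` by derivations that extend
the adjoint action and map `w` to `d/dt` of the acting element, and the coefficient of `w⁰` in
`u · wᵐ` is, for a product `u` of `m` elements of `L`, `m!` times the commutative product of their
derivatives (`exists_isSymbol`). Applied to the coefficients of series, symbols turn a relation
between products of fields into a polynomial relation between linear forms. As
`e^{ξd}(t^{-m-1} ⊗ b) = (t + ξ)^{-m-1} ⊗ b`, these forms are Taylor coefficients at the points `-ξ`,
and for distinct points they are linearly independent by Hermite interpolation
(`linearIndependent_taylorForm`); linear independence over an extension of `ℂ` suffices for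
algebraic independence at the complex points (`linearIndependent_of_symbols`). No form of the
Poincaré–Birkhoff–Witt theorem is presupposed; its independence half is the case `ξ = 0`. The same
argument gives the injectivity of `v ⊗ u ⊗ f ↦ f(x) (e^{xd} v) u`, of its variant with the opposite
product, and of the analogous map in three factors `e^{(x + z)d} u`, `e^{zd} v`, `w`.

The `𝒮`-Jacobi identity is equivalent to `u (e^{xd} v) = ∑ⱼ fⱼ(x) (e^{xd} v⁽ʲ⁾) u⁽ʲ⁾`
(`sJacobi_derivationY`, `relation_of_sJacobi`). By injectivity, this relation determines
`𝒮(x)(v ⊗ u) = ∑ⱼ v⁽ʲ⁾ ⊗ u⁽ʲ⁾ ⊗ fⱼ(x)`, which gives uniqueness. For existence it has to be shown that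
`e^{xd} v` and `u` can be interchanged; the commutators of generators are
`t^{-m-1} (t + x)^{-n-1} ⊗ [a, b]`, which partial fractions in `t` express through the poles at `0`
and `-x`, with coefficients in `ℂ[x⁻¹]` (`commutator_mem_generatorSpan`).

Unitarity and the quantum Yang-Baxter equation hold because both sides, composed with an injective
product map, express the same product with the factors reversed (`unitary_braiding`,
`braidEquation_of_exchange`). At `x = 0` the case `𝒮 = 1` would give
`[t⁻¹ ⊗ a, t⁻¹ ⊗ b] = t⁻² ⊗ [a, b] = 0`.
-/

noncomputable section

namespace QuantumVA

/-! ### Hahn series and homomorphisms -/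

section Hahn

variable {Γ : Type*} [AddCommMonoid Γ] [PartialOrder Γ] [IsOrderedCancelAddMonoid Γ]
variable {k : Type*} [CommRing k] {A B : Type*} [Ring A] [Algebra k A] [Ring B] [Algebra k B]

/-- A homomorphism of algebras applied to the coefficients of Hahn series. -/
def mapAlgHom (Γ : Type*) [AddCommMonoid Γ] [PartialOrder Γ] [IsOrderedCancelAddMonoid Γ]
    (f : A →ₐ[k] B) : HahnSeries Γ A →ₐ[k] HahnSeries Γ B where
  toFun x := x.map f
  map_one' := HahnSeries.map_one (f : A →+* B).toMonoidWithZeroHom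
  map_mul' x y := HahnSeries.map_mul (f : A →+* B).toNonUnitalRingHom
  map_zero' := by ext; simp
  map_add' x y := by ext; simp
  commutes' r := by
    simp only [HahnSeries.algebraMap_apply]
    ext a
    by_cases h : a = 0 <;> simp [h, HahnSeries.C_apply]

@[simp]
theorem coeff_mapAlgHom (f : A →ₐ[k] B) (x : HahnSeries Γ A) (a : Γ) :
    (mapAlgHom Γ f x).coeff a = f (x.coeff a) := rfl

/-- The embedding of coefficients as constant Hahn series. -/
def constAlgHom (Γ : Type*) [AddCommMonoid Γ] [PartialOrder Γ] [IsOrderedCancelAddMonoid Γ]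
    (k A : Type*) [CommRing k] [Ring A] [Algebra k A] : A →ₐ[k] HahnSeries Γ A where
  __ := (HahnSeries.C : A →+* HahnSeries Γ A)
  commutes' _ := rfl

theorem mapAlgHom_single (f : A →ₐ[k] B) (g : Γ) (a : A) :
    mapAlgHom Γ f (HahnSeries.single g a) = HahnSeries.single g (f a) := by
  ext e
  by_cases h : e = g <;> simp [h]

theorem coeff_mul_of_subset {R : Type*} [Ring R] {x y : HahnSeries Γ R} {s t : Set Γ}
    (hs : s.IsPWO) (ht : t.IsPWO) (hxs : x.support ⊆ s) (hyt : y.support ⊆ t) (a : Γ) :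
    (x * y).coeff a = ∑ ij ∈ Finset.antidiagonal hs ht a, x.coeff ij.1 * y.coeff ij.2 := by
  rw [HahnSeries.coeff_mul_left' hs hxs]
  refine Finset.sum_subset (fun i hi => ?_) fun i hi hi' => ?_
  · rw [Finset.mem_antidiagonal] at hi ⊢
    exact ⟨hi.1, hyt hi.2.1, hi.2.2⟩
  · rw [Finset.mem_antidiagonal] at hi hi'
    have : y.coeff i.2 = 0 := by
      by_contra h
      exact hi' ⟨hi.1, h, hi.2.2⟩
    rw [this, mul_zero]

/-- Hahn series with central coefficients are central. -/
theorem commute_mapAlgHom (g : B →ₐ[k] A) (hg : ∀ c a, Commute (g c) a) (f : HahnSeries Γ B)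
    (x : HahnSeries Γ A) : Commute (mapAlgHom Γ g f) x := by
  ext e
  rw [HahnSeries.coeff_mul_left' (HahnSeries.isPWO_support f)
      (fun a ha h => ha (by simp [h])),
    HahnSeries.coeff_mul_right' (HahnSeries.isPWO_support f)
      (fun a ha h => ha (by simp [h]))]
  refine Finset.sum_bij' (fun i _ => i.swap) (fun i _ => i.swap) ?_ ?_ ?_ ?_ ?_
  · intro i hi
    simp only [Finset.mem_antidiagonal] at hi ⊢
    exact ⟨hi.2.1, hi.1, by simpa [add_comm] using hi.2.2⟩
  · intro i hi
    simp only [Finset.mem_antidiagonal] at hi ⊢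
    exact ⟨hi.2.1, hi.1, by simpa [add_comm] using hi.2.2⟩
  · simp
  · simp
  · intro i hi
    exact (hg _ _).eq

theorem commute_mapAlgHom_ofId (f : HahnSeries Γ k) (x : HahnSeries Γ A) :
    Commute (mapAlgHom Γ (Algebra.ofId k A) f) x :=
  commute_mapAlgHom (Algebra.ofId k A) (fun c a => Algebra.commutes c a) f x

end Hahn

/-! ### Exponentials of derivations -/

section Exp

variable {A B : Type*} [Ring A] [Algebra ℂ A] [Ring B] [Algebra ℂ B]

/-- The divided power `Dᵏ / k!`. -/
def divPow {M : Type*} [AddCommGroup M] [Module ℂ M] (D : M →ₗ[ℂ] M) (k : ℕ) : M →ₗ[ℂ] M :=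
  ((k.factorial : ℂ)⁻¹) • D ^ k

section DivPow

variable {M N : Type*} [AddCommGroup M] [Module ℂ M] [AddCommGroup N] [Module ℂ N]

@[simp]
theorem divPow_zero (D : M →ₗ[ℂ] M) (a : M) : divPow D 0 a = a := by simp [divPow]

theorem succ_smul_divPow_succ (D : M →ₗ[ℂ] M) (k : ℕ) (a : M) :
    ((k : ℂ) + 1) • divPow D (k + 1) a = D (divPow D k a) := by
  simp only [divPow, LinearMap.smul_apply, map_smul, smul_smul, pow_succ', Module.End.mul_apply]
  congr 1
  rw [Nat.factorial_succ]
  have h1 : ((k : ℂ) + 1) ≠ 0 := by exact_mod_cast k.succ_ne_zero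
  have h2 : (k.factorial : ℂ) ≠ 0 := by exact_mod_cast k.factorial_ne_zero
  push_cast
  field_simp

theorem divPow_divPow (D : M →ₗ[ℂ] M) (i j : ℕ) (a : M) :
    divPow D i (divPow D j a) = ((i + j).choose i : ℂ) • divPow D (i + j) a := by
  simp only [divPow, LinearMap.smul_apply, map_smul, smul_smul, pow_add, Module.End.mul_apply]
  congr 1
  have h := Nat.add_choose_mul_factorial_mul_factorial i j
  rw [Nat.choose_symm_add.symm] at h
  have h1 : (i.factorial : ℂ) ≠ 0 := by exact_mod_cast i.factorial_ne_zero
  have h2 : (j.factorial : ℂ) ≠ 0 := by exact_mod_cast j.factorial_ne_zero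
  have h3 : ((i + j).factorial : ℂ) ≠ 0 := by exact_mod_cast (i + j).factorial_ne_zero
  field_simp
  rw [← h]
  push_cast
  ring

/-- A map that intertwines `D` and `D'` intertwines their divided powers. -/
theorem map_divPow {D : M →ₗ[ℂ] M} {D' : N →ₗ[ℂ] N} (f : M →ₗ[ℂ] N)
    (h : ∀ a, f (D a) = D' (f a)) (k : ℕ) (a : M) : f (divPow D k a) = divPow D' k (f a) := by
  simp only [divPow, LinearMap.smul_apply, map_smul]
  congr 1
  induction k generalizing a with
  | zero => rfl
  | succ k ih => rw [pow_succ, pow_succ, Module.End.mul_apply, Module.End.mul_apply, ih, h]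

/-- A linear map applied to the coefficients of Hahn series. -/
def mapCoeff (Γ : Type*) [PartialOrder Γ] {M N : Type*} [AddCommGroup M] [Module ℂ M]
    [AddCommGroup N] [Module ℂ N] (f : M →ₗ[ℂ] N) : HahnSeries Γ M →ₗ[ℂ] HahnSeries Γ N where
  toFun x := x.map f
  map_add' x y := by ext; simp
  map_smul' c x := by ext; simp

@[simp]
theorem coeff_mapCoeff {Γ : Type*} [PartialOrder Γ] {M N : Type*} [AddCommGroup M] [Module ℂ M]
    [AddCommGroup N] [Module ℂ N] (f : M →ₗ[ℂ] N) (x : HahnSeries Γ M) (n : Γ) :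
    (mapCoeff Γ f x).coeff n = f (x.coeff n) := rfl

theorem mapCoeff_single {Γ : Type*} [PartialOrder Γ] (f : M →ₗ[ℂ] N) (g : Γ) (a : M) :
    mapCoeff Γ f (HahnSeries.single g a) = HahnSeries.single g (f a) := by
  ext e
  by_cases h : e = g <;> simp [h]

/-- The series `e^{xD} a = ∑ₖ xᵏ Dᵏ a / k!`, as a linear function of `a`. -/
def expLin (D : M →ₗ[ℂ] M) : M →ₗ[ℂ] Laurent M where
  toFun a := HahnSeries.ofSuppBddBelow (fun n : ℤ => if 0 ≤ n then divPow D n.toNat a else 0)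
    ⟨0, fun n hn => by by_contra h; exact hn (if_neg h)⟩
  map_add' a b := by
    ext n
    by_cases h : 0 ≤ n <;> simp [HahnSeries.ofSuppBddBelow, h]
  map_smul' c a := by
    ext n
    by_cases h : 0 ≤ n <;> simp [HahnSeries.ofSuppBddBelow, h]

@[simp]
theorem coeff_expLin_natCast (D : M →ₗ[ℂ] M) (a : M) (n : ℕ) :
    (expLin D a).coeff (n : ℤ) = divPow D n a := by
  change (if 0 ≤ (n : ℤ) then divPow D (n : ℤ).toNat a else 0) = divPow D n a
  rw [if_pos (Int.natCast_nonneg n), Int.toNat_natCast]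

theorem coeff_expLin_of_neg (D : M →ₗ[ℂ] M) (a : M) {n : ℤ} (hn : n < 0) :
    (expLin D a).coeff n = 0 :=
  if_neg (not_le.2 hn)

/-- A map that intertwines `D` and `D'` intertwines their exponentials. -/
theorem mapCoeff_expLin {D : M →ₗ[ℂ] M} {D' : N →ₗ[ℂ] N} (f : M →ₗ[ℂ] N)
    (h : ∀ a, f (D a) = D' (f a)) (a : M) : mapCoeff ℤ f (expLin D a) = expLin D' (f a) := by
  ext n
  rw [coeff_mapCoeff]
  rcases lt_or_ge n 0 with hn | hn
  · rw [coeff_expLin_of_neg _ _ hn, coeff_expLin_of_neg _ _ hn, map_zero]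
  · obtain ⟨n, rfl⟩ := Int.eq_ofNat_of_zero_le hn
    exact (congrArg f (coeff_expLin_natCast D a n)).trans
      ((map_divPow f h n a).trans (coeff_expLin_natCast D' _ n).symm)

/-- `(d/dx) e^{xD} a = e^{xD} D a`. -/
theorem expLin_apply_self (D : M →ₗ[ℂ] M) (a : M) :
    expLin D (D a) = LaurentSeries.derivative ℂ (expLin D a) := by
  ext n
  have hc : (LaurentSeries.derivative ℂ (expLin D a)).coeff n =
      (n + 1) • (expLin D a).coeff (n + 1) := by simp
  rw [hc]
  rcases lt_or_ge n 0 with hn | hn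
  · rw [coeff_expLin_of_neg _ _ hn]
    rcases eq_or_ne n (-1) with rfl | h1
    · simp
    · rw [coeff_expLin_of_neg _ _ (by omega), smul_zero]
  · obtain ⟨n, rfl⟩ := Int.eq_ofNat_of_zero_le hn
    have h1 := coeff_expLin_natCast D (D a) n
    have h2 := coeff_expLin_natCast D a (n + 1)
    have h3 := map_divPow (D := D) (D' := D) D (fun _ => rfl) n a
    push_cast at h2
    rw [h2, ← Int.cast_smul_eq_zsmul ℂ]
    push_cast
    rw [succ_smul_divPow_succ, h3]
    exact h1

/-- `e^{xD} a = a` if `D a = 0`. -/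
theorem expLin_eq_single (D : M →ₗ[ℂ] M) {a : M} (h : D a = 0) :
    expLin D a = HahnSeries.single 0 a := by
  ext n
  rcases lt_or_ge n 0 with hn | hn
  · rw [coeff_expLin_of_neg _ _ hn, HahnSeries.coeff_single_of_ne hn.ne]
  · obtain ⟨n, rfl⟩ := Int.eq_ofNat_of_zero_le hn
    refine (coeff_expLin_natCast D a n).trans ?_
    cases n with
    | zero => simp
    | succ n =>
      rw [HahnSeries.coeff_single_of_ne (by simp; omega)]
      simp [divPow, pow_succ, h]

end DivPow

/-- `D` is a derivation of the (noncommutative) algebra `A`. -/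
def IsDeriv (D : A →ₗ[ℂ] A) : Prop := ∀ a b, D (a * b) = D a * b + a * D b

theorem IsDeriv.map_one {D : A →ₗ[ℂ] A} (hD : IsDeriv D) : D 1 = 0 := by
  have := hD 1 1
  simpa using this

/-- The Leibniz rule for divided powers. -/
theorem IsDeriv.divPow_mul {D : A →ₗ[ℂ] A} (hD : IsDeriv D) (n : ℕ) (a b : A) :
    divPow D n (a * b) =
      ∑ p ∈ Finset.HasAntidiagonal.antidiagonal n, divPow D p.1 a * divPow D p.2 b := by
  induction n with
  | zero => simp
  | succ n ih =>
    have h1 : ((n : ℂ) + 1) ≠ 0 := by exact_mod_cast n.succ_ne_zero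
    refine smul_right_injective A h1 ?_
    simp only
    rw [succ_smul_divPow_succ, ih, map_sum]
    have e : ∀ p ∈ Finset.HasAntidiagonal.antidiagonal (n + 1),
        ((n : ℂ) + 1) • (divPow D p.1 a * divPow D p.2 b)
        = (p.1 : ℂ) • (divPow D p.1 a * divPow D p.2 b)
          + (p.2 : ℂ) • (divPow D p.1 a * divPow D p.2 b) := by
      intro p hp
      rw [← add_smul]
      congr 1
      exact_mod_cast (Finset.HasAntidiagonal.mem_antidiagonal.1 hp).symm
    rw [Finset.smul_sum, Finset.sum_congr rfl e, Finset.sum_add_distrib,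
      Finset.Nat.sum_antidiagonal_succ, Finset.Nat.sum_antidiagonal_succ']
    simp only [Nat.cast_zero, zero_smul, zero_add, Nat.cast_add, Nat.cast_one]
    rw [← Finset.sum_add_distrib]
    refine Finset.sum_congr rfl fun p _ => ?_
    rw [hD, ← succ_smul_divPow_succ, ← succ_smul_divPow_succ, smul_mul_assoc, mul_smul_comm]

theorem coeff_ofPowerSeries_of_neg {R : Type*} [Ring R] (p : R⟦X⟧) {n : ℤ} (hn : n < 0) :
    (HahnSeries.ofPowerSeries ℤ R p).coeff n = 0 := by
  rw [HahnSeries.ofPowerSeries_apply, HahnSeries.embDomain_of_notMem_range]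
  rintro ⟨m, hm⟩
  simp at hm
  omega

theorem expLin_eq_ofPowerSeries (D : A →ₗ[ℂ] A) (a : A) :
    expLin D a = HahnSeries.ofPowerSeries ℤ A (expSeries D a) := by
  ext n
  rcases lt_or_ge n 0 with hn | hn
  · rw [coeff_expLin_of_neg _ _ hn, coeff_ofPowerSeries_of_neg _ hn]
  · obtain ⟨n, rfl⟩ := Int.eq_ofNat_of_zero_le hn
    refine (coeff_expLin_natCast D a n).trans
      (Eq.trans ?_ (HahnSeries.ofPowerSeries_apply_coeff _ n).symm)
    simp [expSeries, divPow]

/-- The homomorphism `a ↦ e^{xD} a` of algebras `A → A((x))` attached to a derivation `D`. -/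
def expHom (D : A →ₗ[ℂ] A) (hD : IsDeriv D) : A →ₐ[ℂ] Laurent A :=
  AlgHom.ofLinearMap (expLin D)
    (by rw [expLin_eq_single D hD.map_one]; rfl)
    (fun a b => by
      simp only [expLin_eq_ofPowerSeries, ← map_mul]
      congr 1
      ext n
      have h : ∀ (c : A) k, PowerSeries.coeff k (expSeries D c) = divPow D k c := fun c k => by
        simp [expSeries, divPow]
      simp only [PowerSeries.coeff_mul, h, hD.divPow_mul])

theorem expHom_apply (D : A →ₗ[ℂ] A) (hD : IsDeriv D) (a : A) : expHom D hD a = expLin D a := rfl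

/-- Homomorphisms that intertwine derivations intertwine their exponentials. -/
theorem mapAlgHom_expHom {D : A →ₗ[ℂ] A} (hD : IsDeriv D) {D' : B →ₗ[ℂ] B} (hD' : IsDeriv D')
    (f : A →ₐ[ℂ] B) (h : ∀ a, f (D a) = D' (f a)) (a : A) :
    mapAlgHom ℤ f (expHom D hD a) = expHom D' hD' (f a) :=
  mapCoeff_expLin f.toLinearMap h a

theorem IsDeriv.mapCoeff {D : A →ₗ[ℂ] A} (hD : IsDeriv D) :
    IsDeriv (A := Laurent A) (mapCoeff ℤ D) := by
  intro x y
  ext n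
  have h1 := HahnSeries.coeff_mul_left' (x := QuantumVA.mapCoeff ℤ D x) (y := y) (a := n)
    (HahnSeries.isPWO_support x) (fun a ha h => ha (by simp [h]))
  have h2 := HahnSeries.coeff_mul_right' (x := x) (y := QuantumVA.mapCoeff ℤ D y) (a := n)
    (HahnSeries.isPWO_support y) (fun a ha h => ha (by simp [h]))
  rw [coeff_mapCoeff, HahnSeries.coeff_mul, HahnSeries.coeff_add, h1, h2, map_sum,
    ← Finset.sum_add_distrib]
  exact Finset.sum_congr rfl fun p _ => hD _ _

/-- The Euler operator `x d/dx` on Laurent series. -/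
def euler {R : Type*} [Ring R] (x : Laurent R) : Laurent R :=
  HahnSeries.ofSuppBddBelow (fun m => m • x.coeff m) ⟨x.order, fun m hm => by
    by_contra h
    exact hm (by simp [HahnSeries.coeff_eq_zero_of_lt_order (not_le.1 h)])⟩

theorem coeff_euler {R : Type*} [Ring R] (x : Laurent R) (n : ℤ) :
    (euler x).coeff n = n • x.coeff n := rfl

theorem euler_mul {R : Type*} [Ring R] (x y : Laurent R) :
    euler (x * y) = euler x * y + x * euler y := by
  ext n
  have h1 := HahnSeries.coeff_mul_left' (x := euler x) (y := y) (a := n)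
    (HahnSeries.isPWO_support x) (fun a ha h => ha (by simp [coeff_euler, h]))
  have h2 := HahnSeries.coeff_mul_right' (x := x) (y := euler y) (a := n)
    (HahnSeries.isPWO_support y) (fun a ha h => ha (by simp [coeff_euler, h]))
  rw [HahnSeries.coeff_add, h1, h2, coeff_euler, HahnSeries.coeff_mul, Finset.smul_sum,
    ← Finset.sum_add_distrib]
  refine Finset.sum_congr rfl fun p hp => ?_
  rw [← (Finset.mem_antidiagonal.1 hp).2.2, coeff_euler, coeff_euler, add_smul, smul_mul_assoc,
    mul_smul_comm]

/-- `d/dx` is a derivation of `A((x))`. It equals `x⁻¹` times the Euler operator. -/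
theorem isDeriv_derivative : IsDeriv (A := Laurent A) (LaurentSeries.derivative ℂ) := by
  have hd : ∀ z : Laurent A, LaurentSeries.derivative ℂ z =
      HahnSeries.single (-1) (1 : A) * euler z := by
    intro z
    ext m
    rw [HahnSeries.coeff_single_mul, coeff_euler]
    simp
  intro x y
  have hs : HahnSeries.single (-1 : ℤ) (1 : A) * x = x * HahnSeries.single (-1 : ℤ) (1 : A) := by
    ext m
    rw [HahnSeries.coeff_single_mul, HahnSeries.coeff_mul_single]
    simp
  rw [hd, hd, hd, euler_mul, ← mul_assoc x, ← hs, mul_add, mul_assoc, mul_assoc]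

end Exp

/-! ### Symbols on the universal enveloping algebra -/

section SymbolRep

attribute [local instance] LieRing.ofAssociativeRing LieAlgebra.ofAssociativeAlgebra

variable {L : Type*} [LieRing L] [LieAlgebra ℂ L] {I : Type*} (b : Module.Basis I ℂ L)

/-- `L` as the space of linear forms in the variables `some i` of `ℂ[Xᵢ, w]`, where `w` stands for
the variable `none`. -/
def linForm : L →ₗ[ℂ] MvPolynomial (Option I) ℂ :=
  b.constr ℂ fun i => MvPolynomial.X (some i)

theorem linForm_basis (i : I) : linForm b (b i) = MvPolynomial.X (some i) := by
  simp [linForm]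

/-- The derivation of `ℂ[Xᵢ, w]` by which `x ∈ L` acts: `y ↦ ⁅x, y⁆` on linear forms in the `Xᵢ`
and `w ↦ δ x`. It is the extension to the symmetric algebra of the action of `x` on the semidirect
product of `L` with the derivation `-δ`. -/
def symDer (δ : LieDerivation ℂ L L) (x : L) :
    Derivation ℂ (MvPolynomial (Option I) ℂ) (MvPolynomial (Option I) ℂ) :=
  MvPolynomial.mkDerivation ℂ fun o => o.elim (linForm b (δ x)) fun i => linForm b ⁅x, b i⁆

theorem symDer_linForm (δ : LieDerivation ℂ L L) (x y : L) :
    symDer b δ x (linForm b y) = linForm b ⁅x, y⁆ := by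
  have h : (symDer b δ x : MvPolynomial (Option I) ℂ →ₗ[ℂ] MvPolynomial (Option I) ℂ) ∘ₗ linForm b
      = linForm b ∘ₗ (LieModule.toEnd ℂ L L x : L →ₗ[ℂ] L) := by
    refine b.ext fun i => ?_
    simp [linForm_basis, symDer]
  exact LinearMap.congr_fun h y

theorem symDer_none (δ : LieDerivation ℂ L L) (x : L) :
    symDer b δ x (MvPolynomial.X none) = linForm b (δ x) := by
  simp [symDer]

/-- The action of `L` on `ℂ[Xᵢ, w]` by derivations. -/
def symLieHom (δ : LieDerivation ℂ L L) :
    L →ₗ⁅ℂ⁆ Module.End ℂ (MvPolynomial (Option I) ℂ) where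
  toFun x := symDer b δ x
  map_add' x y := by
    have : symDer b δ (x + y) = symDer b δ x + symDer b δ y := by
      refine MvPolynomial.derivation_ext fun o => ?_
      cases o <;> simp [symDer]
    simp [this]
  map_smul' c x := by
    have : symDer b δ (c • x) = c • symDer b δ x := by
      refine MvPolynomial.derivation_ext fun o => ?_
      cases o <;> simp [symDer]
    simp [this]
  map_lie' {x y} := by
    have : symDer b δ ⁅x, y⁆ = ⁅symDer b δ x, symDer b δ y⁆ := by
      refine MvPolynomial.derivation_ext fun o => ?_
      rw [Derivation.commutator_apply]
      cases o with
      | none =>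
        rw [symDer_none, symDer_none, symDer_none, symDer_linForm, symDer_linForm,
          LieDerivation.apply_lie_eq_sub, map_sub]
      | some i =>
        rw [← linForm_basis b, symDer_linForm, symDer_linForm, symDer_linForm, symDer_linForm,
          symDer_linForm, ← map_sub]
        congr 1
        simp
    rw [this]
    ext1 z
    simp [LieRing.of_associative_ring_bracket]

/-- The action of `U(L)` on `ℂ[Xᵢ, w]`. -/
def symRep (δ : LieDerivation ℂ L L) :
    UniversalEnvelopingAlgebra ℂ L →ₐ[ℂ] Module.End ℂ (MvPolynomial (Option I) ℂ) :=
  UniversalEnvelopingAlgebra.lift ℂ (symLieHom b δ)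

theorem symRep_ι (δ : LieDerivation ℂ L L) (x : L) (q : MvPolynomial (Option I) ℂ) :
    symRep b δ (UniversalEnvelopingAlgebra.ι ℂ x) q = symDer b δ x q := by
  rw [symRep, UniversalEnvelopingAlgebra.lift_ι_apply]
  rfl

open MvPolynomial in
/-- `x₁ ⋯ xₗ` maps `w^{r + l}` to `(r + 1) ⋯ (r + l) wʳ δx₁ ⋯ δxₗ` modulo `w^{r + 1}`. -/
theorem symRep_prod (δ : LieDerivation ℂ L L) (l : List L) (r : ℕ) :
    ∃ q, symRep b δ (l.map (UniversalEnvelopingAlgebra.ι ℂ)).prod (X none ^ (r + l.length)) =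
      C ((r + l.length).descFactorial l.length : ℂ) * X none ^ r *
        (l.map fun x => linForm b (δ x)).prod + X none ^ (r + 1) * q := by
  induction l generalizing r with
  | nil => exact ⟨0, by simp⟩
  | cons x l ih =>
    obtain ⟨q, hq⟩ := ih (r + 1)
    refine ⟨C ((r + 1 + l.length).descFactorial l.length : ℂ) *
      symDer b δ x (l.map fun x => linForm b (δ x)).prod + (r + 2 : ℂ) • linForm b (δ x) * q +
        X none * symDer b δ x q, ?_⟩
    rw [List.map_cons, List.prod_cons, map_mul, Module.End.mul_apply, List.length_cons,
      show r + (l.length + 1) = r + 1 + l.length by ring, hq, symRep_ι]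
    have hd : ((r + 1 + l.length).descFactorial (l.length + 1) : ℂ) =
        (r + 1) * (r + 1 + l.length).descFactorial l.length := by
      rw [Nat.descFactorial_succ, show r + 1 + l.length - l.length = r + 1 by omega]
      push_cast
      ring
    rw [hd]
    simp only [map_add, Derivation.leibniz, Derivation.leibniz_pow, symDer_none, List.map_cons,
      List.prod_cons, smul_eq_mul, MvPolynomial.derivation_C, MvPolynomial.C_mul,
      MvPolynomial.smul_eq_C_mul, nsmul_eq_mul]
    simp only [map_one, map_natCast, map_ofNat, Nat.add_sub_cancel,
      show r + 1 + 1 - 1 = r + 1 by rfl]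
    push_cast
    ring

/-- Symbols of order `m`: `s` is a functional on an algebra `V` that contains `L` via `j`. It
vanishes on products of fewer than `m` elements of `L`, and on products of `m` elements it is the
product of the values of a functional `p` on `L`. -/
def IsSymbol {L V k : Type*} [AddCommGroup L] [Module ℂ L] [Ring V] [Algebra ℂ V] [CommRing k]
    [Algebra ℂ k] (j : L →ₗ[ℂ] V) (p : L →ₗ[ℂ] k) (s : V →ₗ[ℂ] k) (m : ℕ) : Prop :=
  ∀ l : List L, (l.length < m → s (l.map j).prod = 0) ∧
    (l.length = m → s (l.map j).prod = (l.map p).prod)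

/-- The map `L → U(L)` as a linear map. -/
def ιLin (L : Type*) [LieRing L] [LieAlgebra ℂ L] : L →ₗ[ℂ] UniversalEnvelopingAlgebra ℂ L :=
  (UniversalEnvelopingAlgebra.ι ℂ : L →ₗ⁅ℂ⁆ UniversalEnvelopingAlgebra ℂ L)

/-- The functional `u ↦ (u wᵐ)(p, w = 0) / m!` is a symbol of order `m` on `U(L)`. -/
theorem exists_isSymbol (δ : LieDerivation ℂ L L) (p : L →ₗ[ℂ] ℂ) (m : ℕ) :
    ∃ s : UniversalEnvelopingAlgebra ℂ L →ₗ[ℂ] ℂ,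
      IsSymbol (ιLin L) (p ∘ₗ (δ : L →ₗ[ℂ] L)) s m := by
  let b := Module.Basis.ofVectorSpace ℂ L
  let ev : MvPolynomial (Option (Module.Basis.ofVectorSpaceIndex ℂ L)) ℂ →ₐ[ℂ] ℂ :=
    MvPolynomial.aeval fun o => o.elim 0 fun i => p (b i)
  have hev : ∀ x, ev (linForm b x) = p x := by
    intro x
    have : ev.toLinearMap ∘ₗ linForm b = p := by
      refine b.ext fun i => ?_
      simp [linForm_basis, ev]
    exact LinearMap.congr_fun this x
  have hw : ev (MvPolynomial.X none) = 0 := by simp [ev]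
  refine ⟨((m.factorial : ℂ)⁻¹) • (ev.toLinearMap ∘ₗ
    (LinearMap.applyₗ (R := ℂ) (MvPolynomial.X none ^ m)) ∘ₗ (symRep b δ).toLinearMap),
    fun l => ⟨fun hl => ?_, fun hl => ?_⟩⟩
  · obtain ⟨q, hq⟩ := symRep_prod b δ l (m - l.length)
    rw [Nat.sub_add_cancel hl.le] at hq
    change (m.factorial : ℂ)⁻¹ •
      ev (symRep b δ (l.map (UniversalEnvelopingAlgebra.ι ℂ)).prod (MvPolynomial.X none ^ m)) = 0
    rw [hq]
    simp [hw, Nat.sub_ne_zero_of_lt hl]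
  · obtain ⟨q, hq⟩ := symRep_prod b δ l 0
    rw [Nat.zero_add, hl] at hq
    change (m.factorial : ℂ)⁻¹ •
      ev (symRep b δ (l.map (UniversalEnvelopingAlgebra.ι ℂ)).prod (MvPolynomial.X none ^ m)) =
        (l.map fun x => p (δ x)).prod
    have h2 : (m.factorial : ℂ) ≠ 0 := by exact_mod_cast m.factorial_ne_zero
    rw [hq]
    simp only [map_add, map_mul, hw, Nat.descFactorial_self, pow_zero, mul_one, zero_add,
      pow_one, zero_mul, add_zero, map_list_prod, List.map_map, smul_eq_mul]
    rw [← MvPolynomial.algebraMap_eq, AlgHom.commutes]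
    simp only [Algebra.algebraMap_self, RingHom.id_apply]
    rw [inv_mul_cancel_left₀ h2]
    congr 1
    refine List.map_congr_left fun x _ => ?_
    exact hev _

end SymbolRep

section SymbolHahn

variable {L V k : Type*} [AddCommGroup L] [Module ℂ L] [Ring V] [Algebra ℂ V] [CommRing k]
    [Algebra ℂ k]
variable {Γ : Type*} [AddCommMonoid Γ] [PartialOrder Γ] [IsOrderedCancelAddMonoid Γ]

/-- A symbol applied to the coefficients of Hahn series is again a symbol. -/
theorem IsSymbol.mapCoeff {j : L →ₗ[ℂ] V} {p : L →ₗ[ℂ] k} {s : V →ₗ[ℂ] k} {m : ℕ}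
    (h : IsSymbol j p s m) :
    IsSymbol (V := HahnSeries Γ V) (k := HahnSeries Γ k) (mapCoeff Γ j) (mapCoeff Γ p)
      (mapCoeff Γ s) m := by
  have hC : ∀ v, QuantumVA.mapCoeff Γ s (HahnSeries.C v) = HahnSeries.C (s v) := by
    intro v
    ext e
    by_cases he : e = 0 <;> simp [HahnSeries.C_apply, he]
  -- Constant factors are split off on the left so that the claim passes to the coefficients.
  have key : ∀ (l : List (HahnSeries Γ L)) (l' : List L),
      (l'.length + l.length < m → QuantumVA.mapCoeff Γ s
        (HahnSeries.C (l'.map j).prod * (l.map (QuantumVA.mapCoeff Γ j)).prod) = 0) ∧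
      (l'.length + l.length = m → QuantumVA.mapCoeff Γ s
        (HahnSeries.C (l'.map j).prod * (l.map (QuantumVA.mapCoeff Γ j)).prod) =
          HahnSeries.C (l'.map p).prod * (l.map (QuantumVA.mapCoeff Γ p)).prod) := by
    intro l
    induction l with
    | nil =>
      intro l'
      refine ⟨fun hl => ?_, fun hl => ?_⟩
      · rw [List.map_nil, List.prod_nil, mul_one, hC, (h l').1 (by simpa using hl), map_zero]
      · rw [List.map_nil, List.prod_nil, mul_one, hC, (h l').2 (by simpa using hl), List.map_nil,
          List.prod_nil, mul_one]
    | cons A l ih =>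
      intro l'
      set R := (l.map (QuantumVA.mapCoeff Γ j)).prod
      set R' := (l.map (QuantumVA.mapCoeff Γ p)).prod
      have hR : ∀ e, (QuantumVA.mapCoeff Γ s (HahnSeries.C (l'.map j).prod *
          (QuantumVA.mapCoeff Γ j A * R))).coeff e =
          ∑ i ∈ Finset.antidiagonal A.isPWO_support (R.isPWO_support.union R'.isPWO_support) e,
            (QuantumVA.mapCoeff Γ s (HahnSeries.C ((l' ++ [A.coeff i.1]).map j).prod * R)).coeff
              i.2 := by
        intro e
        rw [coeff_mapCoeff, HahnSeries.C_apply, HahnSeries.coeff_single_zero_mul,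
          coeff_mul_of_subset A.isPWO_support (R.isPWO_support.union R'.isPWO_support)
            (fun a ha h => ha (by simp [h])) Set.subset_union_left, Finset.mul_sum, map_sum]
        refine Finset.sum_congr rfl fun i _ => ?_
        rw [coeff_mapCoeff s, HahnSeries.C_apply, HahnSeries.coeff_single_zero_mul]
        simp [mul_assoc]
      refine ⟨fun hl => ?_, fun hl => ?_⟩
      · ext e
        rw [List.map_cons, List.prod_cons, hR]
        refine Finset.sum_eq_zero fun i _ => ?_
        rw [(ih _).1 (by 
          simp only [List.length_append, List.length_cons, List.length_nil] at hl ⊢; omega)]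
        rfl
      · ext e
        rw [List.map_cons, List.prod_cons, hR, List.map_cons, List.prod_cons, HahnSeries.C_apply,
          HahnSeries.coeff_single_zero_mul,
          coeff_mul_of_subset A.isPWO_support (R.isPWO_support.union R'.isPWO_support)
            (fun a ha h => ha (by simp [h])) Set.subset_union_right, Finset.mul_sum]
        refine Finset.sum_congr rfl fun i _ => ?_
        rw [(ih _).2 (by 
          simp only [List.length_append, List.length_cons, List.length_nil] at hl ⊢; omega),
          HahnSeries.C_apply, HahnSeries.coeff_single_zero_mul]
        simp [mul_assoc, R']
  intro l
  have := key l []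
  simpa using this

end SymbolHahn

/-! ### Independence of vectors detected by symbols -/

section Density

variable {K : Type*} [Field K] {J I : Type*}

/-- Finitely many linearly independent linear forms take arbitrary values simultaneously. -/
theorem exists_forall_eq_of_linearIndependent {Y : J → I → K} (hY : LinearIndependent K Y)
    (F : Finset J) (v : J → K) : ∃ c : I →₀ K, ∀ j ∈ F, (c.sum fun i a => a * Y j i) = v j := by
  classical
  let T : (I →₀ K) →ₗ[K] (F → K) :=
    LinearMap.pi fun j => Finsupp.lsum K fun i => LinearMap.toSpanSingleton K K (Y j i)
  have hT : ∀ c (j : F), T c j = c.sum fun i a => a * Y j i := fun c j => by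
    simp [T, LinearMap.toSpanSingleton]
  suffices h : LinearMap.range T = ⊤ by
    obtain ⟨c, hc⟩ := LinearMap.range_eq_top.1 h fun j => v j
    exact ⟨c, fun j hj => (hT c ⟨j, hj⟩).symm.trans (congrFun hc ⟨j, hj⟩)⟩
  by_contra h
  obtain ⟨f, hf0, hf⟩ := Submodule.exists_le_ker_of_lt_top _ (lt_top_iff_ne_top.2 h)
  have hrel : ∑ j : F, f (Pi.single j 1) • Y j = 0 := by
    funext i
    have h0 : f (T (Finsupp.single i 1)) = 0 := hf ⟨_, rfl⟩
    rw [LinearMap.pi_apply_eq_sum_univ f] at h0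
    have h2 : ∀ j : F, (fun j' => if j = j' then (1 : K) else 0) = Pi.single j 1 := fun j =>
      funext fun j' => by simp [Pi.single_apply, eq_comm]
    simpa [hT, Finsupp.sum_single_index, Finset.sum_apply, mul_comm, h2] using h0
  have h1 := Fintype.linearIndependent_iff.1 (hY.comp (fun j : F => (j : J))
    Subtype.val_injective) (fun j => f (Pi.single j 1)) hrel
  refine hf0 (LinearMap.pi_ext' fun j => LinearMap.ext_ring ?_)
  simpa using h1 j

variable [Algebra ℂ K]

/-- Linearly independent linear forms over an extension `K` of `ℂ` are algebraically independent
as functions on the complex points. -/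
theorem eq_zero_of_forall_eval_eq_zero {Y : J → I → K} (hY : LinearIndependent K Y)
    (Q : MvPolynomial J K)
    (h : ∀ p : I →₀ ℂ,
      MvPolynomial.eval (fun j => p.sum fun i a => algebraMap ℂ K a * Y j i) Q = 0) :
    Q = 0 := by
  have : Infinite K := Infinite.of_injective _ (algebraMap ℂ K).injective
  refine MvPolynomial.funext fun v => ?_
  obtain ⟨c, hc⟩ := exists_forall_eq_of_linearIndependent hY Q.vars v
  classical
  -- `R` is the restriction of `Q` to the span of finitely many coordinate vectors.
  let R : MvPolynomial I K := MvPolynomial.bind₁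
    (fun j => ∑ i ∈ c.support, MvPolynomial.X i * MvPolynomial.C (Y j i)) Q
  have hR : ∀ p : I → K, MvPolynomial.eval p R =
      MvPolynomial.eval (fun j => ∑ i ∈ c.support, p i * Y j i) Q := by
    intro p
    simp only [R, MvPolynomial.eval, MvPolynomial.eval₂Hom_bind₁]
    simp
  have hR0 : R = 0 := by
    refine MvPolynomial.funext_set (fun _ => Set.range (algebraMap ℂ K))
      (fun _ => Set.infinite_range_of_injective (algebraMap ℂ K).injective) fun x hx => ?_
    choose q hq using fun i => hx i (Set.mem_univ i)
    rw [hR, map_zero, ← h (Finsupp.onFinset c.support (fun i => if i ∈ c.support then q i else 0)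
      fun i hi => by by_contra h; exact hi (if_neg h))]
    congr 2
    funext j
    rw [Finsupp.sum_of_support_subset (s := c.support) _ (Finsupp.support_onFinset_subset) _
      (by simp)]
    refine Finset.sum_congr rfl fun i hi => ?_
    rw [Finsupp.onFinset_apply, if_pos hi, hq]
  have h2 := hR c
  rw [hR0, map_zero] at h2
  rw [map_zero, h2]
  refine MvPolynomial.eval₂Hom_congr' rfl (fun j hj _ => ?_) rfl
  exact (hc j hj).symm

/-- Vectors that symbols map to monomials in linearly independent linear forms are linearly
independent: the part of highest degree of a linear relation among the vectors gives a polynomial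
relation among the forms. -/
theorem linearIndependent_of_symbols {M : Type*} [AddCommGroup M] [Module K M] {Y : J → I → K}
    (hY : LinearIndependent K Y) (E : (J →₀ ℕ) → M)
    (h : ∀ (p : I →₀ ℂ) (m : ℕ), ∃ s : M →ₗ[K] K, ∀ α : J →₀ ℕ,
      (α.degree < m → s (E α) = 0) ∧ (α.degree = m → s (E α) =
        α.prod fun j a => (p.sum fun i c => algebraMap ℂ K c * Y j i) ^ a)) :
    LinearIndependent K E := by
  classical
  rw [linearIndependent_iff]
  intro c hc
  by_contra hne
  obtain ⟨α₀, hα₀, hmax⟩ := Finset.exists_max_image c.support Finsupp.degree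
    (Finsupp.support_nonempty_iff.2 hne)
  set m := α₀.degree
  let Q : MvPolynomial J K :=
    ∑ α ∈ c.support with α.degree = m, MvPolynomial.monomial α (c α)
  have hQ : Q = 0 := by
    refine eq_zero_of_forall_eval_eq_zero hY Q fun p => ?_
    obtain ⟨s, hs⟩ := h p m
    have h1 := congrArg s hc
    rw [Finsupp.linearCombination_apply, Finsupp.sum, map_sum, map_zero,
      ← Finset.sum_filter_add_sum_filter_not _ (fun α => α.degree = m)] at h1
    rw [← h1, map_sum]
    rw [Finset.sum_eq_zero (s := c.support.filter fun α => ¬ α.degree = m), add_zero]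
    · refine Finset.sum_congr rfl fun α hα => ?_
      rw [MvPolynomial.eval_monomial, map_smul, (hs α).2 (Finset.mem_filter.1 hα).2, smul_eq_mul]
    · intro α hα
      obtain ⟨h2, h3⟩ := Finset.mem_filter.1 hα
      rw [map_smul, (hs α).1 (lt_of_le_of_ne (hmax α h2) h3), smul_zero]
  have h4 : MvPolynomial.coeff α₀ Q = c α₀ := by
    simp only [Q, MvPolynomial.coeff_sum, MvPolynomial.coeff_monomial]
    rw [Finset.sum_ite_eq' _ α₀]
    exact if_pos (Finset.mem_filter (p := fun α => Finsupp.degree α = m).2 ⟨hα₀, rfl⟩)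
  rw [hQ, MvPolynomial.coeff_zero] at h4
  exact Finsupp.mem_support_iff.1 hα₀ h4.symm

end Density

section Taylor

variable {K : Type*} [Field K] {n : ℕ} (B : Type*)

open Polynomial in
/-- The linear forms `P ↦ (coefficient of (s + ξⱼ)ᵐ in P_b)`, indexed by `(j, b, m)`, on families
`P = (P_b)` of polynomials in `s`; the coordinate `(b, k)` of `P` is the coefficient of `sᵏ` in
`P_b`. -/
def taylorForm [DecidableEq B] (ξ : Fin n → K) : Fin n × B × ℕ → B × ℕ → K :=
  fun j i => if j.2.1 = i.1 then (taylor (-ξ j.1) (X ^ i.2)).coeff j.2.2 else 0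

open Polynomial in
/-- For distinct `ξⱼ` the forms `taylorForm` are linearly independent (Hermite interpolation): a
relation among them is evaluated at a polynomial that vanishes to high order at all points `-ξⱼ`
but one, and at this point to the order of the last coefficient that occurs in the relation. -/
theorem linearIndependent_taylorForm [DecidableEq B] {ξ : Fin n → K}
    (hξ : Function.Injective ξ) : LinearIndependent K (taylorForm B ξ) := by
  rw [linearIndependent_iff]
  intro l hl
  by_contra hne
  obtain ⟨⟨j₁, b, m₁⟩, hj₁⟩ := Finsupp.support_nonempty_iff.2 hne
  obtain ⟨⟨j₀, b₀, m₀⟩, hj₀, hmax⟩ := Finset.exists_max_image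
    (l.support.filter fun i => i.1 = j₁ ∧ i.2.1 = b) (fun i => i.2.2)
    ⟨_, Finset.mem_filter.2 ⟨hj₁, rfl, rfl⟩⟩
  simp only [Finset.mem_filter] at hj₀ hmax
  obtain ⟨hj₀, rfl, rfl⟩ := hj₀
  -- `Λ` is the part of the relation that concerns the component `b₀`.
  let Λ : K[X] →ₗ[K] K := ∑ i ∈ l.support,
    (if i.2.1 = b₀ then l i else 0) • (lcoeff K i.2.2 ∘ₗ taylor (-ξ i.1))
  have hΛ : Λ = 0 := by
    refine lhom_ext' fun k => LinearMap.ext_ring ?_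
    have h1 := congrFun hl (b₀, k)
    rw [Finsupp.linearCombination_apply, Finsupp.sum, Finset.sum_apply] at h1
    simp only [Λ, LinearMap.comp_apply, LinearMap.coe_sum, Finset.sum_apply, LinearMap.smul_apply,
      LinearMap.zero_apply, ← X_pow_eq_monomial, lcoeff_apply, LinearMap.zero_comp]
    refine Eq.trans ?_ h1
    refine Finset.sum_congr rfl fun i _ => ?_
    by_cases hi : i.2.1 = b₀ <;> simp [taylorForm, hi]
  let M : ℕ := l.support.sup (fun i => i.2.2) + 1
  let P : K[X] := (X + C (ξ j₀)) ^ m₀ * ∏ j ∈ Finset.univ.erase j₀, (X + C (ξ j)) ^ M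
  have hP : Λ P = 0 := by rw [hΛ]; rfl
  have ht : ∀ j, taylor (-ξ j) P =
      (X + C (ξ j₀ - ξ j)) ^ m₀ * ∏ j' ∈ Finset.univ.erase j₀, (X + C (ξ j' - ξ j)) ^ M := by
    intro j
    simp only [P, taylor_apply, mul_comp, pow_comp, prod_comp, add_comp, X_comp, C_comp, add_assoc,
      ← C_add, neg_add_eq_sub]
  have hP2 : Λ P = l (j₀, b₀, m₀) * ∏ j' ∈ Finset.univ.erase j₀, (ξ j' - ξ j₀) ^ M := by
    simp only [Λ, LinearMap.comp_apply, LinearMap.coe_sum, Finset.sum_apply, LinearMap.smul_apply,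
      lcoeff_apply]
    rw [Finset.sum_eq_single_of_mem (j₀, b₀, m₀) hj₀]
    · rw [if_pos rfl, ht]
      simp only [sub_self, C_0, add_zero, smul_eq_mul]
      rw [show m₀ = 0 + m₀ by simp, pow_add, pow_zero, one_mul, coeff_X_pow_mul,
        coeff_zero_eq_eval_zero, eval_prod]
      simp
    · rintro ⟨j, b, m⟩ hi hne
      by_cases hb : b = b₀
      · subst hb
        rw [if_pos rfl, ht]
        by_cases hj : j = j₀
        · subst hj
          have hm : m < m₀ := lt_of_le_of_ne (hmax _ ⟨hi, rfl, rfl⟩) (by rintro rfl; exact hne rfl)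
          simp only [sub_self, C_0, add_zero, smul_eq_mul]
          rw [coeff_X_pow_mul', if_neg (by simpa using hm), mul_zero]
        · have hm : m < M := Nat.lt_succ_of_le
            (Finset.le_sup (f := fun i : Fin n × B × ℕ => i.2.2) hi)
          rw [← Finset.mul_prod_erase _ _ (Finset.mem_erase.2 ⟨hj, Finset.mem_univ j⟩),
            mul_left_comm]
          simp only [sub_self, C_0, add_zero, smul_eq_mul]
          rw [coeff_X_pow_mul', if_neg (by simpa using hm), mul_zero]
      · rw [if_neg hb, zero_smul]
  rw [hP2] at hP
  rcases mul_eq_zero.1 hP with h0 | h0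
  · exact Finsupp.mem_support_iff.1 hj₀ h0
  · rw [Finset.prod_eq_zero_iff] at h0
    obtain ⟨j', hj', h0⟩ := h0
    exact (Finset.mem_erase.1 hj').1 (hξ (sub_eq_zero.1 (pow_eq_zero_iff (by simp [M]) |>.1 h0)))

end Taylor

/-! ### Spanning of the universal enveloping algebra by monomials -/

section Generation

attribute [local instance] LieRing.ofAssociativeRing LieAlgebra.ofAssociativeAlgebra

variable {L : Type*} [LieRing L] [LieAlgebra ℂ L]

theorem ιLin_lie (x y : L) : ιLin L ⁅x, y⁆ = ιLin L x * ιLin L y - ιLin L y * ιLin L x := by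
  change UniversalEnvelopingAlgebra.ι ℂ ⁅x, y⁆ = _
  rw [LieHom.map_lie, LieRing.of_associative_ring_bracket]
  rfl

/-- `U(L)` is the only subspace that contains `1` and is closed under left multiplication by
`L`. -/
theorem eq_top_of_one_mem_of_mul_mem {W : Submodule ℂ (UniversalEnvelopingAlgebra ℂ L)}
    (h1 : 1 ∈ W) (hmul : ∀ x, ∀ u ∈ W, ιLin L x * u ∈ W) : W = ⊤ := by
  let S : Subalgebra ℂ (UniversalEnvelopingAlgebra ℂ L) :=
    { carrier := {u | ∀ w ∈ W, u * w ∈ W}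
      mul_mem' := fun {a b} ha hb w hw => by rw [mul_assoc]; exact ha _ (hb _ hw)
      add_mem' := fun {a b} ha hb w hw => by rw [add_mul]; exact W.add_mem (ha _ hw) (hb _ hw)
      algebraMap_mem' := fun r w hw => by rw [← Algebra.smul_def]; exact W.smul_mem r hw }
  let f : L →ₗ⁅ℂ⁆ S :=
    { toFun := fun x => ⟨ιLin L x, hmul x⟩
      map_add' := fun x y => Subtype.ext (map_add _ _ _)
      map_smul' := fun c x => Subtype.ext (map_smul _ _ _)
      map_lie' := fun {x y} => Subtype.ext (ιLin_lie x y) }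
  have hS : S.val.comp (UniversalEnvelopingAlgebra.lift ℂ f) = AlgHom.id ℂ _ := by
    refine UniversalEnvelopingAlgebra.hom_ext ℂ (LieHom.ext fun x => ?_)
    change S.val (UniversalEnvelopingAlgebra.lift ℂ f (UniversalEnvelopingAlgebra.ι ℂ x)) = _
    rw [UniversalEnvelopingAlgebra.lift_ι_apply]
    rfl
  refine (Submodule.eq_top_iff').2 fun u => ?_
  have hu : u ∈ S := by
    have := DFunLike.congr_fun hS u
    rw [AlgHom.id_apply] at this
    rw [← this]
    exact (UniversalEnvelopingAlgebra.lift ℂ f u).2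
  simpa using hu 1 h1

variable {I : Type*} (x : I → L)

/-- The span of the products of fewer than `n` elements of the family `x`. -/
def wordSpan (n : ℕ) : Submodule ℂ (UniversalEnvelopingAlgebra ℂ L) :=
  Submodule.span ℂ {u | ∃ l : List I, l.length < n ∧ u = (l.map fun i => ιLin L (x i)).prod}

theorem wordSpan_mono : Monotone (wordSpan x) := fun _ _ h =>
  Submodule.span_mono fun _ ⟨l, hl, h'⟩ => ⟨l, by omega, h'⟩

theorem mul_mem_wordSpan {n : ℕ} (i : I) {u : UniversalEnvelopingAlgebra ℂ L}
    (hu : u ∈ wordSpan x n) : ιLin L (x i) * u ∈ wordSpan x (n + 1) := by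
  induction hu using Submodule.span_induction with
  | mem u hu =>
    obtain ⟨l, hl, rfl⟩ := hu
    exact Submodule.subset_span ⟨i :: l, by simpa using hl, by simp⟩
  | zero => simp
  | add u v _ _ h h' => rw [mul_add]; exact Submodule.add_mem _ h h'
  | smul c u _ h => rw [mul_smul_comm]; exact Submodule.smul_mem _ c h

/-- Permuting the factors of a product changes it by shorter products only. -/
theorem prod_sub_prod_mem_wordSpan (hx : Submodule.span ℂ (Set.range x) = ⊤) {l l' : List I}
    (h : l.Perm l') : (l.map fun i => ιLin L (x i)).prod - (l'.map fun i => ιLin L (x i)).prod ∈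
      wordSpan x l.length := by
  induction h with
  | nil => simp
  | cons i h ih =>
    simp only [List.map_cons, List.prod_cons, List.length_cons, ← mul_sub]
    exact mul_mem_wordSpan x i ih
  | swap i j l =>
    simp only [List.map_cons, List.prod_cons, List.length_cons]
    rw [← mul_assoc, ← mul_assoc, ← sub_mul, ← ιLin_lie]
    have hmem : ⁅x j, x i⁆ ∈ Submodule.span ℂ (Set.range x) := hx ▸ Submodule.mem_top
    generalize ⁅x j, x i⁆ = y at hmem
    induction hmem using Submodule.span_induction with
    | mem u hu =>
      obtain ⟨i, rfl⟩ := hu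
      exact Submodule.subset_span ⟨i :: l, by simp, by simp⟩
    | zero => simp
    | add u v _ _ h h' => rw [map_add, add_mul]; exact Submodule.add_mem _ h h'
    | smul c u _ h => rw [map_smul, smul_mul_assoc]; exact Submodule.smul_mem _ c h
  | trans h₁ h₂ ih₁ ih₂ =>
    rw [← h₁.length_eq] at ih₂
    simpa using Submodule.add_mem _ ih₁ ih₂

/-- The monomial `∏ᵢ xᵢ^αᵢ` in `U(L)`, the factors being multiplied in some order. -/
def monomialU (α : I →₀ ℕ) : UniversalEnvelopingAlgebra ℂ L :=
  (α.toMultiset.toList.map fun i => ιLin L (x i)).prod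

/-- The spanning half of the Poincaré–Birkhoff–Witt theorem. -/
theorem span_monomialU (hx : Submodule.span ℂ (Set.range x) = ⊤) :
    Submodule.span ℂ (Set.range (monomialU x)) = ⊤ := by
  classical
  have key : ∀ n, wordSpan x n ≤ Submodule.span ℂ (Set.range (monomialU x)) := by
    intro n
    induction n with
    | zero => exact Submodule.span_le.2 fun u ⟨l, hl, _⟩ => absurd hl (Nat.not_lt_zero _)
    | succ n ih =>
      refine Submodule.span_le.2 ?_
      rintro _ ⟨l, hl, rfl⟩
      let α : I →₀ ℕ := Multiset.toFinsupp (l : Multiset I)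
      have hp : l.Perm α.toMultiset.toList := by
        rw [← Multiset.coe_eq_coe, Multiset.coe_toList, Multiset.toFinsupp_toMultiset]
      have h1 := Submodule.add_mem _
        (ih (wordSpan_mono x (Nat.le_of_lt_succ hl) (prod_sub_prod_mem_wordSpan x hx hp)))
        (Submodule.subset_span (Set.mem_range_self (f := monomialU x) α))
      rwa [monomialU, sub_add_cancel] at h1
  have hW : (⨆ n, wordSpan x n) = ⊤ := by
    have hmem : ∀ u, u ∈ ⨆ n, wordSpan x n ↔ ∃ n, u ∈ wordSpan x n := fun u =>
      Submodule.mem_iSup_of_directed _ (wordSpan_mono x).directed_le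
    refine eq_top_of_one_mem_of_mul_mem ?_ fun y u hu => ?_
    · exact (hmem _).2 ⟨1, Submodule.subset_span ⟨[], by simp, by simp⟩⟩
    · obtain ⟨n, hn⟩ := (hmem _).1 hu
      have hy : y ∈ Submodule.span ℂ (Set.range x) := hx ▸ Submodule.mem_top
      refine (hmem _).2 ⟨n + 1, ?_⟩
      induction hy using Submodule.span_induction with
      | mem y hy =>
        obtain ⟨i, rfl⟩ := hy
        exact mul_mem_wordSpan x i hn
      | zero => simp
      | add u v _ _ h h' => rw [map_add, add_mul]; exact Submodule.add_mem _ h h'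
      | smul c u _ h => rw [map_smul, smul_mul_assoc]; exact Submodule.smul_mem _ c h
  exact top_le_iff.1 (hW ▸ iSup_le key)

end Generation

/-! ### The Lie algebra `𝔤 ⊗ t⁻¹ℂ[t⁻¹]` -/

section NegLoop

variable {𝔤 : Type*} [LieRing 𝔤] [LieAlgebra ℂ 𝔤]

/-- The element `t^{-m-1} ⊗ a` of `𝔤 ⊗ t⁻¹ℂ[t⁻¹]`, as a linear function of `a`. -/
def pole (m : ℕ) : 𝔤 →ₗ[ℂ] negLoop 𝔤 :=
  LinearMap.codRestrict (negLoop 𝔤).toSubmodule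
    (TensorProduct.mk ℂ (ℂ[T;T⁻¹]) 𝔤 (LaurentPolynomial.T (-m - 1)))
    fun a => Submodule.subset_span ⟨-m - 1, a, by omega, rfl⟩

theorem coe_pole (m : ℕ) (a : 𝔤) :
    (pole m a : ℂ[T;T⁻¹] ⊗[ℂ] 𝔤) = LaurentPolynomial.T (-m - 1) ⊗ₜ a := rfl

theorem lie_pole (m n : ℕ) (a b : 𝔤) : ⁅pole m a, pole n b⁆ = pole (m + n + 1) ⁅a, b⁆ := by
  refine Subtype.ext ?_
  rw [LieSubalgebra.coe_bracket, coe_pole, coe_pole, coe_pole,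
    LieAlgebra.ExtendScalars.bracket_tmul, ← LaurentPolynomial.T_add]
  congr 2
  push_cast
  ring

theorem negLoopDerivation_pole (m : ℕ) (a : 𝔤) :
    negLoopDerivation 𝔤 (pole m a) = (-((m : ℂ) + 1)) • pole (m + 1) a := by
  refine Subtype.ext ?_
  change ddt.rTensor 𝔤 (LaurentPolynomial.T (-m - 1) ⊗ₜ a) =
    (-((m : ℂ) + 1)) • (LaurentPolynomial.T (-((m + 1 : ℕ) : ℤ) - 1) ⊗ₜ a)
  rw [LinearMap.rTensor_tmul, ddt_T, TensorProduct.smul_tmul']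
  push_cast
  congr 2
  · ring
  · congr 1; ring

theorem span_pole {B : Type*} (β : Module.Basis B ℂ 𝔤) :
    Submodule.span ℂ (Set.range fun i : B × ℕ => pole i.2 (β i.1)) = ⊤ := by
  have hp : ∀ (m : ℕ) (a : 𝔤),
      pole m a ∈ Submodule.span ℂ (Set.range fun i : B × ℕ => pole i.2 (β i.1)) := by
    intro m a
    have ha : a ∈ Submodule.span ℂ (Set.range β) := β.span_eq ▸ Submodule.mem_top
    induction ha using Submodule.span_induction with
    | mem a ha =>
      obtain ⟨i, rfl⟩ := ha
      exact Submodule.subset_span ⟨(i, m), rfl⟩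
    | zero => simp
    | add u v _ _ h h' => rw [map_add]; exact Submodule.add_mem _ h h'
    | smul c u _ h => rw [map_smul]; exact Submodule.smul_mem _ c h
  refine Submodule.eq_top_iff'.2 ?_
  rintro ⟨z, hz⟩
  induction hz using Submodule.span_induction with
  | mem z hz =>
    obtain ⟨n, a, hn, rfl⟩ := hz
    obtain ⟨m, rfl⟩ : ∃ m : ℕ, n = -m - 1 := ⟨(-n - 1).toNat, by omega⟩
    exact hp m a
  | zero => exact Submodule.zero_mem _
  | add u v hu hv h h' => exact Submodule.add_mem _ h h'
  | smul c u hu h => exact Submodule.smul_mem _ c h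

/-- There are linear functionals on `𝔤 ⊗ t⁻¹ℂ[t⁻¹]` with arbitrary values on `t^{-m-1} ⊗ β b`. -/
theorem exists_functional {B : Type*} (β : Module.Basis B ℂ 𝔤) (q : B × ℕ → ℂ) :
    ∃ p : negLoop 𝔤 →ₗ[ℂ] ℂ, ∀ i : B × ℕ, p (pole i.2 (β i.1)) = q i := by
  let f : ℂ[T;T⁻¹] ⊗[ℂ] 𝔤 →ₗ[ℂ] ℂ :=
    ((AddMonoidAlgebra.basis ℤ ℂ).tensorProduct β).constr ℂ fun i => q (i.2, (-i.1 - 1).toNat)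
  refine ⟨f ∘ₗ (negLoop 𝔤).toSubmodule.subtype, fun i => ?_⟩
  change f (LaurentPolynomial.T (-i.2 - 1) ⊗ₜ β i.1) = q i
  rw [LaurentPolynomial.T, ← AddMonoidAlgebra.basis_apply, ← Module.Basis.tensorProduct_apply,
    Module.Basis.constr_basis]
  congr 2
  simp

/-- The divided powers of `d/dt` on `t^{-m-1} ⊗ a`. -/
theorem divPow_negLoopDerivation_pole (r m : ℕ) (a : 𝔤) :
    divPow (negLoopDerivation 𝔤 : negLoop 𝔤 →ₗ[ℂ] negLoop 𝔤) r (pole m a) =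
      ((-1 : ℂ) ^ r * (m + r).choose r) • pole (m + r) a := by
  induction r with
  | zero => simp
  | succ r ih =>
    have h2 : ((r : ℂ) + 1) ≠ 0 := by exact_mod_cast r.succ_ne_zero
    refine smul_right_injective _ h2 ?_
    simp only
    rw [succ_smul_divPow_succ, ih, map_smul]
    change _ • negLoopDerivation 𝔤 (pole (m + r) a) = _
    rw [negLoopDerivation_pole, smul_smul, smul_smul, ← add_assoc]
    congr 1
    have h3 := Nat.add_one_mul_choose_eq (m + r) r
    have h4 : ((m + r + 1 : ℕ) : ℂ) * (m + r).choose r = (m + r + 1).choose (r + 1) * (r + 1) := by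
      exact_mod_cast h3
    push_cast at h4 ⊢
    rw [pow_succ]
    linear_combination (-(-1) ^ r) * h4

/-- The derivation `d` of `U(𝔤 ⊗ t⁻¹ℂ[t⁻¹])`. -/
abbrev dU (𝔤 : Type*) [LieRing 𝔤] [LieAlgebra ℂ 𝔤] : UNegLoop 𝔤 →ₗ[ℂ] UNegLoop 𝔤 :=
  envelopingDerivation (negLoopDerivation 𝔤)

theorem isDeriv_dU : IsDeriv (dU 𝔤) := envelopingDerivation_mul _

/-- The homomorphism `u ↦ e^{xd} u`. -/
abbrev field (𝔤 : Type*) [LieRing 𝔤] [LieAlgebra ℂ 𝔤] : UNegLoop 𝔤 →ₐ[ℂ] Laurent (UNegLoop 𝔤) :=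
  expHom (dU 𝔤) isDeriv_dU

theorem ιLin_negLoopDerivation (x : negLoop 𝔤) :
    ιLin _ ((negLoopDerivation 𝔤 : negLoop 𝔤 →ₗ[ℂ] negLoop 𝔤) x) = dU 𝔤 (ιLin _ x) :=
  (envelopingDerivation_ι _ x).symm

theorem divPow_pole (r m : ℕ) (a : 𝔤) :
    divPow (dU 𝔤) r (ιLin _ (pole m a)) =
      ((-1 : ℂ) ^ r * (m + r).choose r) • ιLin _ (pole (m + r) a) := by
  rw [← map_divPow (ιLin _) ιLin_negLoopDerivation, divPow_negLoopDerivation_pole, map_smul]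

end NegLoop

/-! ### Systems of fields and their symbols -/

section MulMap

variable {K A : Type*} [CommRing K] [Algebra ℂ K] [Ring A] [Algebra ℂ A]
variable {W : Type*} [AddCommGroup W] [Module ℂ W]

/-- The map `W ⊗ K → A`, `w ⊗ f ↦ f E(w)`, for an algebra `A` that contains `K` via `κ`. -/
def mulMap (κ : K →ₐ[ℂ] A) (E : W →ₗ[ℂ] A) : W ⊗[ℂ] K →ₗ[ℂ] A :=
  TensorProduct.lift ((LinearMap.mul ℂ A).flip.compl₁₂ E κ.toLinearMap)

@[simp]
theorem mulMap_tmul (κ : K →ₐ[ℂ] A) (E : W →ₗ[ℂ] A) (w : W) (f : K) :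
    mulMap κ E (w ⊗ₜ f) = κ f * E w := by
  simp [mulMap]

theorem mulMap_injective (κ : K →ₐ[ℂ] A) (E : W →ₗ[ℂ] A) {X : Type*} (b : Module.Basis X ℂ W)
    (h : ∀ c : X →₀ K, (c.sum fun i f => κ f * E (b i)) = 0 → c = 0) :
    Function.Injective (mulMap κ E) := by
  classical
  rw [injective_iff_map_eq_zero]
  intro z hz
  have h1 : ∀ c : X →₀ K, mulMap κ E ((TensorProduct.equivFinsuppOfBasisLeft b).symm c) =
      c.sum fun i f => κ f * E (b i) := by
    intro c
    rw [TensorProduct.equivFinsuppOfBasisLeft_symm_apply, Finsupp.sum, map_sum]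
    simp [Finsupp.sum]
  obtain ⟨c, rfl⟩ := (TensorProduct.equivFinsuppOfBasisLeft b).symm.surjective z
  rw [h c ((h1 c).symm.trans hz), map_zero]

end MulMap

section FieldSystem

variable {𝔤 : Type*} [LieRing 𝔤] [LieAlgebra ℂ 𝔤] {B : Type*} [DecidableEq B]
variable (β : Module.Basis B ℂ 𝔤)
variable {K A : Type*} [Field K] [Algebra ℂ K] [Ring A] [Algebra ℂ A]

/-- Homomorphisms `φ₁, …, φₙ` from `U(𝔤 ⊗ t⁻¹ℂ[t⁻¹])` to an extension `A` of `K` such that `φⱼ`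
has the symbols of `e^{ξⱼ d}`. -/
def IsFieldSystem (κ : K →ₐ[ℂ] A) {n : ℕ} (ξ : Fin n → K) (φ : Fin n → UNegLoop 𝔤 →ₐ[ℂ] A) :
    Prop :=
  ∀ (q : B × ℕ →₀ ℂ) (m : ℕ), ∃ s : A →+ K, (∀ f a, s (κ f * a) = f * s a) ∧
    ∀ l : List (Fin n × B × ℕ),
      (l.length < m → s (l.map fun j => φ j.1 (ιLin _ (pole j.2.2 (β j.2.1)))).prod = 0) ∧
      (l.length = m → s (l.map fun j => φ j.1 (ιLin _ (pole j.2.2 (β j.2.1)))).prod =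
        (l.map fun j => q.sum fun i c => algebraMap ℂ K c * taylorForm B ξ j i).prod)

/-- The monomials of `U(𝔤 ⊗ t⁻¹ℂ[t⁻¹])` in a basis of `𝔤`. -/
abbrev negMonomial : (B × ℕ →₀ ℕ) → UNegLoop 𝔤 :=
  monomialU fun i : B × ℕ => pole i.2 (β i.1)

variable {β}

/-- The products `φ_{σ 1}(e^{α_{σ 1}}) ⋯ φ_{σ n}(e^{α_{σ n}})` of monomials are independent over
`K`, in any fixed order `σ` of the factors: symbols do not see the order, and the forms that they
produce are linearly independent. -/
theorem IsFieldSystem.eq_zero_of_sum_eq_zero {κ : K →ₐ[ℂ] A} {n : ℕ} {ξ : Fin n → K}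
    {φ : Fin n → UNegLoop 𝔤 →ₐ[ℂ] A} (h : IsFieldSystem β κ ξ φ) (hξ : Function.Injective ξ)
    {σ : List (Fin n)} (hσ : σ.Perm (List.finRange n)) (c : (Fin n → (B × ℕ →₀ ℕ)) →₀ K)
    (hc : (c.sum fun α f => κ f * (σ.map fun j => φ j (negMonomial β (α j))).prod) = 0) :
    c = 0 := by
  let _ : Module K A := Module.compHom A (κ : K →+* A)
  let e : ((Fin n × B × ℕ) →₀ ℕ) ≃ (Fin n → (B × ℕ →₀ ℕ)) :=
    Finsupp.curryEquiv.trans Finsupp.equivFunOnFinite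
  -- `w α` lists the generators in the product with exponents `α`, in the order of the factors.
  let w : ((Fin n × B × ℕ) →₀ ℕ) → List (Fin n × B × ℕ) := fun α =>
    σ.flatMap fun j => ((e α) j).toMultiset.toList.map fun i => (j, i)
  have hw : ∀ α, (w α : Multiset (Fin n × B × ℕ)) = α.toMultiset := by
    intro α
    refine Multiset.ext.2 fun ⟨j, i⟩ => ?_
    have hσ' : (σ : Multiset (Fin n)) = Finset.univ.val :=
      (Multiset.coe_eq_coe.2 hσ).trans rfl
    have h1 : ∀ j', Multiset.count (j, i) ((e α j').toMultiset.map fun i => (j', i)) =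
        if j = j' then α (j, i) else 0 := by
      intro j'
      split_ifs with hj
      · subst hj
        rw [Multiset.count_map_eq_count' _ _ fun _ _ h => (Prod.mk.inj h).2,
          Finsupp.count_toMultiset]
        rfl
      · refine Multiset.count_eq_zero.2 fun hm => hj ?_
        obtain ⟨_, _, h2⟩ := Multiset.mem_map.1 hm
        exact (Prod.mk.inj h2).1.symm
    have h2 : (w α : Multiset (Fin n × B × ℕ)) =
        Multiset.bind Finset.univ.val fun j => (e α j).toMultiset.map fun i => (j, i) := by
      rw [← hσ', ← Multiset.coe_bind]
      refine Multiset.bind_congr fun j _ => ?_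
      rw [← Multiset.map_coe, Multiset.coe_toList]
    rw [h2, Multiset.count_bind, Finsupp.count_toMultiset]
    simp only [h1]
    exact (Finset.sum_ite_eq Finset.univ j _).trans (if_pos (Finset.mem_univ j))
  let E : ((Fin n × B × ℕ) →₀ ℕ) → A := fun α => (σ.map fun j => φ j (negMonomial β (e α j))).prod
  have hE : ∀ α, E α = ((w α).map fun j => φ j.1 (ιLin _ (pole j.2.2 (β j.2.1)))).prod := by
    intro α
    simp only [E, w, negMonomial, monomialU, List.flatMap, List.map_flatten, List.prod_flatten,
      List.map_map, map_list_prod, Function.comp_def]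
  have hlin : LinearIndependent K E := by
    refine linearIndependent_of_symbols (linearIndependent_taylorForm B hξ) E fun q m => ?_
    obtain ⟨s, hs1, hs2⟩ := h q m
    refine ⟨{ toFun := s, map_add' := s.map_add, map_smul' := hs1 }, fun α => ?_⟩
    have hd : (w α).length = α.degree := by
      rw [← Multiset.coe_card, hw, Finsupp.card_toMultiset]
      rfl
    change (_ → s (E α) = 0) ∧ (_ → s (E α) = _)
    rw [hE, ← hd]
    refine ⟨(hs2 (w α)).1, fun hm => ((hs2 (w α)).2 hm).trans ?_⟩
    rw [← Multiset.prod_coe, ← Multiset.map_coe, hw, Finsupp.toMultiset_map,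
      Finsupp.prod_toMultiset, Finsupp.prod_mapDomain_index (fun _ => pow_zero _)
        (fun _ _ _ => pow_add _ _ _)]
  have h3 := hlin.comp e.symm e.symm.injective
  refine linearIndependent_iff.1 h3 c ?_
  rw [Finsupp.linearCombination_apply, ← hc]
  refine Finsupp.sum_congr fun α _ => ?_
  change κ (c α) * (σ.map fun j => φ j (negMonomial β (e (e.symm α) j))).prod = _
  rw [e.apply_symm_apply]

end FieldSystem

section Systems

variable {𝔤 : Type*} [LieRing 𝔤] [LieAlgebra ℂ 𝔤] {B : Type*} (β : Module.Basis B ℂ 𝔤)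

/-- The derivation `d/dt` of `𝔤 ⊗ t⁻¹ℂ[t⁻¹]` as a linear map. -/
abbrev dL (𝔤 : Type*) [LieRing 𝔤] [LieAlgebra ℂ 𝔤] : negLoop 𝔤 →ₗ[ℂ] negLoop 𝔤 :=
  (negLoopDerivation 𝔤 : negLoop 𝔤 →ₗ[ℂ] negLoop 𝔤)

/-- Symbols with prescribed values on the basis `t^{-m-1} ⊗ β b`; they exist because `d/dt` maps
this basis to nonzero multiples of distinct basis vectors. -/
theorem exists_isSymbol_pole (q : B × ℕ → ℂ) (m : ℕ) :
    ∃ (p : negLoop 𝔤 →ₗ[ℂ] ℂ) (s : UNegLoop 𝔤 →ₗ[ℂ] ℂ), IsSymbol (ιLin _) p s m ∧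
      ∀ i : B × ℕ, p (pole i.2 (β i.1)) = q i := by
  obtain ⟨p, hp⟩ := exists_functional β fun i => -(i.2 : ℂ)⁻¹ * q (i.1, i.2 - 1)
  obtain ⟨s, hs⟩ := exists_isSymbol (negLoopDerivation 𝔤) p m
  refine ⟨p ∘ₗ dL 𝔤, s, hs, fun i => ?_⟩
  change p (negLoopDerivation 𝔤 (pole i.2 (β i.1))) = q i
  have h1 : ((i.2 : ℂ) + 1) ≠ 0 := by exact_mod_cast i.2.succ_ne_zero
  rw [negLoopDerivation_pole, map_smul, hp (i.1, i.2 + 1)]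
  simp only [Nat.add_sub_cancel, smul_eq_mul]
  push_cast
  field_simp

variable [DecidableEq B] {K : Type*} [Field K] [Algebra ℂ K]

/-- The coefficient of `(s + ξ)ᵐ` in the polynomial `∑ₖ q(b, k) sᵏ`. -/
def taylorValue (q : B × ℕ →₀ ℂ) (ξ : K) (b : B) (m : ℕ) : K :=
  q.sum fun i c => algebraMap ℂ K c * taylorForm B (fun _ : Fin 1 => ξ) (0, b, m) i

theorem sum_taylorForm (q : B × ℕ →₀ ℂ) {n : ℕ} (ξ : Fin n → K) (j : Fin n × B × ℕ) :
    (q.sum fun i c => algebraMap ℂ K c * taylorForm B ξ j i) =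
      taylorValue q (ξ j.1) j.2.1 j.2.2 := rfl

theorem taylorValue_eq (q : B × ℕ →₀ ℂ) (ξ : K) (b : B) (m : ℕ) :
    taylorValue q ξ b m = q.sum fun i c => algebraMap ℂ K c *
      if b = i.1 then (-ξ) ^ (i.2 - m) * (i.2.choose m : K) else 0 := by
  refine Finsupp.sum_congr fun i _ => ?_
  rw [taylorForm]
  congr 2
  simp [← sub_eq_add_neg, ← Polynomial.coeff_X_add_C_pow]

theorem taylorValue_zero (q : B × ℕ →₀ ℂ) (b : B) (m : ℕ) :
    taylorValue q (0 : K) b m = algebraMap ℂ K (q (b, m)) := by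
  rw [taylorValue_eq, Finsupp.sum_eq_single (b, m)]
  · simp
  · rintro ⟨b', k⟩ _ hne
    rcases eq_or_ne b b' with rfl | hb
    · have hk : k ≠ m := fun h => hne (by rw [h])
      rcases lt_or_gt_of_ne hk with h | h
      · simp [Nat.choose_eq_zero_of_lt h]
      · simp [Nat.sub_ne_zero_of_lt h]
    · simp [hb]
  · simp

theorem map_taylorValue {K' : Type*} [Field K'] [Algebra ℂ K'] (f : K →ₐ[ℂ] K')
    (q : B × ℕ →₀ ℂ) (ξ : K) (b : B) (m : ℕ) :
    f (taylorValue q ξ b m) = taylorValue q (f ξ) b m := by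
  rw [taylorValue_eq, taylorValue_eq, Finsupp.sum, Finsupp.sum, map_sum]
  refine Finset.sum_congr rfl fun i _ => ?_
  split_ifs <;> simp

/-- The variable `x` of `ℂ((x))`. -/
abbrev varX : Laurent ℂ := HahnSeries.single 1 1

/-- A functional with coordinates `q` maps `e^{xd}(t^{-m-1} ⊗ b) = (t + x)^{-m-1} ⊗ b` to the
Taylor coefficient of `q` at `-x`. -/
theorem mapCoeff_expLin_pole {p : negLoop 𝔤 →ₗ[ℂ] ℂ} {q : B × ℕ →₀ ℂ}
    (hp : ∀ i : B × ℕ, p (pole i.2 (β i.1)) = q i) (b : B) (m : ℕ) :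
    mapCoeff ℤ p (expLin (dL 𝔤) (pole m (β b))) = taylorValue q varX b m := by
  ext n
  rw [coeff_mapCoeff, taylorValue_eq, Finsupp.sum, HahnSeries.coeff_sum]
  have hX : ∀ k : ℕ, (-varX) ^ k = HahnSeries.single (k : ℤ) ((-1 : ℂ) ^ k) := by
    intro k
    rw [← HahnSeries.single_neg, HahnSeries.single_pow]
    simp
  have hterm : ∀ i : B × ℕ, (algebraMap ℂ (Laurent ℂ) (q i) * if b = i.1 then
      (-varX) ^ (i.2 - m) * (i.2.choose m : Laurent ℂ) else 0).coeff n =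
      if b = i.1 ∧ n = ((i.2 - m : ℕ) : ℤ) then q i * ((-1) ^ (i.2 - m) * i.2.choose m) else 0 := by
    intro i
    rw [HahnSeries.algebraMap_apply, HahnSeries.C_mul_eq_smul, HahnSeries.coeff_smul]
    by_cases hb : b = i.1
    · rw [if_pos hb, hX, ← HahnSeries.single_zero_natCast, HahnSeries.single_mul_single]
      by_cases hn : n = ((i.2 - m : ℕ) : ℤ) <;> simp [hb, hn]
    · simp [hb]
  rcases lt_or_ge n 0 with hn | hn
  · rw [coeff_expLin_of_neg _ _ hn, map_zero]
    refine (Finset.sum_eq_zero fun i _ => ?_).symm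
    rw [hterm, if_neg (by omega)]
  · obtain ⟨r, rfl⟩ := Int.eq_ofNat_of_zero_le hn
    refine (congrArg p (coeff_expLin_natCast _ _ r)).trans ?_
    rw [divPow_negLoopDerivation_pole, map_smul, hp (b, m + r)]
    rw [Finset.sum_congr rfl fun i _ => hterm i, Finset.sum_eq_single (b, m + r)]
    · rw [if_pos ⟨rfl, by simp⟩, smul_eq_mul, Nat.add_sub_cancel_left, Nat.choose_symm_add]
      ring
    · rintro ⟨b', k⟩ _ hne
      split_ifs with h
      · obtain ⟨rfl, h⟩ := h
        have hk : k < m := by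
          by_contra hk
          refine hne ?_
          have h' : r = k - m := by exact_mod_cast h
          rw [h', Nat.add_sub_cancel' (not_lt.1 hk)]
        simp [Nat.choose_eq_zero_of_lt hk]
      · rfl
    · intro h
      rw [Finsupp.notMem_support_iff.1 h]
      simp

/-- Coefficientwise extensions of symbols give symbols of field systems with values in Hahn series
when the `φⱼ(t^{-m-1} ⊗ b)` have coefficients in `L`. -/
theorem isFieldSystem_of_mapCoeff {Γ V k : Type*} [AddCommGroup Γ] [LinearOrder Γ]
    [IsOrderedAddMonoid Γ] [Ring V] [Algebra ℂ V] [Field k] [Algebra ℂ k] {M : Type*}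
    [AddCommGroup M] [Module ℂ M] {κ : k →ₐ[ℂ] V} {j : M →ₗ[ℂ] V}
    {n : ℕ} {ξ : Fin n → HahnSeries Γ k} {φ : Fin n → UNegLoop 𝔤 →ₐ[ℂ] HahnSeries Γ V}
    (a : Fin n → negLoop 𝔤 → HahnSeries Γ M)
    (ha : ∀ i x, mapCoeff Γ j (a i x) = φ i (ιLin _ x))
    (h : ∀ (q : B × ℕ →₀ ℂ) (m : ℕ), ∃ (p : M →ₗ[ℂ] k) (s : V →ₗ[ℂ] k),
      (∀ f v, s (κ f * v) = f * s v) ∧ IsSymbol j p s m ∧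
      ∀ (i : Fin n) b r, mapCoeff Γ p (a i (pole r (β b))) = taylorValue q (ξ i) b r) :
    IsFieldSystem β (mapAlgHom Γ κ) ξ φ := by
  intro q m
  obtain ⟨p, s, hs, hsym, hp⟩ := h q m
  refine ⟨(mapCoeff Γ s).toAddMonoidHom, fun f v => ?_, fun l => ?_⟩
  · ext e
    change s _ = _
    rw [coeff_mul_of_subset f.isPWO_support v.isPWO_support (fun a ha h => ha (by simp [h]))
      subset_rfl, coeff_mul_of_subset f.isPWO_support v.isPWO_support subset_rfl
      (fun a ha h => ha (by simp [h])), map_sum]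
    exact Finset.sum_congr rfl fun i _ => hs _ _
  · have h1 := hsym.mapCoeff (Γ := Γ) (l.map fun i => a i.1 (pole i.2.2 (β i.2.1)))
    simp only [List.length_map, List.map_map, Function.comp_def, ha, hp] at h1
    exact h1

/-- The identity of `U(𝔤 ⊗ t⁻¹ℂ[t⁻¹])` is a field system at `ξ = 0`; this is the case that yields
the independence of the monomials. -/
theorem isFieldSystem_id (κ : ℂ →ₐ[ℂ] UNegLoop 𝔤) :
    IsFieldSystem β κ (fun _ : Fin 1 => (0 : ℂ)) fun _ => AlgHom.id ℂ _ := by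
  intro q m
  obtain ⟨p, s, hs, hp⟩ := exists_isSymbol_pole β q m
  refine ⟨s.toAddMonoidHom, fun f v => ?_, fun l => ?_⟩
  · rw [show κ f = algebraMap ℂ _ f from κ.commutes f, ← Algebra.smul_def]
    exact map_smul s f v
  · have h1 := hs (l.map fun i => pole i.2.2 (β i.2.1))
    simp only [sum_taylorForm, taylorValue_zero]
    simp only [List.length_map, List.map_map, Function.comp_def, hp] at h1
    exact h1

end Systems

/-! ### Injectivity of products of fields -/

section Injectivity

variable {𝔤 : Type*} [LieRing 𝔤] [LieAlgebra ℂ 𝔤] {B : Type*} [DecidableEq B]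
variable {β : Module.Basis B ℂ 𝔤}

/-- The Poincaré–Birkhoff–Witt basis of `U(𝔤 ⊗ t⁻¹ℂ[t⁻¹])`. -/
def pbwBasis (β : Module.Basis B ℂ 𝔤) : Module.Basis (B × ℕ →₀ ℕ) ℂ (UNegLoop 𝔤) :=
  Module.Basis.mk (v := negMonomial β)
    (linearIndependent_iff.2 fun c hc => by
      have h := (isFieldSystem_id β (Algebra.ofId ℂ _)).eq_zero_of_sum_eq_zero
        (Function.injective_of_subsingleton _) (List.Perm.refl (List.finRange 1))
        (c.mapDomain fun α _ => α) (by
          rw [Finsupp.sum_mapDomain_index (by simp) (by simp [add_mul])]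
          simpa [Finsupp.linearCombination_apply, Algebra.ofId_apply, ← Algebra.smul_def]
            using hc)
      refine Finsupp.mapDomain_injective (fun α α' h => congrFun h 0) (h.trans ?_)
      simp)
    (span_monomialU _ (span_pole β)).ge

theorem pbwBasis_apply (β : Module.Basis B ℂ 𝔤) (α : B × ℕ →₀ ℕ) :
    pbwBasis β α = negMonomial β α := by simp [pbwBasis]

theorem IsFieldSystem.mulMap_injective {K A : Type*} [Field K] [Algebra ℂ K] [Ring A]
    [Algebra ℂ A] {W : Type*} [AddCommGroup W] [Module ℂ W] {κ : K →ₐ[ℂ] A} {n : ℕ}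
    {ξ : Fin n → K} {φ : Fin n → UNegLoop 𝔤 →ₐ[ℂ] A} (h : IsFieldSystem β κ ξ φ)
    (hξ : Function.Injective ξ) {σ : List (Fin n)} (hσ : σ.Perm (List.finRange n))
    (E : W →ₗ[ℂ] A) {X : Type*} (b : Module.Basis X ℂ W) (e : X → Fin n → (B × ℕ →₀ ℕ))
    (he : Function.Injective e)
    (hE : ∀ x, E (b x) = (σ.map fun j => φ j (pbwBasis β (e x j))).prod) :
    Function.Injective (mulMap κ E) := by
  refine QuantumVA.mulMap_injective κ E b fun c hc => ?_
  have h1 := h.eq_zero_of_sum_eq_zero hξ hσ (c.mapDomain e) (by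
    rw [Finsupp.sum_mapDomain_index (by simp) (by simp [add_mul]), ← hc]
    refine Finsupp.sum_congr fun x _ => ?_
    simp only [hE, pbwBasis_apply])
  exact Finsupp.mapDomain_injective he (h1.trans (by simp))

end Injectivity

section LaurentInjectivity

variable {𝔤 : Type*} [LieRing 𝔤] [LieAlgebra ℂ 𝔤]

/-- The embedding of `ℂ((x))` into `A((x))`. -/
abbrev scalars (A : Type*) [Ring A] [Algebra ℂ A] : Laurent ℂ →ₐ[ℂ] Laurent A :=
  mapAlgHom ℤ (Algebra.ofId ℂ A)

/-- The embedding of `A` into `A((x))`. -/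
abbrev const (A : Type*) [Ring A] [Algebra ℂ A] : A →ₐ[ℂ] Laurent A := constAlgHom ℤ ℂ A

section Products

variable {A R : Type*} [Ring A] [Algebra ℂ A] [Ring R] [Algebra ℂ R]

/-- The map `a ⊗ b ↦ f(a) g(b)`. -/
def mulPair (f g : A →ₐ[ℂ] R) : A ⊗[ℂ] A →ₗ[ℂ] R :=
  LinearMap.mul' ℂ R ∘ₗ TensorProduct.map f.toLinearMap g.toLinearMap

/-- The map `a ⊗ b ↦ g(b) f(a)`. -/
def mulPairOp (f g : A →ₐ[ℂ] R) : A ⊗[ℂ] A →ₗ[ℂ] R :=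
  mulPair g f ∘ₗ (TensorProduct.comm ℂ A A).toLinearMap

@[simp]
theorem mulPair_tmul (f g : A →ₐ[ℂ] R) (a b : A) : mulPair f g (a ⊗ₜ b) = f a * g b := rfl

@[simp]
theorem mulPairOp_tmul (f g : A →ₐ[ℂ] R) (a b : A) : mulPairOp f g (a ⊗ₜ b) = g b * f a := rfl

/-- The map `a ⊗ b ⊗ c ↦ f(a) g(b) h(c)`. -/
def mulTriple (f g h : A →ₐ[ℂ] R) : (A ⊗[ℂ] A) ⊗[ℂ] A →ₗ[ℂ] R :=
  LinearMap.mul' ℂ R ∘ₗ TensorProduct.map (mulPair f g) h.toLinearMap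

@[simp]
theorem mulTriple_tmul (f g h : A →ₐ[ℂ] R) (a b c : A) :
    mulTriple f g h ((a ⊗ₜ b) ⊗ₜ c) = f a * g b * h c := rfl

end Products

theorem isFieldSystem_laurent {B : Type*} [DecidableEq B] (β : Module.Basis B ℂ 𝔤) :
    IsFieldSystem β (scalars (UNegLoop 𝔤)) ![varX, 0] ![field 𝔤, const _] := by
  refine isFieldSystem_of_mapCoeff β (j := ιLin _)
    ![fun x => expLin (dL 𝔤) x, fun x => HahnSeries.single 0 x] ?_ fun q m => ?_
  · intro i x
    fin_cases i
    · exact mapCoeff_expLin _ ιLin_negLoopDerivation x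
    · exact mapCoeff_single _ _ _
  · obtain ⟨p, s, hs, hp⟩ := exists_isSymbol_pole β q m
    refine ⟨p, s, fun f v => ?_, hs, fun i b r => ?_⟩
    · rw [show Algebra.ofId ℂ _ f = algebraMap ℂ _ f from rfl, ← Algebra.smul_def]
      exact map_smul s f v
    · fin_cases i
      · exact mapCoeff_expLin_pole β hp b r
      · refine (mapCoeff_single p _ _).trans ?_
        change _ = taylorValue q 0 b r
        rw [taylorValue_zero, hp (b, r)]
        rfl

theorem varX_ne_zero : varX ≠ 0 := HahnSeries.single_ne_zero one_ne_zero

theorem injective_pair {K : Type*} [Zero K] {a : K} (ha : a ≠ 0) :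
    Function.Injective ![a, 0] := by
  intro i j h
  fin_cases i <;> fin_cases j <;> simp_all

/-- `v ⊗ u ⊗ f ↦ f(x) (e^{xd} v) u` is injective. -/
theorem mulMap_mulPair_injective :
    Function.Injective (mulMap (scalars _) (mulPair (field 𝔤) (const _))) := by
  classical
  let β := Module.Basis.ofVectorSpace ℂ 𝔤
  refine (isFieldSystem_laurent β).mulMap_injective (injective_pair varX_ne_zero)
    (List.Perm.refl _) _ ((pbwBasis β).tensorProduct (pbwBasis β)) (fun x => ![x.1, x.2])
    (fun x y h => Prod.ext (congrFun h 0) (congrFun h 1)) fun x => ?_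
  simp [Module.Basis.tensorProduct_apply', List.finRange_succ]

/-- `v ⊗ u ⊗ f ↦ f(x) u (e^{xd} v)` is injective. -/
theorem mulMap_mulPairOp_injective :
    Function.Injective (mulMap (scalars _) (mulPairOp (field 𝔤) (const _))) := by
  classical
  let β := Module.Basis.ofVectorSpace ℂ 𝔤
  refine (isFieldSystem_laurent β).mulMap_injective (injective_pair varX_ne_zero)
    (σ := [1, 0]) (List.Perm.swap _ _ _) _ ((pbwBasis β).tensorProduct (pbwBasis β))
    (fun x => ![x.1, x.2])
    (fun x y h => Prod.ext (congrFun h 0) (congrFun h 1)) fun x => ?_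
  simp [Module.Basis.tensorProduct_apply']

/-- The embedding of `ℂ((x))((z))` into `A((x))((z))`. -/
abbrev scalars₂ (A : Type*) [Ring A] [Algebra ℂ A] :
    Laurent (Laurent ℂ) →ₐ[ℂ] Laurent (Laurent A) :=
  mapAlgHom ℤ (scalars A)

/-- The substitution `g(x) ↦ g(x + z)`, expanded in nonnegative powers of `z`, on `A((x))`. -/
abbrev shift (A : Type*) [Ring A] [Algebra ℂ A] : Laurent A →ₐ[ℂ] Laurent (Laurent A) :=
  expHom (LaurentSeries.derivative ℂ) isDeriv_derivative

/-- The substitution `g(x) ↦ g(z)`. -/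
abbrev atZ (A : Type*) [Ring A] [Algebra ℂ A] : Laurent A →ₐ[ℂ] Laurent (Laurent A) :=
  mapAlgHom ℤ (const A)

theorem isFieldSystem_laurent₂ {B : Type*} [DecidableEq B] (β : Module.Basis B ℂ 𝔤) :
    IsFieldSystem β (scalars₂ (UNegLoop 𝔤)) ![shift ℂ varX, atZ ℂ varX, 0]
      ![(shift _).comp (field 𝔤), (atZ _).comp (field 𝔤), (const _).comp (const _)] := by
  have hd : ∀ x, expLin (dL 𝔤) (dL 𝔤 x) = LaurentSeries.derivative ℂ (expLin (dL 𝔤) x) :=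
    expLin_apply_self _
  refine isFieldSystem_of_mapCoeff β (j := mapCoeff ℤ (ιLin _))
    ![fun x => mapCoeff ℤ (expLin (dL 𝔤)) (expLin (dL 𝔤) x),
      fun x => mapCoeff ℤ (HahnSeries.single.linearMap 0) (expLin (dL 𝔤) x),
      fun x => HahnSeries.single 0 (HahnSeries.single 0 x)] ?_ fun q m => ?_
  · intro i x
    fin_cases i
    · change mapCoeff ℤ (mapCoeff ℤ (ιLin _)) (mapCoeff ℤ (expLin (dL 𝔤)) (expLin (dL 𝔤) x)) =
        expLin _ (expLin _ _)
      rw [mapCoeff_expLin _ hd,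
        mapCoeff_expLin (mapCoeff ℤ (ιLin _)) (D' := LaurentSeries.derivative ℂ),
        mapCoeff_expLin _ ιLin_negLoopDerivation]
      intro a
      ext n
      simp
    · change mapCoeff ℤ (mapCoeff ℤ (ιLin _)) (mapCoeff ℤ (HahnSeries.single.linearMap 0)
        (expLin (dL 𝔤) x)) = atZ _ (expLin (dU 𝔤) (ιLin _ x))
      rw [← mapCoeff_expLin _ ιLin_negLoopDerivation]
      ext1
      funext n
      exact mapCoeff_single (ιLin _) _ _
    · refine (mapCoeff_single (mapCoeff ℤ (ιLin _)) _ _).trans ?_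
      exact congrArg (HahnSeries.single 0) (mapCoeff_single (ιLin _) _ _)
  · obtain ⟨p, s, hs, hp⟩ := exists_isSymbol_pole β q m
    refine ⟨mapCoeff ℤ p, mapCoeff ℤ s, fun f v => ?_, hs.mapCoeff, fun i b r => ?_⟩
    · ext e
      change s _ = _
      rw [coeff_mul_of_subset f.isPWO_support v.isPWO_support (fun a ha h => ha (by simp [h]))
        subset_rfl, coeff_mul_of_subset f.isPWO_support v.isPWO_support subset_rfl
        (fun a ha h => ha (by simp [h])), map_sum]
      refine Finset.sum_congr rfl fun i _ => ?_
      rw [coeff_mapAlgHom, show Algebra.ofId ℂ _ (f.coeff i.1) = algebraMap ℂ _ _ from rfl,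
        ← Algebra.smul_def]
      exact map_smul s _ _
    · fin_cases i
      · change mapCoeff ℤ (mapCoeff ℤ p) (mapCoeff ℤ (expLin (dL 𝔤)) (expLin (dL 𝔤) _)) =
          taylorValue q (shift ℂ varX) b r
        rw [mapCoeff_expLin _ hd, mapCoeff_expLin (mapCoeff ℤ p) (D' := LaurentSeries.derivative ℂ),
          mapCoeff_expLin_pole β hp, ← map_taylorValue]
        · rfl
        · intro a
          ext n
          simp
      · change mapCoeff ℤ (mapCoeff ℤ p) (mapCoeff ℤ (HahnSeries.single.linearMap 0)
          (expLin (dL 𝔤) _)) = taylorValue q (atZ ℂ varX) b r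
        rw [← map_taylorValue, ← mapCoeff_expLin_pole β hp]
        ext1
        funext n
        exact mapCoeff_single p _ _
      · refine (mapCoeff_single (mapCoeff ℤ p) _ _).trans ?_
        change _ = taylorValue q 0 b r
        rw [taylorValue_zero, ← hp (b, r)]
        exact congrArg (HahnSeries.single 0) (mapCoeff_single p _ _)

theorem coeff_shift_zero {A : Type*} [Ring A] [Algebra ℂ A] (g : Laurent A) :
    (shift A g).coeff 0 = g :=
  (coeff_expLin_natCast _ g 0).trans (divPow_zero _ _)

/-- The elements `x + z`, `z` and `0` of `ℂ((x))((z))` are distinct. -/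
theorem injective_triple :
    Function.Injective (![shift ℂ varX, atZ ℂ varX, 0] : Fin 3 → Laurent (Laurent ℂ)) := by
  have h1 : shift ℂ varX ≠ 0 := fun h => varX_ne_zero (by rw [← coeff_shift_zero varX, h]; rfl)
  have h2 : atZ ℂ varX ≠ 0 := by
    rw [atZ, mapAlgHom_single, map_one]
    exact HahnSeries.single_ne_zero one_ne_zero
  have h3 : shift ℂ varX ≠ atZ ℂ varX := fun h => varX_ne_zero (by
    rw [← coeff_shift_zero varX, h, atZ, mapAlgHom_single]
    exact HahnSeries.coeff_single_of_ne (by simp))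
  intro i j h
  fin_cases i <;> fin_cases j <;> simp_all [eq_comm]

/-- `u ⊗ v ⊗ w ⊗ f ↦ f (e^{(x + z)d} u) (e^{zd} v) w` is injective. -/
theorem mulMap_mulTriple_injective :
    Function.Injective (mulMap (K := Laurent (Laurent ℂ)) (scalars₂ _)
      (mulTriple ((shift _).comp (field 𝔤))
      ((atZ _).comp (field 𝔤)) ((const _).comp (const _)))) := by
  classical
  let β := Module.Basis.ofVectorSpace ℂ 𝔤
  refine (isFieldSystem_laurent₂ β).mulMap_injective injective_triple
    (List.Perm.refl _) _ (((pbwBasis β).tensorProduct (pbwBasis β)).tensorProduct (pbwBasis β))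
    (fun x => ![x.1.1, x.1.2, x.2])
    (fun x y h => Prod.ext (Prod.ext (congrFun h 0) (congrFun h 1)) (congrFun h 2)) fun x => ?_
  simp [Module.Basis.tensorProduct_apply', List.finRange_succ, mul_assoc]

end LaurentInjectivity

/-! ### Nondegeneracy -/

section Embedding

variable {Γ Γ₁ Γ₂ : Type*} [AddCommGroup Γ] [LinearOrder Γ] [IsOrderedAddMonoid Γ]
variable [AddCommGroup Γ₁] [LinearOrder Γ₁] [IsOrderedAddMonoid Γ₁]
variable [AddCommGroup Γ₂] [LinearOrder Γ₂] [IsOrderedAddMonoid Γ₂]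
variable {A : Type*} [Ring A] [Algebra ℂ A]

/-- The embedding of Hahn series induced by an embedding of ordered groups of exponents. -/
def embAlgHom (A : Type*) [Ring A] [Algebra ℂ A] (f : Γ₁ →+ Γ) (hf : StrictMono f) :
    HahnSeries Γ₁ A →ₐ[ℂ] HahnSeries Γ A :=
  HahnSeries.embDomainAlgHom f hf.injective fun _ _ => hf.le_iff_le

theorem embAlgHom_apply (f : Γ₁ →+ Γ) (hf : StrictMono f) (x : HahnSeries Γ₁ A) :
    embAlgHom A f hf x = HahnSeries.embDomain (OrderEmbedding.ofStrictMono f hf) x := rfl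

theorem coeff_embAlgHom (f : Γ₁ →+ Γ) (hf : StrictMono f) (x : HahnSeries Γ₁ A) (a : Γ₁) :
    (embAlgHom A f hf x).coeff (f a) = x.coeff a :=
  HahnSeries.embDomain_coeff (f := OrderEmbedding.ofStrictMono f hf)

/-- Coefficients of a product of series in two independent sets of variables. -/
theorem coeff_embAlgHom_mul (f : Γ₁ →+ Γ) (hf : StrictMono f) (g : Γ₂ →+ Γ) (hg : StrictMono g)
    (hfg : ∀ a b a' b', f a + g b = f a' + g b' → a = a' ∧ b = b') (x : HahnSeries Γ₁ A)
    (y : HahnSeries Γ₂ A) (a : Γ₁) (b : Γ₂) :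
    (embAlgHom A f hf x * embAlgHom A g hg y).coeff (f a + g b) = x.coeff a * y.coeff b := by
  have hx : (embAlgHom A f hf x).support ⊆ f '' x.support := HahnSeries.support_embDomain_subset
  have hy : (embAlgHom A g hg y).support ⊆ g '' y.support := HahnSeries.support_embDomain_subset
  have key : ∀ i : Γ × Γ, i.1 ∈ (embAlgHom A f hf x).support →
      i.2 ∈ (embAlgHom A g hg y).support → i.1 + i.2 = f a + g b → i = (f a, g b) := by
    rintro ⟨i, j⟩ hi hj h
    obtain ⟨a', _, rfl⟩ := hx hi
    obtain ⟨b', _, rfl⟩ := hy hj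
    obtain ⟨rfl, rfl⟩ := hfg _ _ _ _ h
    rfl
  rw [HahnSeries.coeff_mul, Finset.sum_eq_single (f a, g b)]
  · simp only
    rw [coeff_embAlgHom, coeff_embAlgHom]
  · intro i hi hne
    obtain ⟨h1, h2, h3⟩ := Finset.mem_antidiagonal.1 hi
    exact absurd (key i h1 h2 h3) hne
  · intro hi
    by_contra hne
    exact hi (Finset.mem_antidiagonal.2
      ⟨left_ne_zero_of_mul hne, right_ne_zero_of_mul hne, rfl⟩)

theorem embAlgHom_comp (f : Γ₁ →+ Γ) (hf : StrictMono f) (g : Γ₂ →+ Γ₁) (hg : StrictMono g)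
    (h : Γ₂ →+ Γ) (hh : StrictMono h) (hfg : ∀ a, f (g a) = h a) (x : HahnSeries Γ₂ A) :
    embAlgHom A f hf (embAlgHom A g hg x) = embAlgHom A h hh x := by
  ext e
  by_cases he : e ∈ Set.range h
  · obtain ⟨a, rfl⟩ := he
    rw [coeff_embAlgHom, ← hfg, coeff_embAlgHom, coeff_embAlgHom]
  · rw [embAlgHom_apply h, HahnSeries.embDomain_of_notMem_range he]
    by_cases he' : e ∈ Set.range f
    · obtain ⟨a, rfl⟩ := he'
      rw [coeff_embAlgHom, embAlgHom_apply, HahnSeries.embDomain_of_notMem_range]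
      rintro ⟨b, rfl⟩
      exact he ⟨b, (hfg b).symm⟩
    · rw [embAlgHom_apply f, HahnSeries.embDomain_of_notMem_range he']

theorem mapCoeff_embDomain {Γ Γ₁ : Type*} [PartialOrder Γ] [PartialOrder Γ₁] {M N : Type*}
    [AddCommGroup M] [Module ℂ M] [AddCommGroup N]
    [Module ℂ N] (p : M →ₗ[ℂ] N) (f : Γ₁ ↪o Γ) (x : HahnSeries Γ₁ M) :
    mapCoeff Γ p (HahnSeries.embDomain f x) = HahnSeries.embDomain f (mapCoeff Γ₁ p x) := by
  ext e
  rw [coeff_mapCoeff]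
  by_cases he : e ∈ Set.range f
  · obtain ⟨a, rfl⟩ := he
    rw [HahnSeries.embDomain_coeff, HahnSeries.embDomain_coeff, coeff_mapCoeff]
  · rw [HahnSeries.embDomain_of_notMem_range he, HahnSeries.embDomain_of_notMem_range he, map_zero]

end Embedding

section Nondegeneracy

/-- The inclusion of the exponents of the `j`-th variable. -/
def axis {n : ℕ} (j : Fin n) : ℤ →+ Exponent n where
  toFun k := toLex (Pi.single (OrderDual.toDual j) k)
  map_zero' := by simp
  map_add' a b := by rw [Pi.single_add]; rfl

theorem strictMono_axis {n : ℕ} (j : Fin n) : StrictMono (axis j) := fun _ _ h =>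
  Pi.toLex_strictMono (Pi.single_strictMono _ h)

/-- The inclusion of the exponents of all variables but the first one. -/
def tailExponent (n : ℕ) : Exponent n →+ Exponent (n + 1) where
  toFun e := toLex fun j =>
    Fin.cons (α := fun _ => ℤ) 0 (fun i => ofLex e (OrderDual.toDual i)) (OrderDual.ofDual j)
  map_zero' := by
    refine ofLex_inj.1 (funext fun j => ?_)
    induction j using OrderDual.rec with | _ j =>
    induction j using Fin.cases <;> rfl
  map_add' a b := by
    refine ofLex_inj.1 (funext fun j => ?_)
    induction j using OrderDual.rec with | _ j =>
    induction j using Fin.cases <;> rfl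

theorem ofLex_tailExponent_zero {n : ℕ} (e : Exponent n) :
    ofLex (tailExponent n e) (OrderDual.toDual 0) = 0 := rfl

theorem ofLex_tailExponent_succ {n : ℕ} (e : Exponent n) (i : Fin n) :
    ofLex (tailExponent n e) (OrderDual.toDual i.succ) = ofLex e (OrderDual.toDual i) := rfl

theorem strictMono_tailExponent (n : ℕ) : StrictMono (tailExponent n) := by
  rintro a b ⟨i, hi, hlt⟩
  refine ⟨OrderDual.toDual (OrderDual.ofDual i).succ, fun j hj => ?_, hlt⟩
  induction j using OrderDual.rec with | _ j =>
  induction j using Fin.cases with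
  | zero => rfl
  | succ j => exact hi (OrderDual.toDual j) (Fin.succ_lt_succ_iff.1 hj)

theorem ofLex_axis_zero_succ {n : ℕ} (k : ℤ) (i : Fin n) :
    ofLex (axis (0 : Fin (n + 1)) k) (OrderDual.toDual i.succ) = 0 :=
  Pi.single_eq_of_ne (M := fun _ : (Fin (n + 1))ᵒᵈ => ℤ) (i := OrderDual.toDual (0 : Fin (n + 1)))
    (i' := OrderDual.toDual i.succ) (fun h => Fin.succ_ne_zero i (OrderDual.toDual_inj.1 h)) k

theorem ofLex_axis_self {n : ℕ} (k : ℤ) (j : Fin n) :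
    ofLex (axis j k) (OrderDual.toDual j) = k :=
  Pi.single_eq_same (M := fun _ : (Fin n)ᵒᵈ => ℤ) _ k

theorem tailExponent_axis {n : ℕ} (j : Fin n) (k : ℤ) :
    tailExponent n (axis j k) = axis j.succ k := by
  refine ofLex_inj.1 (funext fun i => ?_)
  induction i using OrderDual.rec with | _ i =>
  induction i using Fin.cases with
  | zero =>
    rw [ofLex_tailExponent_zero]
    exact (Pi.single_eq_of_ne (M := fun _ : (Fin (n + 1))ᵒᵈ => ℤ)
      (i := OrderDual.toDual j.succ) (i' := OrderDual.toDual (0 : Fin (n + 1)))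
      (fun h => Fin.succ_ne_zero j (OrderDual.toDual_inj.1 h).symm) k).symm
  | succ i =>
    rw [ofLex_tailExponent_succ]
    by_cases h : i = j
    · subst h
      rw [ofLex_axis_self, ofLex_axis_self]
    · exact (Pi.single_eq_of_ne (M := fun _ : (Fin n)ᵒᵈ => ℤ) (i := OrderDual.toDual j)
        (i' := OrderDual.toDual i) (fun h' => h (OrderDual.toDual_inj.1 h')) k).trans
        (Pi.single_eq_of_ne (M := fun _ : (Fin (n + 1))ᵒᵈ => ℤ) (i := OrderDual.toDual j.succ)
        (i' := OrderDual.toDual i.succ)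
        (fun h' => h (Fin.succ_injective _ (OrderDual.toDual_inj.1 h'))) k).symm

theorem ofLex_add_apply {n : ℕ} (a b : Exponent n) (i : (Fin n)ᵒᵈ) :
    ofLex (a + b) i = ofLex a i + ofLex b i := rfl

theorem axis_zero_add_tailExponent_injective {n : ℕ} (a : ℤ) (b : Exponent n) (a' : ℤ)
    (b' : Exponent n) (h : axis 0 a + tailExponent n b = axis 0 a' + tailExponent n b') :
    a = a' ∧ b = b' := by
  constructor
  · have h1 := congrFun (congrArg ofLex h) (OrderDual.toDual 0)
    rwa [ofLex_add_apply, ofLex_add_apply, ofLex_axis_self, ofLex_axis_self,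
      ofLex_tailExponent_zero, ofLex_tailExponent_zero, add_zero, add_zero] at h1
  · refine ofLex_inj.1 (funext fun i => ?_)
    have h1 := congrFun (congrArg ofLex h) (OrderDual.toDual (OrderDual.ofDual i).succ)
    rwa [ofLex_add_apply, ofLex_add_apply, ofLex_axis_zero_succ, ofLex_axis_zero_succ,
      ofLex_tailExponent_succ, ofLex_tailExponent_succ, zero_add, zero_add] at h1

theorem axis_add_tailExponent {n : ℕ} (e : Exponent (n + 1)) :
    axis 0 (ofLex e (OrderDual.toDual 0)) +
      tailExponent n (toLex fun i => ofLex e (OrderDual.toDual (OrderDual.ofDual i).succ)) = e := by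
  refine ofLex_inj.1 (funext fun i => ?_)
  induction i using OrderDual.rec with | _ i =>
  induction i using Fin.cases with
  | zero => rw [ofLex_add_apply, ofLex_axis_self, ofLex_tailExponent_zero, add_zero]
  | succ i =>
    rw [ofLex_add_apply, ofLex_axis_zero_succ, ofLex_tailExponent_succ, zero_add]
    rfl

variable (𝔤 : Type*) [LieRing 𝔤] [LieAlgebra ℂ 𝔤]

theorem vertexOperator_apply (a b : UNegLoop 𝔤) :
    vertexOperator 𝔤 a b = field 𝔤 a * HahnSeries.C b := by
  rw [expHom_apply, expLin_eq_ofPowerSeries, ← HahnSeries.ofPowerSeries_C, ← map_mul]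
  rfl

theorem coeff_vertexOperator (a b : UNegLoop 𝔤) (k : ℤ) :
    (vertexOperator 𝔤 a b).coeff k = (field 𝔤 a).coeff k * b := by
  rw [vertexOperator_apply, HahnSeries.C_apply, HahnSeries.coeff_mul_single_zero]

/-- The homomorphism `u ↦ e^{xⱼ d} u`. -/
abbrev fieldAt {n : ℕ} (j : Fin n) : UNegLoop 𝔤 →ₐ[ℂ] HahnSeries (Exponent n) (UNegLoop 𝔤) :=
  (embAlgHom _ (axis j) (strictMono_axis j)).comp (field 𝔤)

/-- `Y(u₁, x₁) ⋯ Y(uₙ, xₙ) 𝟏 = (e^{x₁ d} u₁) ⋯ (e^{xₙ d} uₙ)`. -/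
theorem productSeries_eq_prod {n : ℕ} (u : Fin n → UNegLoop 𝔤) :
    productSeries (vertexOperator 𝔤) 1 n u = (List.ofFn fun j => fieldAt 𝔤 j (u j)).prod := by
  induction n with
  | zero =>
    ext e
    obtain rfl : e = 0 := ofLex_inj.1 (funext fun i => (OrderDual.ofDual i).elim0)
    simp [productSeries, productCoeff]
  | succ n ih =>
    have h : (List.ofFn fun j => fieldAt 𝔤 (Fin.succ j) (u j.succ)).prod =
        embAlgHom _ (tailExponent n) (strictMono_tailExponent n)
          (productSeries (vertexOperator 𝔤) 1 n (Fin.tail u)) := by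
      rw [ih, map_list_prod, List.map_ofFn]
      congr 2
      funext j
      exact (embAlgHom_comp _ _ _ (strictMono_axis j) _ (strictMono_axis _)
        (tailExponent_axis j) _).symm
    rw [List.ofFn_succ, List.prod_cons, h]
    ext e
    nth_rw 2 [← axis_add_tailExponent e]
    refine Eq.trans ?_ (coeff_embAlgHom_mul _ (strictMono_axis 0) _ _
      axis_zero_add_tailExponent_injective _ _ _ _).symm
    exact coeff_vertexOperator _ _ _ _

theorem isFieldSystem_fieldAt {B : Type*} [DecidableEq B] (β : Module.Basis B ℂ 𝔤) (n : ℕ) :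
    IsFieldSystem β (mapAlgHom (Exponent n) (Algebra.ofId ℂ (UNegLoop 𝔤)))
      (fun j => embAlgHom ℂ (axis j) (strictMono_axis j) varX) (fieldAt 𝔤) := by
  refine isFieldSystem_of_mapCoeff β (j := ιLin _)
    (fun i x => HahnSeries.embDomain (OrderEmbedding.ofStrictMono _ (strictMono_axis i))
      (expLin (dL 𝔤) x)) (fun i x => ?_) fun q m => ?_
  · rw [mapCoeff_embDomain, mapCoeff_expLin _ ιLin_negLoopDerivation]
    rfl
  · obtain ⟨p, s, hs, hp⟩ := exists_isSymbol_pole β q m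
    refine ⟨p, s, fun f v => ?_, hs, fun i b r => ?_⟩
    · rw [show Algebra.ofId ℂ _ f = algebraMap ℂ _ f from rfl, ← Algebra.smul_def]
      exact map_smul s f v
    · rw [mapCoeff_embDomain, mapCoeff_expLin_pole β hp, ← map_taylorValue]
      rfl

theorem injective_variables (n : ℕ) :
    Function.Injective fun j : Fin n => embAlgHom ℂ (axis j) (strictMono_axis j) varX := by
  intro i j h
  have h1 : (HahnSeries.single (axis i 1) (1 : ℂ)) = HahnSeries.single (axis j 1) 1 := by
    have h2 : ∀ i : Fin n, embAlgHom ℂ (axis i) (strictMono_axis i) varX =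
        HahnSeries.single (axis i 1) (1 : ℂ) := fun i => HahnSeries.embDomain_single
    rw [← h2, ← h2]
    exact h
  have h3 : axis i 1 = axis j 1 := by
    by_contra hne
    have h4 := congrArg (fun z => z.coeff (axis i 1)) h1
    simp [HahnSeries.coeff_single_of_ne hne] at h4
  by_contra hne
  have h5 := congrFun (congrArg ofLex h3) (OrderDual.toDual i)
  rw [ofLex_axis_self] at h5
  exact one_ne_zero (h5.trans (Pi.single_eq_of_ne (M := fun _ : (Fin n)ᵒᵈ => ℤ)
    (i := OrderDual.toDual j) (i' := OrderDual.toDual i)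
    (fun h' => hne (OrderDual.toDual_inj.1 h')) 1))

/-- The map `u₁ ⊗ ⋯ ⊗ uₙ ↦ (e^{x₁ d} u₁) ⋯ (e^{xₙ d} uₙ)`. -/
def fieldProduct (n : ℕ) :
    (⨂[ℂ] _ : Fin n, UNegLoop 𝔤) →ₗ[ℂ] HahnSeries (Exponent n) (UNegLoop 𝔤) :=
  PiTensorProduct.lift ((MultilinearMap.mkPiAlgebraFin ℂ n _).compLinearMap
    fun j => (fieldAt 𝔤 j).toLinearMap)

theorem fieldProduct_tprod (n : ℕ) (u : Fin n → UNegLoop 𝔤) :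
    fieldProduct 𝔤 n (PiTensorProduct.tprod ℂ u) =
      (List.ofFn fun j => fieldAt 𝔤 j (u j)).prod := by
  rw [fieldProduct, PiTensorProduct.lift.tprod, MultilinearMap.compLinearMap_apply,
    MultilinearMap.mkPiAlgebraFin_apply]
  rfl

theorem mulMap_fieldProduct_injective (n : ℕ) : Function.Injective
    (mulMap (K := IterLaurent n) (mapAlgHom (Exponent n) (Algebra.ofId ℂ (UNegLoop 𝔤)))
      (fieldProduct 𝔤 n)) := by
  classical
  let β := Module.Basis.ofVectorSpace ℂ 𝔤
  refine (isFieldSystem_fieldAt 𝔤 β n).mulMap_injective (injective_variables n)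
    (List.Perm.refl _) _ (Basis.piTensorProduct fun _ => pbwBasis β) id
    Function.injective_id fun x => ?_
  rw [Basis.piTensorProduct_apply, fieldProduct_tprod, List.ofFn_eq_map]
  rfl

/-- `Zₙ(u₁ ⊗ ⋯ ⊗ uₙ ⊗ f) = f (e^{x₁ d} u₁) ⋯ (e^{xₙ d} uₙ)`. -/
theorem Z_eq (n : ℕ) (z : (⨂[ℂ] _ : Fin n, UNegLoop 𝔤) ⊗[ℂ] IterLaurent n) :
    (HahnModule.of ℂ).symm (Z (vertexOperator 𝔤) 1 n z) =
      mulMap (mapAlgHom (Exponent n) (Algebra.ofId ℂ (UNegLoop 𝔤))) (fieldProduct 𝔤 n) z := by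
  induction z with
  | zero => simp
  | add x y hx hy => rw [LinearMap.map_add, LinearMap.map_add, HahnModule.of_symm_add, hx, hy]
  | tmul T f =>
    rw [mulMap_tmul]
    change (HahnModule.of ℂ).symm
      (f • PiTensorProduct.lift (productMap (vertexOperator 𝔤) 1 n) T) = _
    induction T using PiTensorProduct.induction_on with
    | smul_tprod r u =>
      rw [LinearMap.map_smul, LinearMap.map_smul, PiTensorProduct.lift.tprod, fieldProduct_tprod,
        ← productSeries_eq_prod]
      ext e
      change ((HahnModule.of ℂ).symm
        (f • HahnModule.of ℂ (r • productSeries (vertexOperator 𝔤) 1 n u))).coeff e = _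
      rw [HahnModule.coeff_smul, coeff_mul_of_subset f.isPWO_support (HahnSeries.isPWO_support _)
        (fun a ha h => ha (by simp [h])) subset_rfl]
      refine Finset.sum_congr rfl fun i _ => ?_
      rw [coeff_mapAlgHom, Algebra.ofId_apply, ← Algebra.smul_def]
      rfl
    | add x y hx hy =>
      rw [LinearMap.map_add, LinearMap.map_add, smul_add, HahnModule.of_symm_add, hx, hy, mul_add]

/-- Nondegeneracy: `Zₙ` is the map `u₁ ⊗ ⋯ ⊗ uₙ ⊗ f ↦ f (e^{x₁ d} u₁) ⋯ (e^{xₙ d} uₙ)`, whose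
injectivity follows from the independence of the symbols of the factors. -/
theorem isNondegenerate_vertexOperator : IsNondegenerate (vertexOperator 𝔤) 1 := by
  intro n _ x y h
  refine mulMap_fieldProduct_injective 𝔤 n ?_
  rw [← Z_eq, ← Z_eq, h]

end Nondegeneracy

/-! ### Coefficients of products of fields -/

section Binomial

theorem choose_sub_one_sub (e : ℕ) (n : ℤ) :
    Ring.choose ((e : ℤ) - 1 - n) e = (-1) ^ e * Ring.choose n e := by
  have h := Ring.choose_neg (n - e + 1) e
  rw [show -(n - (e : ℤ) + 1) = e - 1 - n by ring, show n - (e : ℤ) + 1 + e - 1 = n by ring] at h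
  rw [h, Units.smul_def, Int.coe_negOnePow_natCast, smul_eq_mul]

theorem choose_eq_zero_of_nonneg_of_lt {a : ℤ} {k : ℕ} (h0 : 0 ≤ a) (h : a < k) :
    Ring.choose a k = 0 := by
  obtain ⟨a, rfl⟩ := Int.eq_ofNat_of_zero_le h0
  rw [Ring.choose_natCast, Nat.choose_eq_zero_of_lt (by exact_mod_cast h), Nat.cast_zero]

theorem choose_eq_zero_of_lt_of_nonneg {a b : ℕ} (h : a < b) : Ring.choose (a : ℤ) b = 0 :=
  choose_eq_zero_of_nonneg_of_lt (by simp) (by exact_mod_cast h)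

end Binomial

section Antidiagonal

open Finset.HasAntidiagonal in
theorem sum_antidiagonal_antidiagonal {M : Type*} [AddCommMonoid M] (n : ℕ) (f : ℕ → ℕ → ℕ → M) :
    ∑ p ∈ antidiagonal n, ∑ q ∈ antidiagonal p.2, f p.1 q.1 q.2 =
      ∑ p ∈ antidiagonal n, ∑ q ∈ antidiagonal p.1, f q.1 q.2 p.2 := by
  rw [Finset.sum_sigma', Finset.sum_sigma']
  refine Finset.sum_nbij' (fun x => ⟨(x.1.1 + x.2.1, x.2.2), (x.1.1, x.2.1)⟩)
    (fun x => ⟨(x.2.1, x.2.2 + x.1.2), (x.2.2, x.1.2)⟩) ?_ ?_ ?_ ?_ ?_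
  · rintro ⟨⟨i, j⟩, ⟨k, l⟩⟩ h
    simp only [Finset.mem_sigma, mem_antidiagonal, and_true] at h ⊢
    omega
  · rintro ⟨⟨i, j⟩, ⟨k, l⟩⟩ h
    simp only [Finset.mem_sigma, mem_antidiagonal, and_true] at h ⊢
    omega
  · rintro ⟨⟨i, j⟩, ⟨k, l⟩⟩ h
    simp only [Finset.mem_sigma, mem_antidiagonal] at h
    obtain ⟨h1, rfl⟩ := h
    rfl
  · rintro ⟨⟨i, j⟩, ⟨k, l⟩⟩ h
    simp only [Finset.mem_sigma, mem_antidiagonal] at h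
    obtain ⟨h1, rfl⟩ := h
    rfl
  · intro x _
    rfl

end Antidiagonal

section Residue

variable {A : Type*} [Ring A] [Algebra ℂ A] {D : A →ₗ[ℂ] A}

/-- `Dᵃ / a!` on the coefficients of `e^{xD} v`; both sides vanish for `s < 0`. -/
theorem divPow_coeff_expLin (D : A →ₗ[ℂ] A) (a : ℕ) (s : ℤ) (v : A) :
    divPow D a ((expLin D v).coeff s) =
      Ring.choose ((a : ℤ) + s) a • (expLin D v).coeff (a + s) := by
  rcases lt_or_ge s 0 with hs | hs
  · rw [coeff_expLin_of_neg _ _ hs, map_zero]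
    rcases lt_or_ge ((a : ℤ) + s) 0 with h | h
    · rw [coeff_expLin_of_neg _ _ h, smul_zero]
    · rw [choose_eq_zero_of_nonneg_of_lt h (by omega), zero_smul]
  · obtain ⟨s, rfl⟩ := Int.eq_ofNat_of_zero_le hs
    have h1 := coeff_expLin_natCast D v s
    have h2 := coeff_expLin_natCast D v (a + s)
    have h3 := Ring.choose_natCast (R := ℤ) (a + s) a
    push_cast at h2 h3
    rw [h2, h3]
    refine (congrArg (divPow D a) h1).trans ((divPow_divPow D a s v).trans ?_)
    rw [← Int.cast_smul_eq_zsmul ℂ]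
    simp

open Finset.HasAntidiagonal in
/-- The coefficient of `x₁^P x₂^Q` in `(x₂ - x₁)ⁿ e^{x₁ D} G(x₂ - x₁)`, expanded in nonnegative
powers of `x₁`. The binomial coefficient is `(-1)ⁱ` times that of `x₁ⁱ` in `(x₂ + x₁)^{Q + i}`,
as `choose (-Q - 1) i = (-1)ⁱ choose (Q + i) i`. -/
def crossCoeff (D : A →ₗ[ℂ] A) (P : ℕ) (Q n : ℤ) : Laurent A →ₗ[ℂ] A where
  toFun G := ∑ i ∈ antidiagonal P, Ring.choose (-Q - 1) i.1 • divPow D i.2 (G.coeff (Q - n + i.1))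
  map_add' x y := by simp [Finset.sum_add_distrib]
  map_smul' c x := by
    rw [RingHom.id_apply, Finset.smul_sum]
    refine Finset.sum_congr rfl fun i _ => ?_
    rw [HahnSeries.coeff_smul, map_smul, smul_comm]

open Finset.HasAntidiagonal in
theorem crossCoeff_apply (P : ℕ) (Q n : ℤ) (G : Laurent A) : crossCoeff D P Q n G =
    ∑ i ∈ antidiagonal P, Ring.choose (-Q - 1) i.1 • divPow D i.2 (G.coeff (Q - n + i.1)) := rfl

open Finset.HasAntidiagonal in
/-- For a bilinear product `b` that satisfies the Leibniz rule and `G(x) = b(e^{xD} v, u)`, the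
series in `crossCoeff` is `(x₂ - x₁)ⁿ b(e^{x₂ D} v, e^{x₁ D} u)`. -/
theorem crossCoeff_eq_of_leibniz (b : A →ₗ[ℂ] A →ₗ[ℂ] A) (hb : ∀ n x y, divPow D n (b x y) =
      ∑ p ∈ antidiagonal n, b (divPow D p.1 x) (divPow D p.2 y))
    (u v : A) (P : ℕ) (Q n : ℤ) {G : Laurent A}
    (hG : ∀ s, G.coeff s = b ((expLin D v).coeff s) u) :
    crossCoeff D P Q n G = ∑ i ∈ antidiagonal P, ((-1) ^ i.1 * Ring.choose n i.1 : ℤ) •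
      b ((expLin D v).coeff (Q - n + i.1)) ((expLin D u).coeff i.2) := by
  have h1 : ∀ i ∈ antidiagonal P,
      Ring.choose (-Q - 1) i.1 • divPow D i.2 (G.coeff (Q - n + i.1)) =
      ∑ j ∈ antidiagonal i.2, (Ring.choose (-Q - 1) i.1 * Ring.choose (Q - n + (i.1 + j.1)) j.1) •
        b ((expLin D v).coeff (Q - n + (i.1 + j.1))) ((expLin D u).coeff j.2) := by
    intro i _
    rw [hG, hb, Finset.smul_sum]
    refine Finset.sum_congr rfl fun j _ => ?_
    rw [divPow_coeff_expLin, map_zsmul, LinearMap.smul_apply, smul_smul,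
      show (j.1 : ℤ) + (Q - n + i.1) = Q - n + (i.1 + j.1) by ring]
    congr 2
  refine (Finset.sum_congr rfl h1).trans ((sum_antidiagonal_antidiagonal P fun i j k =>
    (Ring.choose (-Q - 1) i * Ring.choose (Q - n + (i + j)) j) •
        b ((expLin D v).coeff (Q - n + (i + j))) ((expLin D u).coeff k)).trans ?_)
  refine Finset.sum_congr rfl fun i _ => ?_
  have h2 : ((-1) ^ i.1 * Ring.choose n i.1 : ℤ) =
      ∑ j ∈ antidiagonal i.1, Ring.choose (-Q - 1) j.1 * Ring.choose (Q - n + (j.1 + j.2)) j.2 := by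
    rw [← choose_sub_one_sub, show (i.1 : ℤ) - 1 - n = (-Q - 1) + (Q - n + i.1) by ring,
      Ring.add_choose_eq _ (Commute.all _ _)]
    refine Finset.sum_congr rfl fun j hj => ?_
    rw [← mem_antidiagonal.1 hj]
    push_cast
    rfl
  rw [h2, Finset.sum_smul]
  refine Finset.sum_congr rfl fun j hj => ?_
  rw [← mem_antidiagonal.1 hj]
  push_cast
  rfl

open Finset.HasAntidiagonal in
theorem crossCoeff_field_mul_const (hD : IsDeriv D) (u v : A) (P : ℕ) (Q n : ℤ) :
    crossCoeff D P Q n (expHom D hD v * const A u) =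
      ∑ i ∈ antidiagonal P, ((-1) ^ i.1 * Ring.choose n i.1 : ℤ) •
        ((expLin D v).coeff (Q - n + i.1) * (expLin D u).coeff i.2) :=
  crossCoeff_eq_of_leibniz (LinearMap.mul ℂ A) (fun n x y => hD.divPow_mul n x y) u v P Q n
    fun _ => HahnSeries.coeff_mul_single_zero

open Finset.HasAntidiagonal in
theorem crossCoeff_const_mul_field (hD : IsDeriv D) (u v : A) (P : ℕ) (Q n : ℤ) :
    crossCoeff D P Q n (const A u * expHom D hD v) =
      ∑ i ∈ antidiagonal P, ((-1) ^ i.1 * Ring.choose n i.1 : ℤ) •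
        ((expLin D u).coeff i.2 * (expLin D v).coeff (Q - n + i.1)) :=
  crossCoeff_eq_of_leibniz (LinearMap.mul ℂ A).flip
    (fun n x y => (hD.divPow_mul n y x).trans (Finset.Nat.sum_antidiagonal_swap
      (f := fun p : ℕ × ℕ => divPow D p.2 y * divPow D p.1 x))) u v P Q n
    fun _ => HahnSeries.coeff_single_zero_mul

theorem coeff_mul_eq_finsum {R : Type*} [Ring R] (x y : Laurent R) (s : ℤ) :
    (x * y).coeff s = ∑ᶠ m : ℤ, x.coeff m * y.coeff (s - m) := by
  rw [HahnSeries.coeff_mul]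
  have h : ∀ m, x.coeff m * y.coeff (s - m) ≠ 0 → (m, s - m) ∈ Finset.antidiagonal
      x.isPWO_support y.isPWO_support s := fun m hm => Finset.mem_antidiagonal.2
    ⟨left_ne_zero_of_mul hm, right_ne_zero_of_mul hm, add_sub_cancel _ _⟩
  rw [finsum_eq_sum_of_support_subset (s := (Finset.antidiagonal x.isPWO_support
    y.isPWO_support s).image Prod.fst)]
  · rw [Finset.sum_image]
    · refine Finset.sum_congr rfl fun i hi => ?_
      rw [← (Finset.mem_antidiagonal.1 hi).2.2, add_sub_cancel_left]
    · intro i hi j hj hij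
      have h1 := (Finset.mem_antidiagonal.1 hi).2.2
      have h2 := (Finset.mem_antidiagonal.1 hj).2.2
      exact Prod.ext hij (by omega)
  · intro m hm
    exact Finset.mem_coe.2 (Finset.mem_image.2 ⟨_, h m hm, rfl⟩)

open Finset.HasAntidiagonal in
theorem crossCoeff_scalars_mul (P : ℕ) (Q n : ℤ) (f : Laurent ℂ) (G : Laurent A) :
    crossCoeff D P Q n (scalars A f * G) =
      ∑ᶠ m : ℤ, f.coeff m • crossCoeff D P Q (n + m) G := by
  let M := Finset.Icc f.order (Q - n + P - G.order)
  have h0 : ∀ m ∉ M, ∀ i : ℕ, i ≤ P → f.coeff m • G.coeff (Q - n + i - m) = 0 := by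
    intro m hm i hi
    rcases lt_or_ge m f.order with h | h
    · rw [HahnSeries.coeff_eq_zero_of_lt_order h, zero_smul]
    · have h2 : Q - n + P - G.order < m := by
        by_contra h3
        exact hm (Finset.mem_Icc.2 ⟨h, not_lt.1 h3⟩)
      rw [HahnSeries.coeff_eq_zero_of_lt_order (x := G) (by omega), smul_zero]
  have hle : ∀ i ∈ antidiagonal P, i.1 ≤ P := fun i hi => by
    have := mem_antidiagonal.1 hi
    omega
  rw [finsum_eq_sum_of_support_subset (s := M)]
  · simp only [crossCoeff_apply, Finset.smul_sum]
    rw [Finset.sum_comm]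
    refine Finset.sum_congr rfl fun i hi => ?_
    rw [coeff_mul_eq_finsum, finsum_eq_sum_of_support_subset (s := M)]
    · rw [map_sum, Finset.smul_sum]
      refine Finset.sum_congr rfl fun m _ => ?_
      rw [coeff_mapAlgHom, Algebra.ofId_apply, ← Algebra.smul_def, map_smul, smul_comm,
        show Q - n + i.1 - m = Q - (n + m) + i.1 by ring]
    · intro m hm
      by_contra hm'
      refine hm ?_
      simp only
      rw [coeff_mapAlgHom, Algebra.ofId_apply, ← Algebra.smul_def]
      exact h0 m hm' i.1 (hle i hi)
  · intro m hm
    by_contra hm'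
    refine hm ?_
    simp only [crossCoeff_apply, Finset.smul_sum]
    refine Finset.sum_eq_zero fun i hi => ?_
    rw [smul_comm, ← map_smul, show Q - (n + m) + i.1 = Q - n + i.1 - m by ring,
      h0 m hm' i.1 (hle i hi), map_zero, smul_zero]

end Residue

/-! ### The Jacobi identity -/

section Binomial

/-- The coefficient identity behind the Jacobi identity: the difference of the expansions of
`(1 - x)ⁿ` in powers of `x` and of `x⁻¹`. -/
theorem alternating_choose_sub (n P r : ℤ) :
    (if P - n ≤ r then (-1) ^ (r - (P - n)).toNat * Ring.choose n (r - (P - n)).toNat else 0) -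
      (n.negOnePow : ℤ) * (if r ≤ P then (-1) ^ (P - r).toNat * Ring.choose n (P - r).toNat else 0)
      = if n < 0 then Ring.choose (r - P - 1) (-n - 1).toNat else 0 := by
  rcases lt_or_ge n 0 with hn | hn
  · rw [if_pos hn]
    obtain ⟨N, rfl⟩ : ∃ N : ℕ, n = -N - 1 := ⟨(-n - 1).toNat, by omega⟩
    rw [show (-(-(N : ℤ) - 1) - 1).toNat = N by omega]
    have key : ∀ i : ℕ, (-1) ^ i * Ring.choose (-(N : ℤ) - 1) i = ((N + i).choose N : ℤ) := by
      intro i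
      rw [← choose_sub_one_sub, show (i : ℤ) - 1 - (-N - 1) = ((N + i : ℕ) : ℤ) by push_cast; ring,
        Ring.choose_natCast, ← Nat.choose_symm_add]
    rcases lt_or_ge r (P + 1) with h1 | h1
    · rw [if_neg (by omega), if_pos (by omega)]
      obtain ⟨e, rfl⟩ : ∃ e : ℕ, r = P - e := ⟨(P - r).toNat, by omega⟩
      rw [show (P - (P - (e : ℤ))).toNat = e by omega, key,
        show P - (e : ℤ) - P - 1 = (N : ℤ) - 1 - (N + e : ℕ) by push_cast; ring, choose_sub_one_sub,
        Ring.choose_natCast, show -(N : ℤ) - 1 = -(N + 1 : ℕ) by push_cast; ring,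
        Int.negOnePow_neg, Int.coe_negOnePow_natCast, pow_succ]
      ring
    · rw [if_neg (show ¬ r ≤ P by omega), mul_zero, sub_zero]
      split_ifs with h2
      · obtain ⟨i, rfl⟩ : ∃ i : ℕ, r = P - (-N - 1) + i := ⟨(r - (P - (-N - 1))).toNat, by omega⟩
        rw [show (P - (-(N : ℤ) - 1) + i - (P - (-N - 1))).toNat = i by omega, key,
          show P - (-(N : ℤ) - 1) + i - P - 1 = ((N + i : ℕ) : ℤ) by push_cast; ring,
          Ring.choose_natCast]
      · rw [choose_eq_zero_of_nonneg_of_lt (by omega) (by omega)]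
  · rw [if_neg (not_lt.2 hn)]
    obtain ⟨n, rfl⟩ := Int.eq_ofNat_of_zero_le hn
    simp only [Ring.choose_natCast]
    rcases lt_or_ge r (P - n) with h1 | h1
    · rw [if_neg (not_le.2 h1), if_pos (by omega), Nat.choose_eq_zero_of_lt (by omega)]
      simp
    · rw [if_pos h1]
      rcases lt_or_ge P r with h2 | h2
      · rw [if_neg (not_le.2 h2), Nat.choose_eq_zero_of_lt (by omega)]
        simp
      · rw [if_pos h2]
        obtain ⟨e, rfl⟩ : ∃ e : ℕ, r = P - e := ⟨(P - r).toNat, by omega⟩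
        obtain ⟨i, rfl⟩ : ∃ i : ℕ, n = i + e := ⟨n - e, by omega⟩
        rw [show (P - (e : ℤ) - (P - (i + e : ℕ))).toNat = i by omega,
          show (P - (P - (e : ℤ))).toNat = e by omega, Nat.choose_symm_add,
          Int.coe_negOnePow_natCast, pow_add]
        have := pow_mul_pow_eq_one e (show (-1 : ℤ) * -1 = 1 by norm_num)
        linear_combination (-((-1) ^ i * ((i + e).choose e : ℤ))) * this

end Binomial

section Jacobi

variable {A : Type*} [Ring A] [Algebra ℂ A] {D : A →ₗ[ℂ] A}

/-- A sum over `ℕ` reindexed along an injection `φ : ℕ → ℤ`, extended by zero to a finite set that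
contains the support. -/
theorem finsum_zsmul_comp {M : Type*} [AddCommGroup M] {φ : ℕ → ℤ} (hφ : Function.Injective φ)
    {F : Finset ℤ} {g : ℤ → M} (hg : ∀ r ∉ F, g r = 0) {c : ℕ → ℤ} {c' : ℤ → ℤ}
    (h : ∀ i, c' (φ i) = c i) (h0 : ∀ r, r ∉ Set.range φ → c' r = 0) :
    ∑ᶠ i, c i • g (φ i) = ∑ r ∈ F, c' r • g r := by
  have h1 : ∑ᶠ i, c i • g (φ i) = ∑ᶠ r ∈ Set.range φ, c' r • g r := by
    rw [finsum_mem_range hφ]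
    exact finsum_congr fun i => by rw [h]
  rw [h1, finsum_mem_def, ← finsum_eq_sum_of_support_subset (fun r => c' r • g r)]
  · refine finsum_congr fun r => ?_
    by_cases hr : r ∈ Set.range φ
    · rw [Set.indicator_of_mem hr]
    · rw [Set.indicator_of_notMem hr, h0 r hr, zero_smul]
  · intro r hr
    by_contra h
    exact hr (by simp only; rw [hg r h, smul_zero])

theorem mode_derivationY (u : A) (n : ℤ) (w : A) :
    mode (derivationY D) u n w = (expLin D u).coeff (-n - 1) * w := by
  have h : derivationY D u w = expLin D u * HahnSeries.C w := by
    rw [expLin_eq_ofPowerSeries, ← HahnSeries.ofPowerSeries_C, ← map_mul]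
    rfl
  rw [mode, h, HahnSeries.C_apply, HahnSeries.coeff_mul_single_zero]

/-- The modes of `Y(Y(u, x₀) v, x₂)` in terms of products of the modes of `u` and `v`. -/
theorem coeff_expLin_coeff_mul (hD : IsDeriv D) (u v : A) (s : ℕ) (k : ℤ) {F : Finset ℤ}
    (hF : ∀ r ∉ F, (expLin D u).coeff r * (expLin D v).coeff (k + s - r) = 0) :
    (expLin D ((expLin D u).coeff s * v)).coeff k =
      ∑ r ∈ F, Ring.choose r s • ((expLin D u).coeff r * (expLin D v).coeff (k + s - r)) := by
  have h1 : expLin D ((expLin D u).coeff s * v) = expLin D ((expLin D u).coeff s) * expLin D v :=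
    map_mul (expHom D hD) _ _
  have h2 : ∀ m : ℤ, (expLin D ((expLin D u).coeff s)).coeff m =
      Ring.choose (m + s) s • (expLin D u).coeff (m + s) := by
    intro m
    rcases lt_or_ge m 0 with hm | hm
    · rw [coeff_expLin_of_neg _ _ hm]
      rcases lt_or_ge (m + s) 0 with h | h
      · rw [coeff_expLin_of_neg _ _ h, smul_zero]
      · rw [choose_eq_zero_of_nonneg_of_lt h (by omega), zero_smul]
    · obtain ⟨m, rfl⟩ := Int.eq_ofNat_of_zero_le hm
      refine (coeff_expLin_natCast _ _ m).trans ?_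
      rw [divPow_coeff_expLin, ← Nat.cast_add, Ring.choose_natCast, Ring.choose_natCast,
        Nat.choose_symm_add]
  rw [h1, coeff_mul_eq_finsum, ← finsum_eq_sum_of_support_subset (fun r : ℤ => Ring.choose r s •
    ((expLin D u).coeff r * (expLin D v).coeff (k + s - r)))]
  · rw [← finsum_comp_equiv (Equiv.addRight (s : ℤ)) (f := fun r : ℤ => Ring.choose r s •
      ((expLin D u).coeff r * (expLin D v).coeff (k + s - r)))]
    refine finsum_congr fun m => ?_
    rw [h2, smul_mul_assoc]
    simp
  · intro r hr
    by_contra h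
    exact hr (by simp only; rw [hF r h, smul_zero])

theorem coeff_mul_coeff_mul_eq_zero (u v w : A) {t r : ℤ} (hr : r ∉ Finset.Icc 0 t) :
    (expLin D u).coeff r * ((expLin D v).coeff (t - r) * w) = 0 := by
  rcases lt_or_ge r 0 with h | h
  · rw [coeff_expLin_of_neg _ _ h, zero_mul]
  · rw [coeff_expLin_of_neg D v (n := t - r), zero_mul, mul_zero]
    by_contra h'
    exact hr (Finset.mem_Icc.2 ⟨h, by omega⟩)

open Finset.HasAntidiagonal in
/-- The terms of the second product in the `𝒮`-Jacobi identity that belong to `f ⊗ v ⊗ u` are the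
coefficients of `(x₂ - x₁)ⁿ f(x₂ - x₁) (e^{x₂ D} v)(e^{x₁ D} u) w`. -/
theorem finsum_mode_eq_crossCoeff (hD : IsDeriv D) (v u w : A) (f : Laurent ℂ) (n : ℤ) (P : ℕ)
    (Q : ℤ) : ∑ᶠ mi : ℤ × ℕ,
      (f.coeff mi.1 * (((-1) ^ mi.2 * Ring.choose (n + mi.1) mi.2 : ℤ) : ℂ)) •
      ((expLin D v).coeff (Q - n - mi.1 + mi.2) * ((expLin D u).coeff (P - mi.2) * w)) =
    crossCoeff D P Q n (scalars A f * (expHom D hD v * const A u)) * w := by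
  let M := Finset.Icc f.order (Q - n + P)
  have h0 : ∀ mi ∉ M ×ˢ Finset.range (P + 1),
      f.coeff mi.1 • ((expLin D v).coeff (Q - n - mi.1 + mi.2) * (expLin D u).coeff (P - mi.2)) =
        0 := by
    rintro ⟨m, i⟩ hm
    simp only
    by_contra h
    refine hm (Finset.mem_product.2 ⟨Finset.mem_Icc.2 ?_, Finset.mem_range.2 ?_⟩)
    all_goals
      have h1 : f.order ≤ m := by
        by_contra h1
        exact h (by rw [HahnSeries.coeff_eq_zero_of_lt_order (not_le.1 h1), zero_smul])
      have h2 : 0 ≤ (P : ℤ) - i := by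
        by_contra h1
        exact h (by rw [coeff_expLin_of_neg D u (not_le.1 h1), mul_zero, smul_zero])
      have h3 : 0 ≤ Q - n - m + i := by
        by_contra h1
        exact h (by rw [coeff_expLin_of_neg D v (not_le.1 h1), zero_mul, smul_zero])
    · exact ⟨h1, by omega⟩
    · simp only
      omega
  rw [finsum_eq_sum_of_support_subset (s := M ×ˢ Finset.range (P + 1)), Finset.sum_product,
    crossCoeff_scalars_mul, finsum_eq_sum_of_support_subset (s := M), Finset.sum_mul]
  · refine Finset.sum_congr rfl fun m _ => ?_
    rw [crossCoeff_field_mul_const, Finset.Nat.sum_antidiagonal_eq_sum_range_succ_mk,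
      smul_mul_assoc, Finset.sum_mul, Finset.smul_sum]
    refine Finset.sum_congr rfl fun i hi => ?_
    have hi' := Finset.mem_range_succ_iff.1 hi
    simp only
    rw [mul_smul, Int.cast_smul_eq_zsmul, smul_mul_assoc, mul_assoc, Nat.cast_sub hi', sub_sub]
  · intro m hm
    by_contra hm'
    refine hm ?_
    simp only
    rw [crossCoeff_field_mul_const, Finset.smul_sum]
    refine Finset.sum_eq_zero fun i hi => ?_
    have h1 : i.1 + i.2 = P := mem_antidiagonal.1 hi
    have h2 := h0 (m, i.1) fun h => hm' (Finset.mem_product.1 h).1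
    rw [← h1] at h2
    push_cast at h2
    rw [add_sub_cancel_left] at h2
    rw [sub_sub] at h2
    rw [smul_comm, h2, smul_zero]
  · intro mi hmi
    by_contra hm'
    refine hmi ?_
    simp only
    rw [mul_comm, mul_smul, ← mul_assoc, ← smul_mul_assoc (f.coeff mi.1), h0 mi hm', zero_mul,
      smul_zero]

end Jacobi

section Jacobi

variable {A : Type*} [Ring A] [Algebra ℂ A] {D : A →ₗ[ℂ] A}

theorem vacuumAxioms_derivationY (hD : IsDeriv D) : VacuumAxioms (derivationY D) 1 where
  vacuum v := by
    have h : derivationY D 1 v = expLin D 1 * HahnSeries.C v := by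
      rw [expLin_eq_ofPowerSeries, ← HahnSeries.ofPowerSeries_C, ← map_mul]
      rfl
    rw [h, expLin_eq_single D hD.map_one, HahnSeries.C_apply, HahnSeries.single_mul_single]
    simp
  creation v n hn := coeff_ofPowerSeries_of_neg _ hn
  limit v := by
    have h := mode_derivationY (D := D) v (-1) 1
    rw [mode] at h
    refine Eq.trans h ?_
    rw [mul_one]
    exact (coeff_expLin_natCast D v 0).trans (divPow_zero _ _)

/-- The right hand side of the Jacobi identity, in terms of products of the modes of `u` and
`v`. -/
theorem finsum_mode_mode (hD : IsDeriv D) (u v w : A) (n p q : ℤ) :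
    ∑ᶠ i : ℕ, Ring.choose p i •
        mode (derivationY D) (mode (derivationY D) u (n + i) v) (p + q - i) w =
      ∑ r ∈ Finset.Icc 0 (-p - 1 + (-q - 1) - n),
        (if n < 0 then Ring.choose (r + p) (-n - 1).toNat else 0) •
        ((expLin D u).coeff r * ((expLin D v).coeff (-p - 1 + (-q - 1) - n - r) * w)) := by
  have h0 : ∀ i : ℕ, -n - 1 - (i : ℤ) < 0 → Ring.choose p i •
      mode (derivationY D) (mode (derivationY D) u (n + i) v) (p + q - i) w = 0 := by
    intro i hi
    rw [mode_derivationY, mode_derivationY, coeff_expLin_of_neg D u (by omega), zero_mul]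
    simp
  rcases lt_or_ge n 0 with hn | hn
  · obtain ⟨N, rfl⟩ : ∃ N : ℕ, n = -N - 1 := ⟨(-n - 1).toNat, by omega⟩
    rw [finsum_eq_sum_of_support_subset (s := Finset.range (N + 1))]
    · simp only [if_pos hn, show (-(-(N : ℤ) - 1) - 1).toNat = N by omega]
      have h1 : ∀ i ∈ Finset.range (N + 1), Ring.choose p i • mode (derivationY D)
          (mode (derivationY D) u (-N - 1 + i) v) (p + q - i) w =
          ∑ r ∈ Finset.Icc 0 (-p - 1 + (-q - 1) - (-N - 1)),
            (Ring.choose p i * Ring.choose r (N - i)) • ((expLin D u).coeff r *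
              ((expLin D v).coeff (-p - 1 + (-q - 1) - (-N - 1) - r) * w)) := by
        intro i hi
        have hi' := Finset.mem_range_succ_iff.1 hi
        have hk : -(p + q - i) - 1 + ((N - i : ℕ) : ℤ) = -p - 1 + (-q - 1) - (-N - 1) := by
          push_cast [hi']
          ring
        rw [mode_derivationY, mode_derivationY,
          show -(-(N : ℤ) - 1 + i) - 1 = ((N - i : ℕ) : ℤ) by push_cast [hi']; ring,
          coeff_expLin_coeff_mul hD u v (N - i) _
            (F := Finset.Icc 0 (-p - 1 + (-q - 1) - (-N - 1))), Finset.sum_mul, Finset.smul_sum]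
        · refine Finset.sum_congr rfl fun r _ => ?_
          rw [hk, smul_mul_assoc, smul_smul, mul_assoc]
        · intro r hr
          rw [hk]
          simpa using coeff_mul_coeff_mul_eq_zero (D := D) u v 1 hr
      rw [Finset.sum_congr rfl h1, Finset.sum_comm]
      refine Finset.sum_congr rfl fun r _ => ?_
      rw [← Finset.sum_smul, add_comm r p, Ring.add_choose_eq _ (Commute.all _ _),
        Finset.Nat.sum_antidiagonal_eq_sum_range_succ_mk]
    · intro i hi
      by_contra hi'
      refine hi (h0 i ?_)
      have : ¬ i < N + 1 := fun h => hi' (by simpa using h)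
      omega
  · rw [finsum_eq_zero_of_forall_eq_zero fun i => h0 i (by omega)]
    simp [not_lt.2 hn]

/-- The second product in the `𝒮`-Jacobi identity: the commutation relation `h` turns it into
`(x₂ - x₁)ⁿ (e^{x₁ D} u)(e^{x₂ D} v) w`, expanded in nonnegative powers of `x₁`. -/
theorem finsum_mode_comm (hD : IsDeriv D) {u v : A} {k : ℕ} {v' u' : Fin k → A}
    {f : Fin k → Laurent ℂ}
    (h : ∑ j, scalars A (f j) * (expHom D hD (v' j) * const A (u' j)) =
      const A u * expHom D hD v) (w : A) (n p q : ℤ) :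
    ∑ j, ∑ᶠ mi : ℤ × ℕ,
      ((f j).coeff mi.1 * (((-1) ^ mi.2 * Ring.choose (n + mi.1) mi.2 : ℤ) : ℂ)) •
        mode (derivationY D) (v' j) (q + n + mi.1 - mi.2)
          (mode (derivationY D) (u' j) (p + mi.2) w) =
      ∑ r ∈ Finset.Icc 0 (-p - 1 + (-q - 1) - n),
        (if r ≤ -p - 1 then (-1) ^ (-p - 1 - r).toNat * Ring.choose n (-p - 1 - r).toNat else 0) •
        ((expLin D u).coeff r * ((expLin D v).coeff (-p - 1 + (-q - 1) - n - r) * w)) := by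
  simp only [mode_derivationY]
  rcases lt_or_ge (-p - 1) 0 with hp | hp
  · rw [Finset.sum_eq_zero, Finset.sum_eq_zero]
    · intro r hr
      have := (Finset.mem_Icc.1 hr).1
      rw [if_neg (by omega), zero_smul]
    · intro j _
      refine finsum_eq_zero_of_forall_eq_zero fun mi => ?_
      rw [coeff_expLin_of_neg D (u' j) (by omega), zero_mul, mul_zero, smul_zero]
  · obtain ⟨P, rfl⟩ : ∃ P : ℕ, p = -P - 1 := ⟨(-p - 1).toNat, by omega⟩
    have h1 : ∀ j, ∑ᶠ mi : ℤ × ℕ,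
        ((f j).coeff mi.1 * (((-1) ^ mi.2 * Ring.choose (n + mi.1) mi.2 : ℤ) : ℂ)) •
        ((expLin D (v' j)).coeff (-(q + n + mi.1 - mi.2) - 1) *
          ((expLin D (u' j)).coeff (-(-P - 1 + mi.2) - 1) * w)) =
        crossCoeff D P (-q - 1) n
          (scalars A (f j) * (expHom D hD (v' j) * const A (u' j))) * w := by
      intro j
      rw [← finsum_mode_eq_crossCoeff hD]
      refine finsum_congr fun mi => ?_
      rw [show -(q + n + mi.1 - (mi.2 : ℤ)) - 1 = -q - 1 - n - mi.1 + mi.2 by ring,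
        show -(-(P : ℤ) - 1 + mi.2) - 1 = P - mi.2 by ring]
    rw [Finset.sum_congr rfl fun j _ => h1 j, ← Finset.sum_mul, ← map_sum, h,
      crossCoeff_const_mul_field, Finset.Nat.sum_antidiagonal_eq_sum_range_succ_mk, Finset.sum_mul,
      show -(-(P : ℤ) - 1) - 1 = P by ring]
    refine Eq.trans ?_ (finsum_zsmul_comp (φ := fun e : ℕ => (P : ℤ) - e)
      (fun a b hab => by simpa using hab)
      (fun r hr => coeff_mul_coeff_mul_eq_zero (D := D) u v w hr)
      (c := fun e => (-1) ^ e * Ring.choose n e) (fun e => ?_) fun r hr => ?_)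
    · rw [finsum_eq_sum_of_support_subset (s := Finset.range (P + 1))]
      · refine Finset.sum_congr rfl fun e he => ?_
        have he' := Finset.mem_range_succ_iff.1 he
        rw [smul_mul_assoc, mul_assoc, Nat.cast_sub he',
          show (P : ℤ) + (-q - 1) - n - (P - e) = -q - 1 - n + e by ring]
      · intro e he
        by_contra he'
        have : ¬ e < P + 1 := fun h => he' (by simpa using h)
        refine he ?_
        simp only
        rw [coeff_expLin_of_neg D u (by omega), zero_mul, smul_zero]
    · rw [if_pos (by omega), sub_sub_cancel, Int.toNat_natCast]
    · refine if_neg fun hr' => hr ⟨(P - r).toNat, ?_⟩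
      simp only
      omega

/-- The `𝒮`-Jacobi identity follows from the commutation relation
`∑ⱼ fⱼ(x) (e^{xD} v⁽ʲ⁾) u⁽ʲ⁾ = u (e^{xD} v)`. -/
theorem sJacobi_derivationY (hD : IsDeriv D) {u v : A} {k : ℕ} {v' u' : Fin k → A}
    {f : Fin k → Laurent ℂ}
    (h : ∑ j, scalars A (f j) * (expHom D hD (v' j) * const A (u' j)) =
      const A u * expHom D hD v) : SJacobi (derivationY D) u v v' u' f := by
  intro w n p q
  rw [finsum_mode_comm hD h, finsum_mode_mode hD]
  simp only [mode_derivationY]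
  let F := Finset.Icc 0 (-p - 1 + (-q - 1) - n)
  let g : ℤ → A := fun r =>
    (expLin D u).coeff r * ((expLin D v).coeff (-p - 1 + (-q - 1) - n - r) * w)
  have h1 : ∑ᶠ i : ℕ, ((-1) ^ i * Ring.choose n i : ℤ) •
      ((expLin D u).coeff (-(p + n - i) - 1) * ((expLin D v).coeff (-(q + i) - 1) * w)) =
      ∑ r ∈ F, (if -p - 1 - n ≤ r then (-1) ^ (r - (-p - 1 - n)).toNat *
        Ring.choose n (r - (-p - 1 - n)).toNat else 0) • g r := by
    refine Eq.trans ?_ (finsum_zsmul_comp (φ := fun i : ℕ => -p - 1 - n + (i : ℤ))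
      (fun a b hab => by simpa using hab)
      (fun r hr => coeff_mul_coeff_mul_eq_zero (D := D) u v w hr)
      (c := fun e => (-1) ^ e * Ring.choose n e) (fun e => ?_) fun r hr => ?_)
    · refine finsum_congr fun i => ?_
      rw [show -(p + n - (i : ℤ)) - 1 = -p - 1 - n + i by ring,
        show -(q + (i : ℤ)) - 1 = -p - 1 + (-q - 1) - n - (-p - 1 - n + i) by ring]
    · rw [if_pos (by omega), add_sub_cancel_left, Int.toNat_natCast]
    · refine if_neg fun hr' => hr ⟨(r - (-p - 1 - n)).toNat, ?_⟩
      simp only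
      omega
  have hsign : (-1 : ℂ) ^ n = ((n.negOnePow : ℤ) : ℂ) := (Int.cast_negOnePow ℂ n).symm
  rw [h1, hsign, Int.cast_smul_eq_zsmul, Finset.smul_sum, ← Finset.sum_sub_distrib]
  refine Finset.sum_congr rfl fun r _ => ?_
  rw [smul_smul, ← sub_smul, alternating_choose_sub, show r - (-p - 1) - 1 = r + p by ring]

/-- `Y(u, x₀ + x₂) Y(v, x₂) w = Y(Y(u, x₀) v, x₂) w`, as `e^{xD}` is a homomorphism. -/
theorem weakAssoc_derivationY (hD : IsDeriv D) (u v w : A) :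
    WeakAssoc (derivationY D) 0 u v w := by
  intro a b
  simp only [mode_derivationY, zero_add, Finset.range_one, Finset.sum_singleton, Nat.choose_self,
    Nat.cast_one, Nat.cast_zero, one_smul]
  rw [show -(0 - (0 : ℤ) - 1 - a) - 1 = a by ring, show -((0 : ℤ) - 1 - b) - 1 = b by ring]
  have h1 : ∀ i : ℕ, -((0 : ℤ) - 1 - i - a) - 1 = a + i ∧ -((i : ℤ) - 1 - b) - 1 = b - i :=
    fun i => ⟨by ring, by ring⟩
  simp only [h1]
  rcases lt_or_ge a 0 with ha | ha
  · rw [coeff_expLin_of_neg D u ha, zero_mul, map_zero, HahnSeries.coeff_zero, zero_mul]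
    refine finsum_eq_zero_of_forall_eq_zero fun i => ?_
    rcases lt_or_ge (a + i) 0 with h | h
    · rw [coeff_expLin_of_neg D u h, zero_mul, smul_zero]
    · rw [choose_eq_zero_of_nonneg_of_lt h (by omega), zero_smul]
  · obtain ⟨s, rfl⟩ := Int.eq_ofNat_of_zero_le ha
    rw [coeff_expLin_coeff_mul hD u v s b (F := Finset.Icc 0 (b + s)) fun r hr => by
      simpa using coeff_mul_coeff_mul_eq_zero (D := D) u v 1 hr]
    refine (finsum_congr fun i => ?_).trans
      ((finsum_zsmul_comp (φ := fun i : ℕ => (s : ℤ) + i) (fun a b hab => by simpa using hab)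
      (fun r hr => coeff_mul_coeff_mul_eq_zero (D := D) (t := b + s) u v w hr)
      (c := fun i => Ring.choose ((s + i : ℕ) : ℤ) s)
      (c' := fun r => if s ≤ r then Ring.choose r s else 0) (fun e => ?_) fun r hr => ?_).trans ?_)
    · rw [← Nat.cast_add, Ring.choose_natCast, Ring.choose_natCast, Nat.choose_symm_add]
      push_cast
      rw [add_comm b, add_sub_add_left_eq_sub]
    · simp
    · refine if_neg fun hr' => hr ⟨(r - s).toNat, ?_⟩
      simp only
      omega
    · rw [Finset.sum_mul]
      refine Finset.sum_congr rfl fun r hr => ?_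
      rw [smul_mul_assoc, mul_assoc]
      split_ifs with h
      · rfl
      · rw [choose_eq_zero_of_nonneg_of_lt (Finset.mem_Icc.1 hr).1 (not_le.1 h)]

end Jacobi

/-! ### Construction of the braiding -/

section ExtendScalars

variable {W K : Type*} [AddCommGroup W] [Module ℂ W] [CommRing K] [Algebra ℂ K]
variable {A : Type*} [Ring A] [Algebra ℂ A]

theorem mulMap_extendScalars (κ : K →ₐ[ℂ] A) (E : W →ₗ[ℂ] A) (T : W →ₗ[ℂ] W ⊗[ℂ] K)
    (z : W ⊗[ℂ] K) : mulMap κ E (extendScalars T z) = mulMap κ (mulMap κ E ∘ₗ T) z := by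
  induction z with
  | zero => simp
  | add x y hx hy => rw [map_add, map_add, map_add, hx, hy]
  | tmul w k =>
    rw [mulMap_tmul, LinearMap.comp_apply]
    change mulMap κ E ((LinearMap.mul' ℂ K).lTensor W (TensorProduct.assoc ℂ W K K (T w ⊗ₜ k))) = _
    induction T w with
    | zero => simp
    | add x y hx hy =>
      rw [TensorProduct.add_tmul, map_add, map_add, map_add, hx, hy, map_add, mul_add]
    | tmul w' f =>
      rw [TensorProduct.assoc_tmul, LinearMap.lTensor_tmul, LinearMap.mul'_apply, mulMap_tmul,
        mulMap_tmul, mul_comm f k, map_mul, mul_assoc]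

theorem scalar_mul_mem_range {κ : K →ₐ[ℂ] A} {E : W →ₗ[ℂ] A} (f : K) {z : A}
    (hz : z ∈ LinearMap.range (mulMap κ E)) : κ f * z ∈ LinearMap.range (mulMap κ E) := by
  obtain ⟨z, rfl⟩ := hz
  refine ⟨(LinearMap.mulLeft ℂ f).lTensor W z, ?_⟩
  induction z with
  | zero => simp
  | add x y hx hy => rw [map_add, map_add, map_add, hx, hy, mul_add]
  | tmul w' g =>
    rw [LinearMap.lTensor_tmul, mulMap_tmul, mulMap_tmul, LinearMap.mulLeft_apply, map_mul,
      mul_assoc]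

theorem mul_mem_range {κ : K →ₐ[ℂ] A} {E : W →ₗ[ℂ] A} {a : A}
    (hκ : ∀ f, Commute (κ f) a) (h : ∀ w, a * E w ∈ LinearMap.range (mulMap κ E)) {z : A}
    (hz : z ∈ LinearMap.range (mulMap κ E)) : a * z ∈ LinearMap.range (mulMap κ E) := by
  obtain ⟨z, rfl⟩ := hz
  induction z with
  | zero => simp
  | add x y hx hy => rw [map_add, mul_add]; exact Submodule.add_mem _ hx hy
  | tmul w f =>
    rw [mulMap_tmul, ← mul_assoc, ← (hκ f).eq, mul_assoc]
    exact scalar_mul_mem_range f (h w)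

end ExtendScalars

section PartialFractions

variable {𝔤 : Type*} [LieRing 𝔤] [LieAlgebra ℂ 𝔤]

/-- The expansion of `t⁻ᵐ (t + x)⁻ⁿ ⊗ c` in nonnegative powers of `x`, for `m + n > 0`. -/
def partialFraction (m n : ℕ) (c : 𝔤) : (UNegLoop 𝔤)⟦X⟧ :=
  PowerSeries.mk fun k =>
    ((-1 : ℂ) ^ k * (n + k - 1).choose k) • ιLin _ (pole (m + n + k - 1) c)

theorem coeff_partialFraction (m n k : ℕ) (c : 𝔤) :
    PowerSeries.coeff k (partialFraction m n c) =
      ((-1 : ℂ) ^ k * (n + k - 1).choose k) • ιLin _ (pole (m + n + k - 1) c) :=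
  PowerSeries.coeff_mk _ _

theorem expSeries_pole (n : ℕ) (c : 𝔤) :
    expSeries (dU 𝔤) (ιLin _ (pole n c)) = partialFraction 0 (n + 1) c := by
  ext k
  rw [coeff_partialFraction, show n + 1 + k - 1 = n + k by omega,
    show 0 + (n + 1) + k - 1 = n + k by omega, ← divPow_pole]
  exact PowerSeries.coeff_mk _ _

theorem C_pole (m : ℕ) (c : 𝔤) :
    PowerSeries.C (ιLin _ (pole m c)) = partialFraction (m + 1) 0 c := by
  ext k
  rw [coeff_partialFraction, PowerSeries.coeff_C]
  cases k with
  | zero => simp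
  | succ k => simp

/-- `x · t^{-m-1} (t + x)^{-n-1} = t^{-m-1} (t + x)^{-n} - t^{-m} (t + x)^{-n-1}`. -/
theorem X_mul_partialFraction (m n : ℕ) (c : 𝔤) :
    PowerSeries.X * partialFraction (m + 1) (n + 1) c =
      partialFraction (m + 1) n c - partialFraction m (n + 1) c := by
  ext k
  rw [map_sub, coeff_partialFraction, coeff_partialFraction]
  cases k with
  | zero =>
    rw [PowerSeries.coeff_zero_X_mul]
    simp [show m + 1 + n = m + (n + 1) by ring]
  | succ k =>
    rw [PowerSeries.coeff_succ_X_mul, coeff_partialFraction,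
      show m + 1 + (n + 1) + k - 1 = m + n + k + 1 by omega,
      show m + 1 + n + (k + 1) - 1 = m + n + k + 1 by omega,
      show m + (n + 1) + (k + 1) - 1 = m + n + k + 1 by omega,
      show n + 1 + k - 1 = n + k by omega, show n + (k + 1) - 1 = n + k by omega,
      show n + 1 + (k + 1) - 1 = n + k + 1 by omega, ← sub_smul, Nat.choose_succ_succ (n + k) k,
      pow_succ]
    congr 1
    push_cast
    ring

theorem commutator_expSeries_pole (m n : ℕ) (a b : 𝔤) :
    PowerSeries.C (ιLin _ (pole m a)) * expSeries (dU 𝔤) (ιLin _ (pole n b)) -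
      expSeries (dU 𝔤) (ιLin _ (pole n b)) * PowerSeries.C (ιLin _ (pole m a)) =
      partialFraction (m + 1) (n + 1) ⁅a, b⁆ := by
  ext k
  rw [map_sub, PowerSeries.coeff_C_mul, PowerSeries.coeff_mul_C, expSeries_pole,
    coeff_partialFraction, coeff_partialFraction, mul_smul_comm, smul_mul_assoc, ← smul_sub,
    ← ιLin_lie, lie_pole,
    show m + (0 + (n + 1) + k - 1) + 1 = m + 1 + (n + 1) + k - 1 by omega]

end PartialFractions

section Braiding

variable {𝔤 : Type*} [LieRing 𝔤] [LieAlgebra ℂ 𝔤]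

/-- The `ℂ((x))`-span of `e^{xd} z` and `z` for `z` in `𝔤 ⊗ t⁻¹ℂ[t⁻¹]`. -/
def generatorSpan (𝔤 : Type*) [LieRing 𝔤] [LieAlgebra ℂ 𝔤] :
    Submodule ℂ (Laurent (UNegLoop 𝔤)) :=
  Submodule.span ℂ {y | ∃ (f : Laurent ℂ) (z : negLoop 𝔤),
    y = scalars _ f * field 𝔤 (ιLin _ z) ∨ y = scalars _ f * const _ (ιLin _ z)}

theorem scalars_mul_mem_generatorSpan (f : Laurent ℂ) {y : Laurent (UNegLoop 𝔤)}
    (hy : y ∈ generatorSpan 𝔤) : scalars _ f * y ∈ generatorSpan 𝔤 := by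
  induction hy using Submodule.span_induction with
  | mem y hy =>
    obtain ⟨g, z, rfl | rfl⟩ := hy
    · exact Submodule.subset_span ⟨f * g, z, Or.inl (by rw [map_mul, mul_assoc])⟩
    · exact Submodule.subset_span ⟨f * g, z, Or.inr (by rw [map_mul, mul_assoc])⟩
  | zero => simp
  | add u v _ _ h h' => rw [mul_add]; exact Submodule.add_mem _ h h'
  | smul c u _ h => rw [mul_smul_comm]; exact Submodule.smul_mem _ c h

/-- Partial fraction expansion: the total pole order `m + n` is lowered until one of the two poles
is gone, at the cost of negative powers of `x`. -/
theorem partialFraction_mem_generatorSpan (c : 𝔤) (s m n : ℕ) (hs : m + n = s + 1) :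
    HahnSeries.ofPowerSeries ℤ _ (partialFraction m n c) ∈ generatorSpan 𝔤 := by
  induction s generalizing m n with
  | zero =>
    rcases Nat.eq_zero_or_pos m with rfl | hm
    · obtain rfl : n = 0 + 1 := by omega
      rw [← expSeries_pole, ← expLin_eq_ofPowerSeries]
      exact Submodule.subset_span ⟨1, pole 0 c, Or.inl (by rw [map_one, one_mul]; rfl)⟩
    · obtain rfl : n = 0 := by omega
      obtain rfl : m = 0 + 1 := by omega
      rw [← C_pole, HahnSeries.ofPowerSeries_C]
      exact Submodule.subset_span ⟨1, pole 0 c, Or.inr (by rw [map_one, one_mul]; rfl)⟩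
  | succ s ih =>
    cases m with
    | zero =>
      obtain rfl : n = s + 1 + 1 := by omega
      rw [← expSeries_pole, ← expLin_eq_ofPowerSeries]
      exact Submodule.subset_span ⟨1, pole (s + 1) c, Or.inl (by rw [map_one, one_mul]; rfl)⟩
    | succ m =>
      cases n with
      | zero =>
        rw [← C_pole, HahnSeries.ofPowerSeries_C]
        exact Submodule.subset_span ⟨1, pole m c, Or.inr (by rw [map_one, one_mul]; rfl)⟩
      | succ n =>
        have h1 := congrArg (HahnSeries.ofPowerSeries ℤ _) (X_mul_partialFraction m n c)
        rw [map_mul, map_sub, HahnSeries.ofPowerSeries_X] at h1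
        have h2 : scalars (UNegLoop 𝔤) (HahnSeries.single (-1) 1) * HahnSeries.single 1 1 = 1 := by
          rw [scalars, mapAlgHom_single, map_one, HahnSeries.single_mul_single]
          simp
        rw [← one_mul (HahnSeries.ofPowerSeries ℤ _ (partialFraction (m + 1) (n + 1) c)), ← h2,
          mul_assoc, h1]
        exact scalars_mul_mem_generatorSpan _
          (Submodule.sub_mem _ (ih _ _ (by omega)) (ih _ _ (by omega)))

/-- The commutators of `𝔤 ⊗ t⁻¹ℂ[t⁻¹]` with its fields, by partial fraction expansion of
`t⁻ᵐ (t + x)⁻ⁿ`. -/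
theorem commutator_mem_generatorSpan (x y : negLoop 𝔤) :
    const _ (ιLin _ x) * field 𝔤 (ιLin _ y) - field 𝔤 (ιLin _ y) * const _ (ιLin _ x) ∈
      generatorSpan 𝔤 := by
  have hspan := span_pole (Module.Basis.ofVectorSpace ℂ 𝔤)
  have hx : x ∈ Submodule.span ℂ _ := hspan.symm ▸ Submodule.mem_top
  have hy : y ∈ Submodule.span ℂ _ := hspan.symm ▸ Submodule.mem_top
  induction hx, hy using Submodule.span_induction₂ with
  | mem_mem x y hx hy =>
    obtain ⟨i, rfl⟩ := hx
    obtain ⟨j, rfl⟩ := hy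
    have h := congrArg (HahnSeries.ofPowerSeries ℤ _) (commutator_expSeries_pole i.2 j.2
      (Module.Basis.ofVectorSpace ℂ 𝔤 i.1) (Module.Basis.ofVectorSpace ℂ 𝔤 j.1))
    rw [map_sub, map_mul, map_mul, HahnSeries.ofPowerSeries_C, ← expLin_eq_ofPowerSeries] at h
    exact h ▸ partialFraction_mem_generatorSpan _ (i.2 + j.2 + 1) _ _ (by ring)
  | zero_left y hy => simp
  | zero_right x hx => simp
  | add_left x y z _ _ _ h h' =>
    simp only [map_add, add_mul, mul_add]
    convert Submodule.add_mem _ h h' using 1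
    abel
  | add_right x y z _ _ _ h h' =>
    simp only [map_add, add_mul, mul_add]
    convert Submodule.add_mem _ h h' using 1
    abel
  | smul_left r x y _ _ h =>
    simp only [map_smul, smul_mul_assoc, mul_smul_comm, ← smul_sub]
    exact Submodule.smul_mem _ r h
  | smul_right r x y _ _ h =>
    simp only [map_smul, smul_mul_assoc, mul_smul_comm, ← smul_sub]
    exact Submodule.smul_mem _ r h

/-- `v ⊗ u ⊗ f ↦ f(x) (e^{xd} v) u`. -/
abbrev normalMap (𝔤 : Type*) [LieRing 𝔤] [LieAlgebra ℂ 𝔤] :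
    (UNegLoop 𝔤 ⊗[ℂ] UNegLoop 𝔤) ⊗[ℂ] Laurent ℂ →ₗ[ℂ] Laurent (UNegLoop 𝔤) :=
  mulMap (scalars _) (mulPair (field 𝔤) (const _))

/-- For `y` in the Lie algebra, `y (e^{xd} v)` is a combination of products `f(x) (e^{xd} v') u'`, by
induction on `v`: commuting `y` past a generator produces only generators and their fields. -/
theorem const_mul_field_mem_range (x : negLoop 𝔤) (v : UNegLoop 𝔤) :
    const _ (ιLin _ x) * field 𝔤 v ∈ LinearMap.range (normalMap 𝔤) := by
  let W : Submodule ℂ (UNegLoop 𝔤) :=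
    { carrier := {v | ∀ x, const _ (ιLin _ x) * field 𝔤 v ∈ LinearMap.range (normalMap 𝔤)}
      add_mem' := fun {a b} ha hb x => by
        rw [map_add, mul_add]; exact Submodule.add_mem _ (ha x) (hb x)
      zero_mem' := fun x => by rw [map_zero, mul_zero]; exact Submodule.zero_mem _
      smul_mem' := fun c a ha x => by
        rw [map_smul, mul_smul_comm]; exact Submodule.smul_mem _ c (ha x) }
  have hfield : ∀ (a : UNegLoop 𝔤) {z}, z ∈ LinearMap.range (normalMap 𝔤) →
      field 𝔤 a * z ∈ LinearMap.range (normalMap 𝔤) := by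
    intro a z hz
    refine mul_mem_range (fun f => commute_mapAlgHom_ofId f _) (fun w => ?_) hz
    induction w with
    | zero => simp
    | add p q hp hq => rw [map_add, mul_add]; exact Submodule.add_mem _ hp hq
    | tmul p q =>
      refine ⟨((a * p) ⊗ₜ q) ⊗ₜ 1, ?_⟩
      rw [mulMap_tmul, map_one, one_mul, mulPair_tmul, mulPair_tmul, map_mul, mul_assoc]
  have hgen : ∀ {y}, y ∈ generatorSpan 𝔤 → ∀ v ∈ W,
      y * field 𝔤 v ∈ LinearMap.range (normalMap 𝔤) := by
    intro y hy v hv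
    induction hy using Submodule.span_induction with
    | mem y hy =>
      obtain ⟨g, z, rfl | rfl⟩ := hy
      · rw [mul_assoc]
        refine scalar_mul_mem_range _ (hfield _ ⟨(v ⊗ₜ 1) ⊗ₜ 1, ?_⟩)
        rw [mulMap_tmul, map_one, one_mul, mulPair_tmul, map_one, mul_one]
      · rw [mul_assoc]
        exact scalar_mul_mem_range _ (hv z)
    | zero => simp
    | add u v _ _ h h' => rw [add_mul]; exact Submodule.add_mem _ h h'
    | smul c u _ h => rw [smul_mul_assoc]; exact Submodule.smul_mem _ c h
  have hW : W = ⊤ := by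
    refine eq_top_of_one_mem_of_mul_mem (fun x => ?_) fun y v hv x => ?_
    · refine ⟨(1 ⊗ₜ ιLin _ x) ⊗ₜ 1, ?_⟩
      rw [mulMap_tmul, map_one, one_mul, mulPair_tmul, map_one]
      exact (one_mul _).trans (mul_one _).symm
    · have h := Submodule.add_mem _ (hgen (commutator_mem_generatorSpan x y) v hv)
        (hfield (ιLin _ y) (hv x))
      rwa [sub_mul, mul_assoc (field 𝔤 _), sub_add_cancel, mul_assoc, ← map_mul] at h
  exact (hW ▸ Submodule.mem_top : v ∈ W) x

/-- Every product `u (e^{xd} v)` is a combination of products `f(x) (e^{xd} v') u'`. -/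
theorem mulPairOp_mem_range (z : UNegLoop 𝔤 ⊗[ℂ] UNegLoop 𝔤) :
    mulPairOp (field 𝔤) (const _) z ∈ LinearMap.range (normalMap 𝔤) := by
  have hconst : ∀ (x : negLoop 𝔤) {z}, z ∈ LinearMap.range (normalMap 𝔤) →
      const _ (ιLin _ x) * z ∈ LinearMap.range (normalMap 𝔤) := by
    intro x z hz
    refine mul_mem_range (fun f => commute_mapAlgHom_ofId f _) (fun w => ?_) hz
    induction w with
    | zero => simp
    | add p q hp hq => rw [map_add, mul_add]; exact Submodule.add_mem _ hp hq
    | tmul p q =>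
      rw [mulPair_tmul, ← mul_assoc]
      obtain ⟨y, hy⟩ := const_mul_field_mem_range x p
      rw [← hy]
      refine ⟨((LinearMap.mulRight ℂ q).lTensor _).rTensor _ y, ?_⟩
      clear hy
      induction y with
      | zero => simp
      | add x y hx hy => rw [map_add, map_add, map_add, hx, hy, add_mul]
      | tmul w f =>
        rw [LinearMap.rTensor_tmul, mulMap_tmul, mulMap_tmul, mul_assoc]
        congr 1
        induction w with
        | zero => simp
        | add x y hx hy => rw [map_add, map_add, map_add, hx, hy, add_mul]
        | tmul a b =>
          rw [LinearMap.lTensor_tmul, mulPair_tmul, mulPair_tmul, LinearMap.mulRight_apply, map_mul,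
            mul_assoc]
  let W : Submodule ℂ (UNegLoop 𝔤) :=
    { carrier := {u | ∀ v, const _ u * field 𝔤 v ∈ LinearMap.range (normalMap 𝔤)}
      add_mem' := fun {a b} ha hb x => by
        rw [map_add, add_mul]; exact Submodule.add_mem _ (ha x) (hb x)
      zero_mem' := fun x => by rw [map_zero, zero_mul]; exact Submodule.zero_mem _
      smul_mem' := fun c a ha x => by
        rw [map_smul, smul_mul_assoc]; exact Submodule.smul_mem _ c (ha x) }
  have hW : W = ⊤ := by
    refine eq_top_of_one_mem_of_mul_mem (fun v => ?_) fun x u hu v => ?_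
    · refine ⟨(v ⊗ₜ 1) ⊗ₜ 1, ?_⟩
      rw [mulMap_tmul, map_one, one_mul, mulPair_tmul, map_one, mul_one, one_mul]
    · rw [map_mul, mul_assoc]
      exact hconst x (hu v)
  induction z with
  | zero => simp
  | add x y hx hy => rw [map_add]; exact Submodule.add_mem _ hx hy
  | tmul v u => exact (hW ▸ Submodule.mem_top : u ∈ W) v

/-- The operator `𝒮(x)`: `𝒮(x)(v ⊗ u) = ∑ⱼ v⁽ʲ⁾ ⊗ u⁽ʲ⁾ ⊗ fⱼ(x)` when
`u (e^{xd} v) = ∑ⱼ fⱼ(x) (e^{xd} v⁽ʲ⁾) u⁽ʲ⁾`. -/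
def braiding (𝔤 : Type*) [LieRing 𝔤] [LieAlgebra ℂ 𝔤] : SOperator (UNegLoop 𝔤) :=
  (LinearEquiv.ofInjective (normalMap 𝔤) mulMap_mulPair_injective).symm.toLinearMap ∘ₗ
    (mulPairOp (field 𝔤) (const _)).codRestrict (LinearMap.range (normalMap 𝔤)) mulPairOp_mem_range

theorem normalMap_braiding (z : UNegLoop 𝔤 ⊗[ℂ] UNegLoop 𝔤) :
    normalMap 𝔤 (braiding 𝔤 z) = mulPairOp (field 𝔤) (const _) z :=
  congrArg Subtype.val ((LinearEquiv.ofInjective (normalMap 𝔤)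
    mulMap_mulPair_injective).apply_symm_apply ⟨_, mulPairOp_mem_range z⟩)

end Braiding

/-! ### Unitarity -/

section EvalNeg

variable {A : Type*} [Ring A] [Algebra ℂ A] {D : A →ₗ[ℂ] A}

theorem alternating_choose_smul_eq_zero {M : Type*} [AddCommGroup M] (k i : ℕ) {a : M}
    (h : i < k → a = 0) (hne : i ≠ k) : ((-1) ^ i * Ring.choose (k : ℤ) i : ℤ) • a = 0 := by
  rcases lt_or_gt_of_ne hne with hlt | hgt
  · rw [h hlt, smul_zero]
  · rw [choose_eq_zero_of_lt_of_nonneg hgt, mul_zero, zero_smul]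

open Finset.HasAntidiagonal in
/-- If `h i` vanishes for `i < k`, only the term `i = k` of the alternating sum survives, since
`choose k i = 0` for `i > k`. -/
theorem sum_antidiagonal_alternating_choose {M : Type*} [AddCommGroup M] (P k : ℕ) (g : ℤ → M)
    (hg : ∀ r < 0, g r = 0) (h : ℕ → ℤ → M) (hh : ∀ i < k, ∀ r, h i r = 0)
    (hk : ∀ r, h k r = g r) :
    ∑ i ∈ antidiagonal P, ((-1) ^ i.1 * Ring.choose (k : ℤ) i.1 : ℤ) • h i.1 i.2 =
      ((-1) ^ k : ℤ) • g (P - k) := by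
  rcases lt_or_ge P k with hP | hP
  · rw [hg _ (by omega), smul_zero]
    refine Finset.sum_eq_zero fun i hi => ?_
    have := mem_antidiagonal.1 hi
    rw [hh _ (by omega), smul_zero]
  · rw [Finset.sum_eq_single (k, P - k)]
    · rw [Ring.choose_natCast, Nat.choose_self, hk, Nat.cast_sub hP]
      simp
    · rintro ⟨i, j⟩ hi hne
      refine alternating_choose_smul_eq_zero k i (fun hlt => hh i hlt _) fun hik => hne ?_
      have : i + j = P := mem_antidiagonal.1 hi
      simp only [Prod.mk.injEq]
      omega
    · intro hi
      exact absurd (mem_antidiagonal.2 (by simp [hP])) hi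

theorem crossCoeff_zero_field_mul_const (hD : IsDeriv D) (u v : A) (P k : ℕ) :
    crossCoeff D P 0 k (expHom D hD v * const A u) =
      ((-1) ^ k : ℤ) • (v * (expLin D u).coeff (P - k)) := by
  rw [crossCoeff_field_mul_const]
  refine sum_antidiagonal_alternating_choose P k (fun r => v * (expLin D u).coeff r)
    (fun r hr => by rw [coeff_expLin_of_neg _ _ hr, mul_zero])
    (fun i r => (expLin D v).coeff (0 - k + i) * (expLin D u).coeff r)
    (fun i hi r => by rw [coeff_expLin_of_neg _ _ (by omega), zero_mul]) fun r => ?_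
  rw [zero_sub, neg_add_cancel]
  congr 1
  exact (coeff_expLin_natCast D v 0).trans (divPow_zero _ _)

theorem crossCoeff_zero_const_mul_field (hD : IsDeriv D) (u v : A) (P k : ℕ) :
    crossCoeff D P 0 k (const A u * expHom D hD v) =
      ((-1) ^ k : ℤ) • ((expLin D u).coeff (P - k) * v) := by
  rw [crossCoeff_const_mul_field]
  refine sum_antidiagonal_alternating_choose P k (fun r => (expLin D u).coeff r * v)
    (fun r hr => by rw [coeff_expLin_of_neg _ _ hr, zero_mul])
    (fun i r => (expLin D u).coeff r * (expLin D v).coeff (0 - k + i))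
    (fun i hi r => by rw [coeff_expLin_of_neg D v (by omega), mul_zero]) fun r => ?_
  rw [zero_sub, neg_add_cancel]
  congr 1
  exact (coeff_expLin_natCast D v 0).trans (divPow_zero _ _)

/-- The specialization `x₂ = 0` of `(x₂ - x₁)ⁿ e^{x₁ D} G(x₂ - x₁)`, which makes sense for large
`n`: it exchanges the roles of the two factors in `G = ∑ⱼ fⱼ(x) (e^{xD} vⱼ) uⱼ`. -/
theorem exists_crossCoeff_zero (hD : IsDeriv D) (z : (A ⊗[ℂ] A) ⊗[ℂ] Laurent ℂ) :
    ∃ N : ℕ, ∀ n : ℕ, N ≤ n → ∀ P : ℕ,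
      crossCoeff D P 0 n (mulMap (scalars A) (mulPair (expHom D hD) (const A)) z) =
        ((-1) ^ n : ℤ) • (mulMap (scalars A) (mulPair (const A) (expHom D hD))
          (evalNeg.lTensor _ z)).coeff (P - n) := by
  induction z with
  | zero => exact ⟨0, fun n _ P => by simp⟩
  | add x y hx hy =>
    obtain ⟨N, hN⟩ := hx
    obtain ⟨N', hN'⟩ := hy
    refine ⟨max N N', fun n hn P => ?_⟩
    rw [map_add, map_add, map_add, map_add, HahnSeries.coeff_add, smul_add,
      hN n (le_of_max_le_left hn), hN' n (le_of_max_le_right hn)]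
  | tmul w f =>
    induction w with
    | zero => exact ⟨0, fun n _ P => by simp⟩
    | add x y hx hy =>
      obtain ⟨N, hN⟩ := hx
      obtain ⟨N', hN'⟩ := hy
      refine ⟨max N N', fun n hn P => ?_⟩
      rw [TensorProduct.add_tmul, map_add, map_add, map_add, map_add, HahnSeries.coeff_add,
        smul_add, hN n (le_of_max_le_left hn), hN' n (le_of_max_le_right hn)]
    | tmul v u =>
      refine ⟨(-f.order).toNat, fun n hn P => ?_⟩
      rw [mulMap_tmul, LinearMap.lTensor_tmul, mulMap_tmul, mulPair_tmul, mulPair_tmul,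
        crossCoeff_scalars_mul, coeff_mul_eq_finsum, ← Int.cast_smul_eq_zsmul ℂ, smul_finsum]
      refine finsum_congr fun m => ?_
      rw [coeff_mapAlgHom, Algebra.ofId_apply, ← Algebra.smul_def]
      change _ = _ • (((-1 : ℂ) ^ m * f.coeff m) • _)
      rcases lt_or_ge m f.order with hm | hm
      · rw [HahnSeries.coeff_eq_zero_of_lt_order hm]
        simp
      · obtain ⟨k, hk⟩ := Int.eq_ofNat_of_zero_le (show 0 ≤ (n : ℤ) + m by omega)
        have h1 : (const A v * expHom D hD u).coeff (P - n - m) =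
          v * (expLin D u).coeff (P - n - m) := HahnSeries.coeff_single_zero_mul
        rw [hk, crossCoeff_zero_field_mul_const, h1, ← hk, sub_sub, ← Int.cast_smul_eq_zsmul ℂ,
          smul_smul, smul_smul]
        congr 1
        have h2 : (-1 : ℂ) ^ k = (-1) ^ n * (-1) ^ m := by
          rw [← zpow_natCast, ← zpow_natCast, ← zpow_add₀ (by norm_num), hk]
        push_cast
        rw [h2]
        ring

end EvalNeg

section Unitarity

variable {𝔤 : Type*} [LieRing 𝔤] [LieAlgebra ℂ 𝔤]

/-- The relation that defines `𝒮`, with `x` replaced by `-x` and translated by `e^{xd}`. -/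
theorem mulMap_evalNeg_braiding (v u : UNegLoop 𝔤) :
    mulMap (scalars _) (mulPair (const _) (field 𝔤)) (evalNeg.lTensor _ (braiding 𝔤 (v ⊗ₜ u))) =
      field 𝔤 u * const _ v := by
  obtain ⟨N, hN⟩ := exists_crossCoeff_zero isDeriv_dU (braiding 𝔤 (v ⊗ₜ u))
  ext k
  let n := max N (-k).toNat
  have h1 := hN n (le_max_left _ _) (k + n).toNat
  have h2 : (-k).toNat ≤ n := le_max_right _ _
  have h3 : (((k + n).toNat : ℕ) : ℤ) - n = k := by omega
  have h4 : (field 𝔤 u * const _ v).coeff k = (expLin (dU 𝔤) u).coeff k * v :=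
    HahnSeries.coeff_mul_single_zero
  have h5 : mulMap (scalars (UNegLoop 𝔤)) (mulPair (field 𝔤) (const _)) (braiding 𝔤 (v ⊗ₜ u)) =
    const _ u * field 𝔤 v := normalMap_braiding _
  rw [h5, crossCoeff_zero_const_mul_field, h3] at h1
  rw [h4]
  have h6 : ((-1) ^ n : ℤ) * (-1) ^ n = 1 := by
    rw [← mul_pow]
    norm_num
  have h7 := congrArg (fun a => ((-1) ^ n : ℤ) • a) h1
  simp only [smul_smul, h6, one_smul] at h7
  exact h7.symm

theorem mulMap_comm_rTensor {A R K : Type*} [Ring A] [Algebra ℂ A] [Ring R] [Algebra ℂ R]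
    [CommRing K] [Algebra ℂ K] (κ : K →ₐ[ℂ] R) (f g : A →ₐ[ℂ] R) (z : (A ⊗[ℂ] A) ⊗[ℂ] K) :
    mulMap κ (mulPairOp f g) ((TensorProduct.comm ℂ A A).toLinearMap.rTensor K z) =
      mulMap κ (mulPair g f) z := by
  induction z with
  | zero => simp
  | add x y hx hy => rw [map_add, map_add, map_add, hx, hy]
  | tmul w k =>
    rw [LinearMap.rTensor_tmul, mulMap_tmul, mulMap_tmul, mulPairOp, LinearMap.comp_apply]
    congr 2
    exact (TensorProduct.comm ℂ A A).symm_apply_apply w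

theorem lTensor_rTensor_apply {M M' K K' : Type*} [AddCommGroup M] [Module ℂ M] [AddCommGroup M']
    [Module ℂ M'] [AddCommGroup K] [Module ℂ K] [AddCommGroup K'] [Module ℂ K'] (f : M →ₗ[ℂ] M')
    (g : K →ₗ[ℂ] K') (z : M ⊗[ℂ] K) :
    g.lTensor M' (f.rTensor K z) = f.rTensor K' (g.lTensor M z) := by
  rw [← LinearMap.comp_apply, ← LinearMap.comp_apply, LinearMap.lTensor_comp_rTensor,
    LinearMap.rTensor_comp_lTensor]

/-- Both sides become equal after the injective map `v ⊗ u ⊗ f ↦ f(x) u (e^{xd} v)`, which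
`𝒮₂₁(-x)` turns into `v ⊗ u ⊗ f ↦ f(x) (e^{xd} v) u`. -/
theorem unitary_braiding : Unitary (braiding 𝔤) := by
  refine LinearMap.ext fun z => mulMap_mulPairOp_injective ?_
  rw [LinearMap.comp_apply, mulMap_extendScalars]
  have h : mulMap (scalars _) (mulPairOp (field 𝔤) (const _)) ∘ₗ
      (evalNeg.lTensor _ ∘ₗ S21 (braiding 𝔤)) = mulPair (field 𝔤) (const _) := by
    refine TensorProduct.ext' fun v u => ?_
    rw [mulPair_tmul, ← mulMap_evalNeg_braiding, ← mulMap_comm_rTensor]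
    rw [LinearMap.comp_apply, LinearMap.comp_apply, S21, LinearMap.comp_apply, LinearMap.comp_apply,
      lTensor_rTensor_apply]
    rfl
  rw [h]
  refine (normalMap_braiding z).trans ?_
  change _ = mulMap _ _ (z ⊗ₜ 1)
  rw [mulMap_tmul, map_one, one_mul]

end Unitarity

/-! ### Uniqueness and nontriviality -/

section Uniqueness

variable {𝔤 : Type*} [LieRing 𝔤] [LieAlgebra ℂ 𝔤]

theorem exists_eq_sum_tmul {V K : Type*} [AddCommGroup V] [Module ℂ V] [AddCommGroup K] [Module ℂ K]
    (z : (V ⊗[ℂ] V) ⊗[ℂ] K) : ∃ (r : ℕ) (v' u' : Fin r → V) (f : Fin r → K),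
      z = ∑ j, (v' j ⊗ₜ u' j) ⊗ₜ f j := by
  have hadd : ∀ x y : (V ⊗[ℂ] V) ⊗[ℂ] K, (∃ (r : ℕ) (v' u' : Fin r → V) (f : Fin r → K),
      x = ∑ j, (v' j ⊗ₜ u' j) ⊗ₜ f j) → (∃ (r : ℕ) (v' u' : Fin r → V) (f : Fin r → K),
      y = ∑ j, (v' j ⊗ₜ u' j) ⊗ₜ f j) → ∃ (r : ℕ) (v' u' : Fin r → V) (f : Fin r → K),
      x + y = ∑ j, (v' j ⊗ₜ u' j) ⊗ₜ f j := by
    rintro _ _ ⟨r, v', u', f, rfl⟩ ⟨r', v'', u'', f', rfl⟩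
    exact ⟨r + r', Fin.append v' v'', Fin.append u' u'', Fin.append f f', by
      simp [Fin.sum_univ_add]⟩
  induction z with
  | zero => exact ⟨0, Fin.elim0, Fin.elim0, Fin.elim0, by simp⟩
  | add x y hx hy => exact hadd x y hx hy
  | tmul w f =>
    induction w with
    | zero => exact ⟨0, Fin.elim0, Fin.elim0, Fin.elim0, by simp⟩
    | add x y hx hy =>
      rw [TensorProduct.add_tmul]
      exact hadd _ _ hx hy
    | tmul v u => exact ⟨1, fun _ => v, fun _ => u, fun _ => f, by simp⟩

theorem normalMap_sum {r : ℕ} (v' u' : Fin r → UNegLoop 𝔤) (f : Fin r → Laurent ℂ) :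
    normalMap 𝔤 (∑ j, (v' j ⊗ₜ u' j) ⊗ₜ f j) =
      ∑ j, scalars _ (f j) * (field 𝔤 (v' j) * const _ (u' j)) := by
  rw [map_sum]
  rfl

theorem sJacobi_braiding (u v : UNegLoop 𝔤) :
    ∃ (r : ℕ) (v' u' : Fin r → UNegLoop 𝔤) (f : Fin r → Laurent ℂ),
      braiding 𝔤 (v ⊗ₜ u) = ∑ j, (v' j ⊗ₜ u' j) ⊗ₜ f j ∧
      SJacobi (vertexOperator 𝔤) u v v' u' f := by
  obtain ⟨r, v', u', f, h⟩ := exists_eq_sum_tmul (braiding 𝔤 (v ⊗ₜ u))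
  refine ⟨r, v', u', f, h, sJacobi_derivationY isDeriv_dU ?_⟩
  rw [← normalMap_sum, ← h, normalMap_braiding]
  rfl

/-- The `𝒮`-Jacobi identity contains the commutation relation
`∑ⱼ fⱼ(x) (e^{xd} v⁽ʲ⁾) u⁽ʲ⁾ = u (e^{xd} v)`: it is the part with `x₀⁻¹ x₁⁰`, applied to `𝟏`. -/
theorem relation_of_sJacobi {u v : UNegLoop 𝔤} {r : ℕ} {v' u' : Fin r → UNegLoop 𝔤}
    {f : Fin r → Laurent ℂ} (h : SJacobi (vertexOperator 𝔤) u v v' u' f) :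
    ∑ j, scalars _ (f j) * (field 𝔤 (v' j) * const _ (u' j)) = const _ u * field 𝔤 v := by
  ext k
  have h1 := h 1 0 (-1) (-k - 1)
  simp only [vertexOperator, mode_derivationY] at h1
  have h2 : (const _ u * field 𝔤 v).coeff k = u * (expLin (dU 𝔤) v).coeff k :=
    HahnSeries.coeff_single_zero_mul
  have h3 : ∀ G : Laurent (UNegLoop 𝔤), crossCoeff (dU 𝔤) 0 k 0 G = G.coeff k := by
    intro G
    rw [crossCoeff_apply]
    simp
  have h4 : ∀ j, ∑ᶠ mi : ℤ × ℕ,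
      ((f j).coeff mi.1 * (((-1) ^ mi.2 * Ring.choose (0 + mi.1) mi.2 : ℤ) : ℂ)) •
        ((expLin (dU 𝔤) (v' j)).coeff (-(-k - 1 + 0 + mi.1 - mi.2) - 1) *
          ((expLin (dU 𝔤) (u' j)).coeff (-(-1 + (mi.2 : ℤ)) - 1) * 1)) =
      (scalars _ (f j) * (field 𝔤 (v' j) * const _ (u' j))).coeff k := by
    intro j
    rw [← h3, ← mul_one (crossCoeff _ _ _ _ _), ← finsum_mode_eq_crossCoeff isDeriv_dU]
    refine finsum_congr fun mi => ?_
    rw [show -(-k - 1 + 0 + mi.1 - (mi.2 : ℤ)) - 1 = k - 0 - mi.1 + mi.2 by ring,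
      show -(-1 + (mi.2 : ℤ)) - 1 = ((0 : ℕ) : ℤ) - mi.2 by push_cast; ring]
  have h5 : ∑ᶠ i : ℕ, ((-1) ^ i * Ring.choose (0 : ℤ) i : ℤ) •
      ((expLin (dU 𝔤) u).coeff (-(-1 + 0 - (i : ℤ)) - 1) *
        ((expLin (dU 𝔤) v).coeff (-(-k - 1 + i) - 1) * 1)) = u * (expLin (dU 𝔤) v).coeff k := by
    rw [finsum_eq_single _ 0]
    · have h6 := coeff_expLin_natCast (dU 𝔤) u 0
      simp at h6
      simp [h6]
    · intro i hi
      obtain ⟨i, rfl⟩ := Nat.exists_eq_succ_of_ne_zero hi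
      simp
  have h6 : ∑ᶠ i : ℕ, Ring.choose (-1 : ℤ) i • ((expLin (dU 𝔤) ((expLin (dU 𝔤) u).coeff
      (-(0 + (i : ℤ)) - 1) * v)).coeff (-(-1 + (-k - 1) - i) - 1) * 1) = 0 := by
    refine finsum_eq_zero_of_forall_eq_zero fun i => ?_
    rw [coeff_expLin_of_neg (dU 𝔤) u (by omega)]
    simp
  rw [h5, h6, Finset.sum_congr rfl fun j _ => h4 j, zpow_zero, one_smul, sub_eq_zero] at h1
  rw [HahnSeries.coeff_sum, h2, h1]

theorem eq_braiding_of_isQuantumVertexAlgebra {S : SOperator (UNegLoop 𝔤)}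
    (hS : IsQuantumVertexAlgebra (vertexOperator 𝔤) 1 S) : S = braiding 𝔤 := by
  refine TensorProduct.ext' fun v u => mulMap_mulPair_injective ?_
  obtain ⟨r, v', u', f, h, hJ⟩ := hS.sJacobi_S u v
  rw [normalMap_braiding, h, normalMap_sum, relation_of_sJacobi hJ]
  rfl

/-- If `𝒮 = 1`, then `e^{xd} v` and `u` commute. For `v = t⁻¹ ⊗ b`, `u = t⁻¹ ⊗ a` and `x = 0`, this
means that `t⁻² ⊗ ⁅a, b⁆` vanishes in the enveloping algebra; symbols of order `1` detect it. -/
theorem isLieAbelian_of_braiding_eq_trivialS (h : braiding 𝔤 = trivialS (UNegLoop 𝔤)) :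
    IsLieAbelian 𝔤 := by
  refine ⟨fun a b => ?_⟩
  have h1 := normalMap_braiding (ιLin (negLoop 𝔤) (pole 0 b) ⊗ₜ[ℂ] ιLin _ (pole 0 a))
  rw [h] at h1
  have h2 : normalMap 𝔤 (trivialS (UNegLoop 𝔤) (ιLin (negLoop 𝔤) (pole 0 b) ⊗ₜ[ℂ]
      ιLin _ (pole 0 a))) = field 𝔤 (ιLin _ (pole 0 b)) * const _ (ιLin _ (pole 0 a)) := by
    change mulMap _ _ ((_ ⊗ₜ _) ⊗ₜ 1) = _
    rw [mulMap_tmul, map_one, one_mul, mulPair_tmul]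
  rw [h2, mulPairOp_tmul] at h1
  have h3 : (expLin (dU 𝔤) (ιLin _ (pole 0 b))).coeff 0 = ιLin _ (pole 0 b) :=
    (coeff_expLin_natCast _ _ 0).trans (divPow_zero _ _)
  have h4 := congrArg (fun y => y.coeff 0) h1
  have h5 : (field 𝔤 (ιLin _ (pole 0 b)) * const _ (ιLin _ (pole 0 a))).coeff 0 =
      (expLin (dU 𝔤) (ιLin _ (pole 0 b))).coeff 0 * ιLin _ (pole 0 a) :=
    HahnSeries.coeff_mul_single_zero
  have h6 : (const _ (ιLin _ (pole 0 a)) * field 𝔤 (ιLin _ (pole 0 b))).coeff 0 =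
      ιLin _ (pole 0 a) * (expLin (dU 𝔤) (ιLin _ (pole 0 b))).coeff 0 :=
    HahnSeries.coeff_single_zero_mul
  simp only [h5, h6, h3] at h4
  have h7 : ιLin (negLoop 𝔤) (pole 1 ⁅a, b⁆) = 0 := by
    rw [← lie_pole 0 0 a b, ιLin_lie, h4, sub_self]
  classical
  let β := Module.Basis.ofVectorSpace ℂ 𝔤
  refine β.ext_elem fun i => ?_
  rw [map_zero, Finsupp.zero_apply]
  obtain ⟨p, s, hs, hp⟩ := exists_isSymbol_pole β (fun j => if j = (i, 1) then 1 else 0) 1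
  have h8 : p ∘ₗ pole 1 = β.coord i := β.ext fun j => by
    rw [LinearMap.comp_apply, hp (j, 1)]
    simp [Finsupp.single_apply]
  have h9 := (hs [pole 1 ⁅a, b⁆]).2 rfl
  simp only [List.map_cons, List.map_nil, List.prod_singleton, h7, map_zero] at h9
  exact (LinearMap.congr_fun h8 ⁅a, b⁆).symm.trans h9.symm

end Uniqueness

/-! ### The quantum Yang-Baxter equation -/

section Actions

variable {A R K : Type*} [Ring A] [Algebra ℂ A] [Ring R] [Algebra ℂ R] [CommRing K] [Algebra ℂ K]
variable {κ : K →ₐ[ℂ] R} {E F : A ⊗[ℂ] A →ₗ[ℂ] R} {T : A ⊗[ℂ] A →ₗ[ℂ] (A ⊗[ℂ] A) ⊗[ℂ] K}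
variable {M M' : (A ⊗[ℂ] A) ⊗[ℂ] A →ₗ[ℂ] R} {L : A → R →ₗ[ℂ] R}

/-- If `T` exchanges the factors in `E`, then `act12 T` exchanges the first two factors of a product
that is built from `E` and the third factor. -/
theorem mulMap_comp_act12 (hT : mulMap κ E ∘ₗ T = F) (hL : ∀ w f y, L w (κ f * y) = κ f * L w y)
    (hM : ∀ u v w, M ((u ⊗ₜ v) ⊗ₜ w) = L w (E (u ⊗ₜ v)))
    (hM' : ∀ u v w, M' ((u ⊗ₜ v) ⊗ₜ w) = L w (F (u ⊗ₜ v))) :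
    mulMap κ M ∘ₗ act12 T = M' := by
  refine TensorProduct.ext_threefold fun u v w => ?_
  rw [hM', ← hT]
  change mulMap κ M (TensorProduct.rightComm ℂ (A ⊗[ℂ] A) K A (T (u ⊗ₜ v) ⊗ₜ w)) =
    L w (mulMap κ E (T (u ⊗ₜ v)))
  induction T (u ⊗ₜ v) with
  | zero => simp
  | add x y hx hy => rw [TensorProduct.add_tmul, map_add, map_add, map_add, map_add, hx, hy]
  | tmul z f =>
    rw [TensorProduct.rightComm_tmul, mulMap_tmul, mulMap_tmul, hL]
    congr 1
    induction z with
    | zero => simp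
    | add x y hx hy => rw [TensorProduct.add_tmul, map_add, map_add, map_add, hx, hy]
    | tmul u v => exact hM u v w

theorem mulMap_comp_act13 (hT : mulMap κ E ∘ₗ T = F) (hL : ∀ w f y, L w (κ f * y) = κ f * L w y)
    (hM : ∀ u v w, M ((u ⊗ₜ v) ⊗ₜ w) = L v (E (u ⊗ₜ w)))
    (hM' : ∀ u v w, M' ((u ⊗ₜ v) ⊗ₜ w) = L v (F (u ⊗ₜ w))) :
    mulMap κ M ∘ₗ act13 T = M' := by
  have h1 : ∀ y, mulMap κ M ((TensorProduct.rightComm ℂ A A A).toLinearMap.rTensor K y) =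
      mulMap κ (M ∘ₗ (TensorProduct.rightComm ℂ A A A).toLinearMap) y := by
    intro y
    induction y with
    | zero => simp
    | add x y hx hy => rw [map_add, map_add, map_add, hx, hy]
    | tmul z f => rw [LinearMap.rTensor_tmul, mulMap_tmul, mulMap_tmul]; rfl
  have h2 : mulMap κ (M ∘ₗ (TensorProduct.rightComm ℂ A A A).toLinearMap) ∘ₗ act12 T =
      M' ∘ₗ (TensorProduct.rightComm ℂ A A A).toLinearMap :=
    mulMap_comp_act12 hT hL (fun u v w => hM u w v) fun u v w => hM' u w v
  refine TensorProduct.ext_threefold fun u v w => ?_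
  refine (h1 _).trans ?_
  exact LinearMap.congr_fun h2 ((u ⊗ₜ w) ⊗ₜ v)

theorem mulMap_comp_act23 (hT : mulMap κ E ∘ₗ T = F) (hL : ∀ w f y, L w (κ f * y) = κ f * L w y)
    (hM : ∀ u v w, M ((u ⊗ₜ v) ⊗ₜ w) = L u (E (v ⊗ₜ w)))
    (hM' : ∀ u v w, M' ((u ⊗ₜ v) ⊗ₜ w) = L u (F (v ⊗ₜ w))) :
    mulMap κ M ∘ₗ act23 T = M' := by
  refine TensorProduct.ext_threefold fun u v w => ?_
  rw [hM', ← hT]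
  change mulMap κ M ((TensorProduct.assoc ℂ A A A).symm.toLinearMap.rTensor K
    ((TensorProduct.assoc ℂ A (A ⊗[ℂ] A) K).symm (u ⊗ₜ T (v ⊗ₜ w)))) =
    L u (mulMap κ E (T (v ⊗ₜ w)))
  induction T (v ⊗ₜ w) with
  | zero => simp
  | add x y hx hy =>
    rw [TensorProduct.tmul_add, map_add, map_add, map_add, map_add, map_add, hx, hy]
  | tmul z f =>
    rw [TensorProduct.assoc_symm_tmul, LinearMap.rTensor_tmul, mulMap_tmul, mulMap_tmul, hL]
    congr 1
    induction z with
    | zero => simp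
    | add x y hx hy => rw [TensorProduct.tmul_add, map_add, map_add, map_add, map_add, hx, hy]
    | tmul v w => exact hM u v w

/-- Operators that exchange the factors of the products of three homomorphisms `f`, `g`, `h`
satisfy the braid equation if these products are independent: both sides of the equation express
`h(w) g(v) f(u)` in terms of `f(u) g(v) h(w)`. -/
theorem braidEquation_of_exchange (f g h : A →ₐ[ℂ] R) (hκ : ∀ k y, Commute (κ k) y)
    (hinj : Function.Injective (mulMap κ (mulTriple f g h)))
    {S₁₂ S₁₃ S₂₃ : A ⊗[ℂ] A →ₗ[ℂ] (A ⊗[ℂ] A) ⊗[ℂ] K}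
    (h₁₂ : mulMap κ (mulPair f g) ∘ₗ S₁₂ = mulPairOp f g)
    (h₁₃ : mulMap κ (mulPair f h) ∘ₗ S₁₃ = mulPairOp f h)
    (h₂₃ : mulMap κ (mulPair g h) ∘ₗ S₂₃ = mulPairOp g h) : BraidEquation S₁₂ S₁₃ S₂₃ := by
  let lft (k : A →ₐ[ℂ] R) (a : A) : R →ₗ[ℂ] R := LinearMap.mulLeft ℂ (k a)
  let rgt (k : A →ₐ[ℂ] R) (a : A) : R →ₗ[ℂ] R := LinearMap.mulRight ℂ (k a)
  have hlft : ∀ (k : A →ₐ[ℂ] R) w c y, lft k w (κ c * y) = κ c * lft k w y := by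
    intro k w c y
    simp only [lft, LinearMap.mulLeft_apply]
    rw [← mul_assoc, ← (hκ c (k w)).eq, mul_assoc]
  have hrgt : ∀ (k : A →ₐ[ℂ] R) w c y, rgt k w (κ c * y) = κ c * rgt k w y := by
    intro k w c y
    simp only [rgt, LinearMap.mulRight_apply, mul_assoc]
  let σ : (A ⊗[ℂ] A) ⊗[ℂ] A ≃ₗ[ℂ] (A ⊗[ℂ] A) ⊗[ℂ] A :=
    TensorProduct.congr (TensorProduct.comm ℂ A A) (LinearEquiv.refl ℂ A)
  let τ : (A ⊗[ℂ] A) ⊗[ℂ] A ≃ₗ[ℂ] (A ⊗[ℂ] A) ⊗[ℂ] A := TensorProduct.rightComm ℂ A A A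
  have e1 : mulMap κ (mulTriple f g h) ∘ₗ act12 S₁₂ = mulTriple g f h ∘ₗ σ.toLinearMap :=
    mulMap_comp_act12 h₁₂ (hrgt h) (fun _ _ _ => rfl) fun _ _ _ => rfl
  have e2 : mulMap κ (mulTriple g f h ∘ₗ σ.toLinearMap) ∘ₗ act13 S₁₃ =
      mulTriple g h f ∘ₗ τ.toLinearMap ∘ₗ σ.toLinearMap :=
    mulMap_comp_act13 h₁₃ (hlft g) (fun _ _ _ => mul_assoc _ _ _) fun _ _ _ => mul_assoc _ _ _
  have e3 : mulMap κ (mulTriple g h f ∘ₗ τ.toLinearMap ∘ₗ σ.toLinearMap) ∘ₗ act23 S₂₃ =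
      mulTriple h g f ∘ₗ σ.toLinearMap ∘ₗ τ.toLinearMap ∘ₗ σ.toLinearMap :=
    mulMap_comp_act23 h₂₃ (hrgt f) (fun _ _ _ => rfl) fun _ _ _ => rfl
  have e4 : mulMap κ (mulTriple f g h) ∘ₗ act23 S₂₃ = mulTriple f h g ∘ₗ τ.toLinearMap :=
    mulMap_comp_act23 h₂₃ (hlft f) (fun _ _ _ => mul_assoc _ _ _) fun _ _ _ => mul_assoc _ _ _
  have e5 : mulMap κ (mulTriple f h g ∘ₗ τ.toLinearMap) ∘ₗ act13 S₁₃ =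
      mulTriple h f g ∘ₗ σ.toLinearMap ∘ₗ τ.toLinearMap :=
    mulMap_comp_act13 h₁₃ (hrgt g) (fun _ _ _ => rfl) fun _ _ _ => rfl
  have e6 : mulMap κ (mulTriple h f g ∘ₗ σ.toLinearMap ∘ₗ τ.toLinearMap) ∘ₗ act12 S₁₂ =
      mulTriple h g f ∘ₗ σ.toLinearMap ∘ₗ τ.toLinearMap ∘ₗ σ.toLinearMap :=
    mulMap_comp_act12 h₁₂ (hlft h) (fun _ _ _ => mul_assoc _ _ _) fun _ _ _ => mul_assoc _ _ _
  refine LinearMap.ext fun z => hinj ?_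
  simp only [LinearMap.comp_apply]
  rw [mulMap_extendScalars, e1, mulMap_extendScalars, e2, mulMap_extendScalars, e4,
    mulMap_extendScalars, e5]
  exact (LinearMap.congr_fun e3 z).trans (LinearMap.congr_fun e6 z).symm

end Actions

section YangBaxter

variable {𝔤 : Type*} [LieRing 𝔤] [LieAlgebra ℂ 𝔤]

/-- A homomorphism on `V((x))` turns the relation that defines `𝒮` into an exchange relation. -/
theorem mulMap_comp_lTensor_braiding {R K : Type*} [Ring R] [Algebra ℂ R] [CommRing K] [Algebra ℂ K]
    {κ : K →ₐ[ℂ] R} (θ : Laurent (UNegLoop 𝔤) →ₐ[ℂ] R) (j : Laurent ℂ →ₗ[ℂ] K)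
    (hθ : ∀ c, θ (scalars _ c) = κ (j c)) {f g : UNegLoop 𝔤 →ₐ[ℂ] R}
    (hf : ∀ u, θ (field 𝔤 u) = f u) (hg : ∀ u, θ (const _ u) = g u) :
    mulMap κ (mulPair f g) ∘ₗ (j.lTensor _ ∘ₗ braiding 𝔤) = mulPairOp f g := by
  have h1 : ∀ z, mulMap κ (mulPair f g) (j.lTensor _ z) = θ (normalMap 𝔤 z) := by
    intro z
    induction z with
    | zero => simp
    | add x y hx hy => rw [map_add, map_add, map_add, map_add, hx, hy]
    | tmul w c =>
      rw [LinearMap.lTensor_tmul, mulMap_tmul, mulMap_tmul, map_mul, hθ]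
      congr 1
      induction w with
      | zero => simp
      | add x y hx hy => rw [map_add, map_add, map_add, hx, hy]
      | tmul u v => rw [mulPair_tmul, mulPair_tmul, map_mul, hf, hg]
  refine TensorProduct.ext' fun v u => ?_
  refine (h1 _).trans ?_
  rw [normalMap_braiding, mulPairOp_tmul, mulPairOp_tmul, map_mul, hf, hg]

/-- Taylor's formula: `f(x + z) = e^{z d/dx} f(x)`. -/
theorem shift_eq_inXaddZ (f : Laurent ℂ) : shift ℂ f = inXaddZ f := by
  ext1
  funext n
  rcases lt_or_ge n 0 with hn | hn
  · exact (coeff_expLin_of_neg _ _ hn).trans (if_neg (not_le.2 hn)).symm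
  · obtain ⟨n, rfl⟩ := Int.eq_ofNat_of_zero_le hn
    have h : (inXaddZ f).coeff n = LaurentSeries.hasseDeriv ℂ n f :=
      (if_pos hn : (if 0 ≤ (n : ℤ) then LaurentSeries.hasseDeriv ℂ (n : ℤ).toNat f else 0) = _)
    have h1 := LaurentSeries.derivative_iterate (R := ℂ) n f
    have h2 : (n.factorial : ℂ) ≠ 0 := by exact_mod_cast n.factorial_ne_zero
    rw [h]
    refine (coeff_expLin_natCast _ f n).trans ?_
    rw [divPow, LinearMap.smul_apply, Module.End.pow_apply, h1, ← Nat.cast_smul_eq_nsmul ℂ,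
      smul_smul, inv_mul_cancel₀ h2, one_smul]

/-- The fields at `x + z`, obtained by translating the fields at `x` by `z`. -/
theorem expHom_mapCoeff_field (u : UNegLoop 𝔤) :
    expHom (mapCoeff ℤ (dU 𝔤)) (isDeriv_dU (𝔤 := 𝔤)).mapCoeff (field 𝔤 u) =
      shift _ (field 𝔤 u) := by
  rw [← mapAlgHom_expHom isDeriv_dU isDeriv_derivative (field 𝔤) (expLin_apply_self _) u]
  exact (mapAlgHom_expHom isDeriv_dU isDeriv_dU.mapCoeff (field 𝔤)
    (fun a => (mapCoeff_expLin (dU 𝔤) (fun _ => rfl) a).symm) u).symm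

/-- The case of homomorphisms to `V((x))((z))`. -/
theorem mulMap_comp_lTensor_braiding₂
    (θ : Laurent (UNegLoop 𝔤) →ₐ[ℂ] Laurent (Laurent (UNegLoop 𝔤)))
    (j : Laurent ℂ →ₗ[ℂ] Laurent (Laurent ℂ))
    (f g : UNegLoop 𝔤 →ₐ[ℂ] Laurent (Laurent (UNegLoop 𝔤)))
    (hθ : ∀ c, θ (scalars _ c) = scalars₂ _ (j c))
    (hf : ∀ u, θ (field 𝔤 u) = f u) (hg : ∀ u, θ (const _ u) = g u) :
    mulMap (K := Laurent (Laurent ℂ)) (scalars₂ _) (mulPair f g) ∘ₗ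
      (j.lTensor _ ∘ₗ braiding 𝔤) = mulPairOp f g := by
  have h := @mulMap_comp_lTensor_braiding 𝔤 _ _ (Laurent (Laurent (UNegLoop 𝔤)))
    (Laurent (Laurent ℂ)) _ _ _ _ (scalars₂ _) θ j hθ f g hf hg
  exact h

theorem commute_scalars₂ {A : Type*} [Ring A] [Algebra ℂ A] (c : Laurent (Laurent ℂ))
    (y : Laurent (Laurent A)) : Commute (scalars₂ A c) y :=
  commute_mapAlgHom _ commute_mapAlgHom_ofId c y

/-- The exchange relation for `e^{(x + z)d} u` and `e^{zd} v`: the translate by `e^{zd}` of the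
relation that defines `𝒮(x)`. -/
theorem exchange_x : mulMap (K := Laurent (Laurent ℂ)) (scalars₂ _)
    (mulPair ((shift _).comp (field 𝔤)) ((atZ _).comp (field 𝔤))) ∘ₗ
      (inX.lTensor _ ∘ₗ braiding 𝔤) =
    mulPairOp ((shift _).comp (field 𝔤)) ((atZ _).comp (field 𝔤)) := by
  refine mulMap_comp_lTensor_braiding₂
    (expHom (mapCoeff ℤ (dU 𝔤)) (isDeriv_dU (𝔤 := 𝔤)).mapCoeff) inX _ _ (fun c => ?_)
    expHom_mapCoeff_field fun u => ?_
  · have h : mapCoeff ℤ (dU 𝔤) (scalars _ c) = 0 := by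
      ext n
      change dU 𝔤 (algebraMap ℂ _ (c.coeff n)) = 0
      rw [Algebra.algebraMap_eq_smul_one, map_smul, isDeriv_dU.map_one, smul_zero]
    rw [expHom_apply, expLin_eq_single _ h]
    exact (mapAlgHom_single _ _ _).symm
  · exact (mapAlgHom_expHom isDeriv_dU isDeriv_dU.mapCoeff (const _)
      (fun a => (mapCoeff_single _ _ _).symm) u).symm

/-- The exchange relation for `e^{(x + z)d} u` and `w`: the substitution `x ↦ x + z` in the relation
that defines `𝒮(x)`. -/
theorem exchange_xz : mulMap (K := Laurent (Laurent ℂ)) (scalars₂ _)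
    (mulPair ((shift _).comp (field 𝔤)) ((const _).comp (const _))) ∘ₗ
      (inXaddZ.lTensor _ ∘ₗ braiding 𝔤) =
    mulPairOp ((shift _).comp (field 𝔤)) ((const _).comp (const _)) := by
  refine mulMap_comp_lTensor_braiding₂ (shift _) inXaddZ _ _ (fun c => ?_) (fun _ => rfl)
    fun u => ?_
  · rw [← shift_eq_inXaddZ]
    refine (mapAlgHom_expHom isDeriv_derivative isDeriv_derivative (scalars _) (fun a => ?_) c).symm
    ext n
    simp
  · refine expLin_eq_single _ ?_
    ext n
    have h0 : (LaurentSeries.derivative ℂ (const _ u)).coeff n =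
        (n + 1) • (HahnSeries.single (0 : ℤ) u).coeff (n + 1) := by
      simp
      rfl
    rw [h0]
    rcases eq_or_ne (n + 1) 0 with h | h
    · rw [h, zero_smul, HahnSeries.coeff_zero]
    · rw [HahnSeries.coeff_single_of_ne h, smul_zero, HahnSeries.coeff_zero]

/-- The exchange relation for `e^{zd} v` and `w`: the substitution `x ↦ z` in the relation that
defines `𝒮(x)`. -/
theorem exchange_z : mulMap (K := Laurent (Laurent ℂ)) (scalars₂ _)
    (mulPair ((atZ _).comp (field 𝔤)) ((const _).comp (const _))) ∘ₗ
      (inZ.lTensor _ ∘ₗ braiding 𝔤) =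
    mulPairOp ((atZ _).comp (field 𝔤)) ((const _).comp (const _)) := by
  refine mulMap_comp_lTensor_braiding₂ (atZ _) inZ _ _ (fun c => ?_) (fun _ => rfl) fun u => ?_
  · ext1
    funext n
    exact (mapAlgHom_single _ _ _).symm
  · exact mapAlgHom_single _ _ _

theorem quantumYangBaxter_braiding : QuantumYangBaxter (braiding 𝔤) := by
  have h (hκ) (hinj) := @braidEquation_of_exchange (UNegLoop 𝔤) (Laurent (Laurent (UNegLoop 𝔤)))
    (Laurent (Laurent ℂ)) _ _ _ _ _ _ (scalars₂ _) ((shift _).comp (field 𝔤))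
    ((atZ _).comp (field 𝔤)) ((const _).comp (const _)) hκ hinj
  exact h (fun c y => commute_scalars₂ c y) mulMap_mulTriple_injective exchange_x exchange_xz
    exchange_z

end YangBaxter

end QuantumVA

end

theorem proposition3p22 {𝔤 : Type*} [LieRing 𝔤] [LieAlgebra ℂ 𝔤]
    (hdim : Module.rank ℂ 𝔤 ≤ Cardinal.aleph0) :
    QuantumVA.IsNonlocalVertexAlgebra (QuantumVA.vertexOperator 𝔤) 1 ∧
    QuantumVA.IsNondegenerate (QuantumVA.vertexOperator 𝔤) 1 ∧
    ∃ S : QuantumVA.SOperator (QuantumVA.UNegLoop 𝔤),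
      QuantumVA.IsQuantumVertexAlgebra (QuantumVA.vertexOperator 𝔤) 1 S ∧
      (∀ S' : QuantumVA.SOperator (QuantumVA.UNegLoop 𝔤),
        QuantumVA.IsQuantumVertexAlgebra (QuantumVA.vertexOperator 𝔤) 1 S' → S' = S) ∧
      (¬ IsLieAbelian 𝔤 → S ≠ QuantumVA.trivialS (QuantumVA.UNegLoop 𝔤)) := by
  have hvac := QuantumVA.vacuumAxioms_derivationY (QuantumVA.isDeriv_dU (𝔤 := 𝔤))
  refine ⟨⟨hvac, fun u v w => ⟨0, QuantumVA.weakAssoc_derivationY QuantumVA.isDeriv_dU u v w⟩⟩,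
    QuantumVA.isNondegenerate_vertexOperator 𝔤, QuantumVA.braiding 𝔤, ?_,
    fun _ => QuantumVA.eq_braiding_of_isQuantumVertexAlgebra,
    fun h h' => h (QuantumVA.isLieAbelian_of_braiding_eq_trivialS h')⟩
  exact
    { toIsWeakQuantumVertexAlgebra := ⟨hvac, fun u v => by
        obtain ⟨r, v', u', f, -, h⟩ := QuantumVA.sJacobi_braiding u v
        exact ⟨r, v', u', f, h⟩⟩
      unitary := QuantumVA.unitary_braiding
      quantumYangBaxter := QuantumVA.quantumYangBaxter_braiding
      sJacobi_S := QuantumVA.sJacobi_braiding }
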